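/- Let $\mathcal D$ be the distribution of a triple $(C,P,D)\in[0,1]^3$ (production cost, retail price, demand) such that: $\mathbb E[C]<\mathbb E[P]$; $D$ and $C$ are conditionally independent given $P$; the conditional distribution of $D$ given $P$ has a density $f(d\mid p)$ with respect to the Lebesgue measure on $[0,1]$ with $f(d\mid p)>L$ for all $(p,d)\in[0,1]^2$, where $L>0$; and the following stage game has a unique Stackelberg equilibrium $(w^\star,q^\star)$. For a wholesale price $w\ge 0$ and a quantity $q\ge 0$ let $\sigma(w;q,c)=qw-qc$, $\rho(q;w,p,d)=\min\{q,d\}\,p-qw$, $u_S(w,q)=\mathbb E[\sigma(w;q,C)]$ and $u_R(w,q)=\mathbb E[\rho(q;w,P,D)]$; a pair $(w,q)$ is a Stackelberg equilibrium if there is a function $\mathrm{BR}$ with $\mathrm{BR}(w')\in\arg\max_{q'\ge 0}u_R(w',q')$ for all $w'\ge 0$ such that $w\in\arg\max_{w'\ge 0}u_S(w',\mathrm{BR}(w'))$ and $q=\mathrm{BR}(w)$. In the repeated game, at each round $t=1,2,\dots$ Nature draws $(C_t,P_t,D_t)$ i.i.d. from $\mathcal D$, the supplier selects a wholesale price $W_t$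 and reveals it to the retailer, the cost $C_t$ is revealed to the supplier, the retailer buys a quantity $Q_t$, and $P_t,D_t$ are revealed to the retailer. For a horizon $T\ge 12$ let $N=\lceil T^{1/3}\rceil$ and let both players use the following strategies with input $T$, with arbitrary tie-breaking (possibly randomized, but not depending on current or future draws of Nature). Supplier (Explore-Then-Commit): for $t=1,\dots,N+1$ and $s=1,\dots,N$, $W_{(t-1)N+s}=s/(N+1)$; then $W_t=W_{S^\star}$ for all $t=(N+1)N+1,\dots,T$, where $S^\star\in\arg\max_{s=N^2+1,\dots,(N+1)N}Q_s\bigl(W_s-\frac1{N^2}\sum_{j=1}^{N^2}C_j\bigr)$. Retailer (Follow-the-Leader): $Q_1$ is uniform on the grid $\mathcal Q=\{\frac1{N+1},\dots,\frac N{N+1}\}$, and for $t\ge 2$, $Q_t\in\arg\max_{q\in\mathcal Q}\bigl(\frac1{t-1}\sum_{s=1}^{t-1}\min\{q,D_s\}P_s-qW_t\bigr)$. Then, for every horizon $T\ge 12$, $$\mathbb E[\sigma(w^\star;q^\star,C)]-\frac1T\sum_{t=1}^T\mathbb E[\sigma(W_t;Q_t,C_t)]\le\Bigl(16+\frac{1-\mathbb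 E[C]}{\mathbb E[P]\,L}+7\sqrt{\ln T}\Bigr)T^{-1/3}.$$ Moreover, if for each horizon $T\ge 12$ a play with input $T$ is given, all defined on one probability space, and $(W_t,Q_t)$, $(C_t,P_t,D_t)$ below denote the variables of the play with input $T$, then: 1. with probability $1$, $\displaystyle\lim_{T\to\infty}\Bigl(\mathbb E[\rho(q^\star;w^\star,P,D)]-\frac1T\sum_{t=1}^T\mathbb E[\rho(Q_t;W_t,P_t,D_t)\mid W_t]\Bigr)=0$; 2. with probability $1$, $\displaystyle\lim_{T\to\infty}\bigl\|(w^\star,q^\star)-(W_T,Q_T)\bigr\|_1=0$. -/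

import Mathlib

open MeasureTheory ProbabilityTheory Filter Topology

namespace SupplyChain

noncomputable section

/-- One draw of Nature: a triple `(C, P, D)` of production cost, retail price and demand. -/
abbrev Outcome : Type := ℝ × ℝ × ℝ

/-- Production cost `C`. -/
def cost (x : Outcome) : ℝ := x.1

/-- Retail price `P`. -/
def price (x : Outcome) : ℝ := x.2.1

/-- Demand `D`. -/
def demand (x : Outcome) : ℝ := x.2.2

lemma measurable_price : Measurable price := measurable_snd.fst

/-- Realized utility of the supplier, `σ(w; q, c) = q w - q c`. -/
def sigma (w q c : ℝ) : ℝ := q * w - q * c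

/-- Realized utility of the retailer, `ρ(q; w, p, d) = min {q, d} p - q w`. -/
def rho (q w p d : ℝ) : ℝ := min q d * p - q * w

/-! ### The stage game -/

/-- Expected utility of the supplier, `u_S(w, q) = q w - q E[C]`. -/
def uS (𝒟 : Measure Outcome) (w q : ℝ) : ℝ := q * w - q * ∫ x, cost x ∂𝒟

/-- Expected utility of the retailer, `u_R(w, q) = E[min {q, D} P] - q w`. -/
def uR (𝒟 : Measure Outcome) (w q : ℝ) : ℝ := (∫ x, min q (demand x) * price x ∂𝒟) - q * w

/-- `q` is a best response of the retailer to the wholesale price `w`: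
`q ∈ argmax_{q' ∈ [0, ∞)} u_R(w, q')`. -/
def IsBestResponse (𝒟 : Measure Outcome) (w q : ℝ) : Prop :=
  0 ≤ q ∧ IsMaxOn (uR 𝒟 w) (Set.Ici 0) q

/-- `(w, q)` is a Stackelberg equilibrium: for some best-response function `BR` of the retailer,
`w ∈ argmax_{w' ∈ [0, ∞)} u_S(w', BR(w'))` and `q = BR(w)`. -/
def IsStackelberg (𝒟 : Measure Outcome) (w q : ℝ) : Prop :=
  ∃ BR : ℝ → ℝ, (∀ w', 0 ≤ w' → IsBestResponse 𝒟 w' (BR w')) ∧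
    0 ≤ w ∧ IsMaxOn (fun w' => uS 𝒟 w' (BR w')) (Set.Ici 0) w ∧ q = BR w

/-- The standing assumption on the distribution `𝒟` of `(C, P, D)`, where `L` is a strict lower
bound on the conditional density of `D` given `P`. -/
structure LearningAssumption (𝒟 : Measure Outcome) [IsProbabilityMeasure 𝒟] (L : ℝ) : Prop where
  /-- `𝒟` is a distribution on `[0,1]^3`. -/
  support : ∀ᵐ x ∂𝒟,
    cost x ∈ Set.Icc (0 : ℝ) 1 ∧ price x ∈ Set.Icc (0 : ℝ) 1 ∧ demand x ∈ Set.Icc (0 : ℝ) 1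
  /-- `E[C] < E[P]`. -/
  mean_lt : ∫ x, cost x ∂𝒟 < ∫ x, price x ∂𝒟
  /-- `D` and `C` are conditionally independent given `P`. -/
  condIndep : CondIndepFun (MeasurableSpace.comap price inferInstance)
    measurable_price.comap_le demand cost 𝒟
  /-- `L` is positive. -/
  pos : 0 < L
  /-- The conditional distribution of `D` given `P` has a density `f(d | p)` with respect to the
  Lebesgue measure on `[0,1]`, and `f(d | p) > L` for all `(p, d) ∈ [0,1]^2`. -/
  density : ∃ f : ℝ → ℝ → ℝ, Measurable (Function.uncurry f) ∧
    (∀ᵐ p ∂(𝒟.map price), condDistrib demand price 𝒟 p =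
      (volume.restrict (Set.Icc (0 : ℝ) 1)).withDensity fun d => ENNReal.ofReal (f p d)) ∧
    ∀ p ∈ Set.Icc (0 : ℝ) 1, ∀ d ∈ Set.Icc (0 : ℝ) 1, L < f p d
  /-- The stage game has a unique Stackelberg equilibrium. -/
  unique_equilibrium : ∃! s : ℝ × ℝ, IsStackelberg 𝒟 s.1 s.2

/-! ### The repeated game

Rounds are numbered `1, …, T`. In round `t`, `X t` is the triple `(C_t, P_t, D_t)` drawn by Nature,
`W t` is the wholesale price and `Q t` is the quantity. -/

section Repeated

variable {Ω : Type*} [MeasurableSpace Ω]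

/-- The online protocol up to round `T`: Nature's draws are i.i.d. with law `𝒟`, and the players
act without knowledge of the current and future draws. Here `ℱ t` collects what has happened up to
the moment at which `Q_t` has been selected (past draws, moves, private randomization of the players
used so far, for the first quantity or for breaking ties); the draw of round `t` has law `𝒟`
and is independent of `ℱ t`, and it belongs to `ℱ (t + 1)`. -/
def FollowsProtocol (𝒟 : Measure Outcome) (μ : Measure Ω) (T : ℕ) (X : ℕ → Ω → Outcome)
    (W Q : ℕ → Ω → ℝ) : Prop :=
  ∃ ℱ : Filtration ℕ (inferInstance : MeasurableSpace Ω), ∀ t ∈ Finset.Icc 1 T,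
    Measurable[ℱ t] (W t) ∧ Measurable[ℱ t] (Q t) ∧ Measurable[ℱ (t + 1)] (X t) ∧
    HasLaw (X t) 𝒟 μ ∧ Indep (MeasurableSpace.comap (X t) inferInstance) (ℱ t) μ

/-- `⌈T^{1/3}⌉`. -/
def gridSize (T : ℕ) : ℕ := ⌈(T : ℝ) ^ (1 / 3 : ℝ)⌉₊

/-- `⌈T^{1/3} + 1⌉`, the number of exploration blocks. -/
def blocks (T : ℕ) : ℕ := ⌈(T : ℝ) ^ (1 / 3 : ℝ) + 1⌉₊

/-- Estimate of `E[C]`: the average of the first `⌈T^{1/3}⌉ ^ 2` production costs. -/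
def costEstimate (T : ℕ) (X : ℕ → Ω → Outcome) (ω : Ω) : ℝ :=
  1 / ((gridSize T : ℝ) ^ 2) * ∑ j ∈ Finset.Icc 1 (gridSize T ^ 2), cost (X j ω)

/-- The supplier runs Explore-Then-Commit (without knowledge of `E[C]`) with input `T`: the grid of
wholesale prices is swept `⌈T^{1/3} + 1⌉` times; then the supplier commits to the price of a round
`S` of the last sweep that maximizes the estimated utility. Ties are broken arbitrarily. -/
def RunsETC (T : ℕ) (X : ℕ → Ω → Outcome) (W Q : ℕ → Ω → ℝ) : Prop :=
  (∀ ω, ∀ t ∈ Finset.Icc 1 (blocks T), ∀ s ∈ Finset.Icc 1 (gridSize T),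
    W ((t - 1) * gridSize T + s) ω = (s : ℝ) / ((gridSize T : ℝ) + 1)) ∧
  ∀ ω, ∃ S ∈ Finset.Icc (gridSize T ^ 2 + 1) (blocks T * gridSize T),
    (∀ s ∈ Finset.Icc (gridSize T ^ 2 + 1) (blocks T * gridSize T),
      Q s ω * (W s ω - costEstimate T X ω) ≤ Q S ω * (W S ω - costEstimate T X ω)) ∧
    ∀ t ∈ Finset.Icc (blocks T * gridSize T + 1) T, W t ω = W S ω

/-- The grid `{1/(⌈T^{1/3}⌉ + 1), …, ⌈T^{1/3}⌉/(⌈T^{1/3}⌉ + 1)}` of quantities. -/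
def quantityGrid (T : ℕ) : Set ℝ :=
  {q | ∃ k ∈ Finset.Icc 1 (gridSize T), q = (k : ℝ) / ((gridSize T : ℝ) + 1)}

/-- The empirical utility `(1/(t-1)) ∑_{s=1}^{t-1} min {q, D_s} P_s - q w` of the retailer. -/
def empiricalUtility (X : ℕ → Ω → Outcome) (t : ℕ) (w q : ℝ) (ω : Ω) : ℝ :=
  1 / ((t : ℝ) - 1) * (∑ s ∈ Finset.Icc 1 (t - 1), min q (demand (X s ω)) * price (X s ω)) - q * w

/-- The retailer runs Follow-the-Leader with input `T`: the first quantity is uniform on the grid,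
then each quantity maximizes the empirical utility over the grid. Ties are broken arbitrarily. -/
def RunsFTL (μ : Measure Ω) (T : ℕ) (X : ℕ → Ω → Outcome) (W Q : ℕ → Ω → ℝ) : Prop :=
  (∀ ω, Q 1 ω ∈ quantityGrid T) ∧ HasLaw (Q 1) (uniformOn (quantityGrid T)) μ ∧
  ∀ ω, ∀ t ∈ Finset.Icc 2 T, Q t ω ∈ quantityGrid T ∧
    IsMaxOn (fun q => empiricalUtility X t (W t ω) q ω) (quantityGrid T) (Q t ω)

/-- A play of the repeated game up to the horizon `T` in which the supplier runs
Explore-Then-Commit and the retailer runs Follow-the-Leader, both with input `T`. -/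
structure IsPlay (𝒟 : Measure Outcome) (μ : Measure Ω) (T : ℕ) (X : ℕ → Ω → Outcome)
    (W Q : ℕ → Ω → ℝ) : Prop where
  protocol : FollowsProtocol 𝒟 μ T X W Q
  supplier : RunsETC T X W Q
  retailer : RunsFTL μ T X W Q

end Repeated

end

end SupplyChain

/-!
The retailer faced with a price `w` solves a concave problem, whose first-order condition involves
the marginal revenue `g q = E[P 1{D > q}]`. The lower bound on the density makes `g` strictly
decreasing on `[0,1]` with slope at least `a = E[P] L`
(`LearningAssumption.marginalRevenue_sub_ge`), so the best response to `w = g q` is `q`, the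
supplier effectively maximizes `supplierValue q = q (g q - E[C])`, and a unique equilibrium is a pair
`(g q, q)` with `q` the only maximizer (`LearningAssumption.equilibrium`).

Follow-the-Leader does the same with the empirical marginal revenue, up to a grid step
(`IsRealization.leader_bracket`). Two consequences hold along every realization. If the empirical
marginal revenue is not much too low at one grid point below the equilibrium quantity, then some
price of the last sweep is nearly optimal (`exists_good_price`), and the committed price is at least
as good up to the error of the cost estimate. The quantities bought at the committed price in the
last sweep and later differ by at most `(α + β) / a` plus two grid steps, where `α` and `β` bound
the deviations of the empirical marginal revenue at both times
(`IsRealization.quantity_sub_le`). These facts give the loss of a round (`IsCommitment.loss_le`,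
`IsPlay.loss_le`).

The coefficient of `(1 - E[C]) / (E[P] L)` in the regret bound carries no logarithm, so the
deviations `α`, `β`, which are maxima over the whole grid, must have means of order `n^{-1/2}` with
a constant below `1`. Writing a marginal sale as an average over `u` of indicators of
`{P > u, D > q}` reduces this to counts of nested events. Between quantiles of equal
probability the increments of these counts are exchangeable, and Spitzer's identity
(`integral_walkMax_eq`) expresses the mean of the maximum through the second moments of single
counts: `∑ √(r (1 - r)) / k` over `r = k / m` is at most `∫ √((1 - r) / r) dr` in the limit, which
is at most `5/3` (`integral_walkMax_labels_le`, `IidDraws.integral_supDev_le`). Hoeffding's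
inequality takes care of the short last sweep and of the single grid point; these events are where
`√(ln T)` comes from. Summing the means of the losses over the rounds yields `IsPlay.regret_le`.

For the convergence, a union bound over all rounds from the last sweep on and all grid points shows
that the empirical marginal revenue or the cost estimate is ever off by more than `ε` only with
probability `O(T^{-2})`. Outside this event all moves after the commitment are close to the
equilibrium, since the maximum of `supplierValue` is strict (`LearningAssumption.exists_accuracy`).
The Borel–Cantelli lemma gives the convergence of the last moves. For the conditional utilities,
the price and demand of a round are independent of its wholesale price, and the conditional
probabilities of the exceptional event have summable means, so that they also tend to zero almost
surely.
-/

namespace SupplyChain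

/-! ### Marginal revenue and the stage game -/

lemma measurable_cost : Measurable cost := measurable_fst

lemma measurable_demand : Measurable demand := measurable_snd.snd

/-- The price if the demand exceeds `q`, and `0` otherwise: the revenue from an additional unit
when `q` units have been bought. -/
noncomputable def marginalSale (q : ℝ) (x : Outcome) : ℝ := {y | q < demand y}.indicator price x

/-- The marginal revenue `E[P 1{D > q}]` of the retailer, i.e. the inverse demand function that the
supplier faces. -/
noncomputable def marginalRevenue (𝒟 : Measure Outcome) (q : ℝ) : ℝ := ∫ x, marginalSale q x ∂𝒟

lemma measurable_marginalSale (q : ℝ) : Measurable (marginalSale q) :=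
  measurable_price.indicator (measurableSet_lt measurable_const measurable_demand)

lemma marginalSale_mem_Icc {x : Outcome} (hx : price x ∈ Set.Icc (0 : ℝ) 1) (q : ℝ) :
    marginalSale q x ∈ Set.Icc (0 : ℝ) 1 := by
  unfold marginalSale
  by_cases h : x ∈ {y | q < demand y}
  · rwa [Set.indicator_of_mem h]
  · rw [Set.indicator_of_notMem h]; simp

lemma marginalSale_antitone {x : Outcome} (hx : 0 ≤ price x) {q q' : ℝ} (h : q ≤ q') :
    marginalSale q' x ≤ marginalSale q x := by
  unfold marginalSale
  by_cases h1 : q' < demand x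
  · have h2 : q < demand x := lt_of_le_of_lt h h1
    simp [h1, h2]
  · by_cases h2 : q < demand x <;> simp [h1, h2, hx]

/-- `marginalSale q x` is a supergradient at `q` of the revenue `q ↦ min q d * p`. -/
lemma revenue_sub_le {x : Outcome} (hx : 0 ≤ price x) (q q' : ℝ) :
    min q' (demand x) * price x - min q (demand x) * price x ≤ (q' - q) * marginalSale q x := by
  unfold marginalSale
  by_cases h : q < demand x
  · simp only [Set.mem_ofPred_eq, h, Set.indicator_of_mem, min_eq_left h.le]
    nlinarith [min_le_left q' (demand x)]
  · simp only [Set.mem_ofPred_eq, h, not_false_eq_true, Set.indicator_of_notMem,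
      min_eq_right (not_lt.1 h)]
    nlinarith [min_le_right q' (demand x)]

section Law

variable {𝒟 : Measure Outcome} [IsProbabilityMeasure 𝒟] {L : ℝ}

lemma LearningAssumption.price_mem (h : LearningAssumption 𝒟 L) :
    ∀ᵐ x ∂𝒟, price x ∈ Set.Icc (0 : ℝ) 1 := h.support.mono fun _ hx => hx.2.1

lemma LearningAssumption.demand_mem (h : LearningAssumption 𝒟 L) :
    ∀ᵐ x ∂𝒟, demand x ∈ Set.Icc (0 : ℝ) 1 := h.support.mono fun _ hx => hx.2.2

lemma LearningAssumption.cost_mem (h : LearningAssumption 𝒟 L) :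
    ∀ᵐ x ∂𝒟, cost x ∈ Set.Icc (0 : ℝ) 1 := h.support.mono fun _ hx => hx.1

lemma integrable_of_ae_mem_Icc {α : Type*} [MeasurableSpace α] {μ : Measure α} [IsFiniteMeasure μ]
    {f : α → ℝ} (hf : Measurable f) {a b : ℝ} (h : ∀ᵐ x ∂μ, f x ∈ Set.Icc a b) :
    Integrable f μ :=
  Integrable.of_mem_Icc a b hf.aemeasurable h

lemma integral_mem_Icc_of_ae {α : Type*} [MeasurableSpace α] {μ : Measure α}
    [IsProbabilityMeasure μ] {f : α → ℝ} (hf : Measurable f) {a b : ℝ}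
    (h : ∀ᵐ x ∂μ, f x ∈ Set.Icc a b) : ∫ x, f x ∂μ ∈ Set.Icc a b := by
  have hi := integrable_of_ae_mem_Icc hf h
  constructor
  · simpa using integral_mono_ae (integrable_const a) hi (h.mono fun x hx => hx.1)
  · simpa using integral_mono_ae hi (integrable_const b) (h.mono fun x hx => hx.2)

lemma LearningAssumption.marginalSale_mem (h : LearningAssumption 𝒟 L) (q : ℝ) :
    ∀ᵐ x ∂𝒟, marginalSale q x ∈ Set.Icc (0 : ℝ) 1 :=
  h.price_mem.mono fun _ hx => marginalSale_mem_Icc hx q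

lemma LearningAssumption.integrable_marginalSale (h : LearningAssumption 𝒟 L) (q : ℝ) :
    Integrable (marginalSale q) 𝒟 :=
  integrable_of_ae_mem_Icc (measurable_marginalSale q) (h.marginalSale_mem q)

lemma LearningAssumption.integrable_price (h : LearningAssumption 𝒟 L) : Integrable price 𝒟 :=
  integrable_of_ae_mem_Icc measurable_price h.price_mem

lemma LearningAssumption.marginalRevenue_mem (h : LearningAssumption 𝒟 L) (q : ℝ) :
    marginalRevenue 𝒟 q ∈ Set.Icc (0 : ℝ) 1 :=
  integral_mem_Icc_of_ae (measurable_marginalSale q) (h.marginalSale_mem q)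

lemma LearningAssumption.mean_cost_mem (h : LearningAssumption 𝒟 L) :
    ∫ x, cost x ∂𝒟 ∈ Set.Icc (0 : ℝ) 1 := integral_mem_Icc_of_ae measurable_cost h.cost_mem

lemma LearningAssumption.mean_price_pos (h : LearningAssumption 𝒟 L) : 0 < ∫ x, price x ∂𝒟 :=
  h.mean_cost_mem.1.trans_lt h.mean_lt

lemma LearningAssumption.marginalRevenue_antitone (h : LearningAssumption 𝒟 L) :
    Antitone (marginalRevenue 𝒟) := fun q q' hq =>
  integral_mono_ae (h.integrable_marginalSale q') (h.integrable_marginalSale q)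
    (h.price_mem.mono fun _ hx => marginalSale_antitone hx.1 hq)

/-- Disintegration of the joint law of price and demand along the price. -/
lemma lintegral_price_demand (s : Set ℝ) (hs : MeasurableSet s) (φ : ℝ → ENNReal)
    (hφ : Measurable φ) :
    ∫⁻ x, φ (price x) * s.indicator 1 (demand x) ∂𝒟
      = ∫⁻ p, φ p * condDistrib demand price 𝒟 p s ∂(𝒟.map price) := by
  have h1 := compProd_map_condDistrib (mβ := inferInstance) (μ := 𝒟) (X := price) (Y := demand)
    measurable_demand.aemeasurable
  have hm : Measurable fun y : ℝ × ℝ => φ y.1 * s.indicator 1 y.2 :=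
    (hφ.comp measurable_fst).mul ((measurable_one.indicator hs).comp measurable_snd)
  have h2 : ∫⁻ x, φ (price x) * s.indicator 1 (demand x) ∂𝒟
      = ∫⁻ y, φ y.1 * s.indicator 1 y.2 ∂(𝒟.map fun a => (price a, demand a)) := by
    rw [lintegral_map hm (measurable_price.prodMk measurable_demand)]
  rw [h2, ← h1, Measure.lintegral_compProd hm]
  refine lintegral_congr fun p => ?_
  simp only [lintegral_const_mul _ (measurable_one.indicator hs), lintegral_indicator_one hs]

lemma LearningAssumption.measure_demand_eq (h : LearningAssumption 𝒟 L) (q : ℝ) :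
    𝒟 {x | demand x = q} = 0 := by
  obtain ⟨f, -, hf, -⟩ := h.density
  have h1 := lintegral_price_demand (𝒟 := 𝒟) {q} (measurableSet_singleton q) 1 measurable_one
  have h2 : ∫⁻ p, (1 : ℝ → ENNReal) p * condDistrib demand price 𝒟 p {q} ∂(𝒟.map price) = 0 := by
    rw [← lintegral_zero (μ := 𝒟.map price)]
    refine lintegral_congr_ae ?_
    filter_upwards [hf] with p hp
    rw [hp, withDensity_absolutelyContinuous _ _ (by simp), mul_zero]
  rw [h2] at h1
  have h3 : ∫⁻ x, (1 : ℝ → ENNReal) (price x) * ({q} : Set ℝ).indicator 1 (demand x) ∂𝒟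
      = 𝒟 (demand ⁻¹' {q}) := by
    rw [← lintegral_indicator_one (measurable_demand (measurableSet_singleton q))]
    refine lintegral_congr fun x => ?_
    simp [Set.indicator]
  exact h3.symm.trans h1

lemma LearningAssumption.demand_pos (h : LearningAssumption 𝒟 L) : ∀ᵐ x ∂𝒟, 0 < demand x := by
  have : ∀ᵐ x ∂𝒟, demand x ≠ 0 := h.measure_demand_eq 0 |> fun h0 => by
    rw [ae_iff]; simpa using h0
  filter_upwards [h.demand_mem, this] with x h1 h2 using lt_of_le_of_ne h1.1 h2.symm

lemma LearningAssumption.marginalRevenue_zero (h : LearningAssumption 𝒟 L) :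
    marginalRevenue 𝒟 0 = ∫ x, price x ∂𝒟 := by
  refine integral_congr_ae (h.demand_pos.mono fun x hx => ?_)
  simp [marginalSale, hx]

lemma LearningAssumption.marginalRevenue_of_one_le (h : LearningAssumption 𝒟 L) {q : ℝ}
    (hq : 1 ≤ q) : marginalRevenue 𝒟 q = 0 := by
  have : marginalSale q =ᵐ[𝒟] 0 := h.demand_mem.mono fun x hx => by
    simp [marginalSale, hx.2.trans hq]
  rw [marginalRevenue, integral_congr_ae this]; simp

lemma LearningAssumption.continuous_marginalRevenue (h : LearningAssumption 𝒟 L) :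
    Continuous (marginalRevenue 𝒟) := by
  rw [continuous_iff_continuousAt]
  intro q
  refine continuousAt_of_dominated (bound := fun _ => 1)
    (Eventually.of_forall fun q' => (measurable_marginalSale q').aestronglyMeasurable)
    (Eventually.of_forall fun q' => (h.marginalSale_mem q').mono fun x hx => ?_)
    (integrable_const _) ?_
  · rw [Real.norm_eq_abs, abs_le]; constructor <;> linarith [hx.1, hx.2]
  · have : ∀ᵐ x ∂𝒟, demand x ≠ q := by
      rw [ae_iff]; simpa using h.measure_demand_eq q
    filter_upwards [this] with x hx
    rcases lt_or_gt_of_ne hx with h1 | h1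
    · refine ContinuousAt.congr (f := fun _ => (0 : ℝ)) continuousAt_const ?_
      filter_upwards [lt_mem_nhds h1] with q' hq'
      simp [marginalSale, hq'.le]
    · refine ContinuousAt.congr (f := fun _ => price x) continuousAt_const ?_
      filter_upwards [gt_mem_nhds h1] with q' hq'
      simp [marginalSale, hq']

/-- The density bound makes the marginal revenue strictly decreasing, at rate `E[P] L`. -/
lemma LearningAssumption.marginalRevenue_sub_ge (h : LearningAssumption 𝒟 L) {q q' : ℝ}
    (hq : 0 ≤ q) (hqq : q ≤ q') (hq' : q' ≤ 1) :
    (∫ x, price x ∂𝒟) * L * (q' - q) ≤ marginalRevenue 𝒟 q - marginalRevenue 𝒟 q' := by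
  obtain ⟨f, hfm, hf, hL⟩ := h.density
  have hsub : Set.Ioc q q' ⊆ Set.Icc (0 : ℝ) 1 := fun d hd => ⟨hq.trans hd.1.le, hd.2.trans hq'⟩
  have hprice : ∀ᵐ p ∂(𝒟.map price), p ∈ Set.Icc (0 : ℝ) 1 := by
    exact (ae_map_iff measurable_price.aemeasurable measurableSet_Icc).2 h.price_mem
  have key := lintegral_price_demand (𝒟 := 𝒟) (Set.Ioc q q') measurableSet_Ioc ENNReal.ofReal
    ENNReal.measurable_ofReal
  have hge : ∫⁻ p, ENNReal.ofReal p * ENNReal.ofReal (L * (q' - q)) ∂(𝒟.map price)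
      ≤ ∫⁻ p, ENNReal.ofReal p * condDistrib demand price 𝒟 p (Set.Ioc q q') ∂(𝒟.map price) := by
    refine lintegral_mono_ae ?_
    filter_upwards [hf, hprice] with p hp hp1
    gcongr
    rw [hp, withDensity_apply _ measurableSet_Ioc, Measure.restrict_restrict measurableSet_Ioc,
      Set.inter_eq_left.2 hsub]
    calc ENNReal.ofReal (L * (q' - q)) = ∫⁻ _ in Set.Ioc q q', ENNReal.ofReal L := by
          rw [setLIntegral_const, Real.volume_Ioc, ENNReal.ofReal_mul h.pos.le]
      _ ≤ _ := setLIntegral_mono' measurableSet_Ioc fun d hd =>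
          ENNReal.ofReal_le_ofReal (hL p hp1 d (hsub hd)).le
  rw [← key, lintegral_mul_const _ ENNReal.measurable_ofReal,
    lintegral_map ENNReal.measurable_ofReal measurable_price] at hge
  have e1 : ∫⁻ x, ENNReal.ofReal (price x) ∂𝒟 = ENNReal.ofReal (∫ x, price x ∂𝒟) :=
    (ofReal_integral_eq_lintegral_ofReal h.integrable_price
      (h.price_mem.mono fun x hx => hx.1)).symm
  have e2 : ∫⁻ x, ENNReal.ofReal (price x) * (Set.Ioc q q').indicator 1 (demand x) ∂𝒟
      = ENNReal.ofReal (marginalRevenue 𝒟 q - marginalRevenue 𝒟 q') := by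
    rw [marginalRevenue, marginalRevenue, ← integral_sub (h.integrable_marginalSale q)
      (h.integrable_marginalSale q'), ofReal_integral_eq_lintegral_ofReal
      (f := fun x => marginalSale q x - marginalSale q' x)
      ((h.integrable_marginalSale q).sub (h.integrable_marginalSale q'))
      (h.price_mem.mono fun x hx => sub_nonneg.2 (marginalSale_antitone hx.1 hqq))]
    refine lintegral_congr fun x => ?_
    by_cases h1 : q < demand x
    · by_cases h2 : q' < demand x
      · simp [marginalSale, h1, h2]
      · simp [marginalSale, h1, h2, not_lt.1 h2]
    · have h2 : ¬ q' < demand x := fun h' => h1 (hqq.trans_lt h')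
      simp [marginalSale, h1, h2]
  rw [e1, e2, ← ENNReal.ofReal_mul h.mean_price_pos.le, ENNReal.ofReal_le_ofReal_iff
    (sub_nonneg.2 (h.marginalRevenue_antitone hqq))] at hge
  linarith

lemma LearningAssumption.integrable_revenue (h : LearningAssumption 𝒟 L) (q : ℝ) :
    Integrable (fun x => min q (demand x) * price x) 𝒟 := by
  refine integrable_of_ae_mem_Icc (a := -|q|) (b := 1)
    ((measurable_const.min measurable_demand).mul measurable_price) ?_
  filter_upwards [h.price_mem, h.demand_mem] with x h1 h2
  constructor
  · have : -|q| ≤ min q (demand x) := le_min (neg_abs_le q) (by linarith [abs_nonneg q, h2.1])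
    nlinarith [h1.1, h1.2, abs_nonneg q]
  · have : min q (demand x) ≤ 1 := (min_le_right _ _).trans h2.2
    nlinarith [h1.1, h1.2]

/-- The marginal revenue at `q` is a supergradient of the expected revenue. -/
lemma LearningAssumption.uR_sub_le (h : LearningAssumption 𝒟 L) (w q q' : ℝ) :
    uR 𝒟 w q' - uR 𝒟 w q ≤ (q' - q) * (marginalRevenue 𝒟 q - w) := by
  have : (∫ x, min q' (demand x) * price x ∂𝒟) - ∫ x, min q (demand x) * price x ∂𝒟
      ≤ (q' - q) * marginalRevenue 𝒟 q := by
    rw [← integral_sub (h.integrable_revenue q') (h.integrable_revenue q), marginalRevenue,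
      ← integral_const_mul]
    exact integral_mono_ae ((h.integrable_revenue q').sub (h.integrable_revenue q))
      ((h.integrable_marginalSale q).const_mul _)
      (h.price_mem.mono fun x hx => revenue_sub_le hx.1 q q')
  unfold uR
  linarith

/-- The expected utility of the supplier when `q` is the quantity that the retailer buys. -/
noncomputable def supplierValue (𝒟 : Measure Outcome) (q : ℝ) : ℝ :=
  q * (marginalRevenue 𝒟 q - ∫ x, cost x ∂𝒟)

lemma LearningAssumption.continuous_supplierValue (h : LearningAssumption 𝒟 L) :
    Continuous (supplierValue 𝒟) := by
  have := h.continuous_marginalRevenue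
  unfold supplierValue
  fun_prop

lemma LearningAssumption.marginalRevenue_strictAntiOn (h : LearningAssumption 𝒟 L) :
    StrictAntiOn (marginalRevenue 𝒟) (Set.Icc 0 1) := fun q hq q' hq' hlt => by
  have h1 := h.marginalRevenue_sub_ge hq.1 hlt.le hq'.2
  have h2 := mul_pos (mul_pos h.mean_price_pos h.pos) (sub_pos.2 hlt)
  linarith

lemma LearningAssumption.exists_supplierValue_pos (h : LearningAssumption 𝒟 L) :
    ∃ q ∈ Set.Icc (0 : ℝ) 1, 0 < supplierValue 𝒟 q := by
  have h1 : ∀ᶠ q in 𝓝 (0 : ℝ), ∫ x, cost x ∂𝒟 < marginalRevenue 𝒟 q :=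
    h.continuous_marginalRevenue.continuousAt.eventually
      (lt_mem_nhds (by rw [h.marginalRevenue_zero]; exact h.mean_lt))
  obtain ⟨ε, hε, h2⟩ := Metric.eventually_nhds_iff.1 h1
  refine ⟨min (ε / 2) 1, ⟨by positivity, min_le_right _ _⟩, ?_⟩
  have hpos : 0 < min (ε / 2) 1 := by positivity
  refine mul_pos hpos (sub_pos.2 (h2 ?_))
  rw [Real.dist_eq, sub_zero, abs_of_pos hpos]
  exact (min_le_left _ _).trans_lt (by linarith)

/-- A quantity that maximizes the supplier's value, at its market-clearing price, is a Stackelberg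
equilibrium. -/
lemma LearningAssumption.isStackelberg_of_isMaxOn (h : LearningAssumption 𝒟 L) {q : ℝ}
    (hq : q ∈ Set.Icc (0 : ℝ) 1) (hmax : IsMaxOn (supplierValue 𝒟) (Set.Icc 0 1) q) :
    IsStackelberg 𝒟 (marginalRevenue 𝒟 q) q := by
  have hex : ∀ w : ℝ, ∃ r : ℝ, (w ∈ Set.Icc 0 (∫ x, price x ∂𝒟) →
      r ∈ Set.Icc (0 : ℝ) 1 ∧ marginalRevenue 𝒟 r = w) ∧
      (w ∉ Set.Icc 0 (∫ x, price x ∂𝒟) → r = 0) := by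
    intro w
    by_cases hw : w ∈ Set.Icc 0 (∫ x, price x ∂𝒟)
    · have := intermediate_value_Icc' (zero_le_one' ℝ) h.continuous_marginalRevenue.continuousOn
      rw [h.marginalRevenue_zero, h.marginalRevenue_of_one_le le_rfl] at this
      obtain ⟨r, hr⟩ := this hw
      exact ⟨r, fun _ => hr, fun h' => absurd hw h'⟩
    · exact ⟨0, fun h' => absurd h' hw, fun _ => rfl⟩
  choose BR hBR hBR' using hex
  have hgle : ∀ r, 0 ≤ r → marginalRevenue 𝒟 r ≤ ∫ x, price x ∂𝒟 := fun r hr => by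
    rw [← h.marginalRevenue_zero]; exact h.marginalRevenue_antitone hr
  have hqw : marginalRevenue 𝒟 q ∈ Set.Icc 0 (∫ x, price x ∂𝒟) :=
    ⟨(h.marginalRevenue_mem q).1, hgle q hq.1⟩
  have hBRq : BR (marginalRevenue 𝒟 q) = q :=
    h.marginalRevenue_strictAntiOn.injOn (hBR _ hqw).1 hq (hBR _ hqw).2
  have hvalue : 0 ≤ supplierValue 𝒟 q := by
    have := hmax (show (0 : ℝ) ∈ Set.Icc (0 : ℝ) 1 by simp)
    simpa [supplierValue] using this
  refine ⟨BR, fun w hw => ?_, hqw.1, fun w hw => ?_, hBRq.symm⟩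
  · by_cases hw' : w ∈ Set.Icc 0 (∫ x, price x ∂𝒟)
    · refine ⟨(hBR w hw').1.1, fun r _ => ?_⟩
      have := h.uR_sub_le w (BR w) r
      rw [(hBR w hw').2, sub_self, mul_zero] at this
      simpa using this
    · rw [hBR' w hw']
      refine ⟨le_rfl, fun r hr => ?_⟩
      have := h.uR_sub_le w 0 r
      have hlt : ∫ x, price x ∂𝒟 < w := not_le.1 fun hle => hw' ⟨hw, hle⟩
      rw [h.marginalRevenue_zero] at this
      have h3 : (r - 0) * ((∫ x, price x ∂𝒟) - w) ≤ 0 :=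
        mul_nonpos_of_nonneg_of_nonpos (by simpa using hr) (by linarith)
      show uR 𝒟 w r ≤ uR 𝒟 w 0
      linarith
  · have e : uS 𝒟 (marginalRevenue 𝒟 q) (BR (marginalRevenue 𝒟 q)) = supplierValue 𝒟 q := by
      rw [hBRq]; unfold uS supplierValue; ring
    show uS 𝒟 w (BR w) ≤ uS 𝒟 (marginalRevenue 𝒟 q) (BR (marginalRevenue 𝒟 q))
    rw [e]
    by_cases hw' : w ∈ Set.Icc 0 (∫ x, price x ∂𝒟)
    · have := hmax (hBR w hw').1
      have e2 : uS 𝒟 w (BR w) = supplierValue 𝒟 (BR w) := by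
        unfold uS supplierValue; rw [(hBR w hw').2]; ring
      rw [e2]; exact this
    · rw [hBR' w hw']; simpa [uS] using hvalue

/-- The Stackelberg equilibrium is the market-clearing price at a quantity in `(0, 1)` that is the
only maximizer of the supplier's value. -/
lemma LearningAssumption.equilibrium (h : LearningAssumption 𝒟 L) {w q : ℝ}
    (hSE : IsStackelberg 𝒟 w q) :
    w = marginalRevenue 𝒟 q ∧ q ∈ Set.Ioo (0 : ℝ) 1 ∧ 0 < supplierValue 𝒟 q ∧
      IsMaxOn (supplierValue 𝒟) (Set.Icc 0 1) q ∧
      ∀ r ∈ Set.Icc (0 : ℝ) 1, supplierValue 𝒟 q ≤ supplierValue 𝒟 r → r = q := by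
  obtain ⟨r, hr, hmax⟩ := isCompact_Icc.exists_isMaxOn (Set.nonempty_Icc.2 (zero_le_one' ℝ))
    h.continuous_supplierValue.continuousOn
  have huniq : ∀ s ∈ Set.Icc (0 : ℝ) 1, IsMaxOn (supplierValue 𝒟) (Set.Icc 0 1) s →
      w = marginalRevenue 𝒟 s ∧ s = q := fun s hs hsmax => by
    have := h.unique_equilibrium.unique (y₁ := (w, q)) (y₂ := (marginalRevenue 𝒟 s, s)) hSE
      (h.isStackelberg_of_isMaxOn hs hsmax)
    exact ⟨congrArg Prod.fst this, (congrArg Prod.snd this).symm⟩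
  obtain ⟨h1, rfl⟩ := huniq r hr hmax
  obtain ⟨s, hs, hspos⟩ := h.exists_supplierValue_pos
  have hpos : 0 < supplierValue 𝒟 r := hspos.trans_le (hmax hs)
  refine ⟨h1, ⟨lt_of_le_of_ne hr.1 ?_, lt_of_le_of_ne hr.2 ?_⟩, hpos, hmax, fun s hs hle => ?_⟩
  · rintro rfl; simp [supplierValue] at hpos
  · rintro rfl
    simp only [supplierValue, h.marginalRevenue_of_one_le le_rfl] at hpos
    linarith [h.mean_cost_mem.1]
  · exact (huniq s hs fun y hy => (hmax hy).trans hle).2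

end Law

/-! ### Maxima of random walks with exchangeable increments -/

section

/-- The maximum `max {0, x₀, x₀ + x₁, …}` of the partial sums of at most `k` terms. -/
noncomputable def walkMax (x : ℕ → ℝ) (k : ℕ) : ℝ :=
  partialSups (fun j => ∑ i ∈ Finset.range j, x i) k

lemma walkMax_zero (x : ℕ → ℝ) : walkMax x 0 = 0 := by simp [walkMax]

lemma walkMax_succ (x : ℕ → ℝ) (k : ℕ) :
    walkMax x (k + 1) = max (walkMax x k) (∑ i ∈ Finset.range (k + 1), x i) := by
  simp [walkMax, partialSups_add_one]

lemma sum_range_le_walkMax (x : ℕ → ℝ) {j k : ℕ} (h : j ≤ k) :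
    ∑ i ∈ Finset.range j, x i ≤ walkMax x k :=
  le_partialSups_of_le (fun j => ∑ i ∈ Finset.range j, x i) h

lemma walkMax_nonneg (x : ℕ → ℝ) (k : ℕ) : 0 ≤ walkMax x k := by
  simpa using sum_range_le_walkMax x (Nat.zero_le k)

lemma walkMax_congr {x y : ℕ → ℝ} {k : ℕ} (h : ∀ i < k, x i = y i) :
    walkMax x k = walkMax y k := by
  induction k with
  | zero => simp [walkMax_zero]
  | succ k ih =>
    rw [walkMax_succ, walkMax_succ, ih fun i hi => h i (hi.trans k.lt_succ_self),
      Finset.sum_congr rfl fun i hi => h i (Finset.mem_range.1 hi)]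

lemma walkMax_succ' (x : ℕ → ℝ) (k : ℕ) :
    walkMax x (k + 1) = max 0 (x 0 + walkMax (fun i => x (i + 1)) k) := by
  induction k with
  | zero => simp [walkMax_succ, walkMax_zero]
  | succ k ih =>
    rw [walkMax_succ, ih, walkMax_succ (fun i => x (i + 1)), Finset.sum_range_succ' x, max_assoc,
      add_comm _ (x 0), ← max_add_add_left]

/-- The cyclic lemma behind Spitzer's identity: over the `k` cyclic shifts of a sequence, the
increments of the running maximum caused by the last term add up to the positive part of the total,
because the maxima of the shifted windows telescope. -/
lemma sum_walkMax_sub_walkMax {x : ℕ → ℝ} {k : ℕ} (hx : ∀ i, x (i + (k + 1)) = x i) :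
    ∑ r ∈ Finset.range (k + 1),
        (walkMax (fun i => x (r + i)) (k + 1) - walkMax (fun i => x (r + i)) k)
      = max 0 (∑ i ∈ Finset.range (k + 1), x i) := by
  set s := ∑ i ∈ Finset.range (k + 1), x i with hs
  have htot : ∀ r, ∑ i ∈ Finset.range (k + 1), x (r + i) = s := by
    intro r
    induction r with
    | zero => simp [hs]
    | succ r ih =>
      rw [← ih, Finset.sum_range_succ, Finset.sum_range_succ' (fun i => x (r + i)), add_zero,
        show r + 1 + k = r + (k + 1) by ring, hx]
      congr 1
      exact Finset.sum_congr rfl fun i _ => by congr 1; ring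
  rcases le_total s 0 with h0 | h0
  · rw [max_eq_left h0]
    refine Finset.sum_eq_zero fun r _ => ?_
    rw [walkMax_succ, htot, max_eq_left (h0.trans (walkMax_nonneg _ _)), sub_self]
  · rw [max_eq_right h0]
    -- `V r` is the maximum of the walk over the window that starts at time `r`.
    set V : ℕ → ℝ := fun r => ∑ i ∈ Finset.range r, x i + walkMax (fun i => x (r + i)) k with hV
    have hstep : ∀ r, walkMax (fun i => x (r + i)) (k + 1) - walkMax (fun i => x (r + i)) k
        = V (r + 1) - V r := by
      intro r
      have e : walkMax (fun i => x (r + i)) (k + 1)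
          = x r + walkMax (fun i => x (r + 1 + i)) k := by
        have h1 := walkMax_succ' (fun i => x (r + i)) k
        have h2 : (fun i => x (r + (i + 1))) = fun i => x (r + 1 + i) :=
          funext fun i => by congr 1; ring
        rw [h2] at h1
        rw [h1, add_zero, max_eq_right]
        have h3 := sum_range_le_walkMax (fun i => x (r + 1 + i)) (le_refl k)
        have h4 := htot r
        rw [Finset.sum_range_succ'] at h4
        have h5 : ∑ i ∈ Finset.range k, x (r + (i + 1)) = ∑ i ∈ Finset.range k, x (r + 1 + i) :=
          Finset.sum_congr rfl fun i _ => by congr 1; ring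
        rw [h5, add_zero] at h4
        linarith
      rw [e, hV]
      simp only [Finset.sum_range_succ]
      ring
    rw [Finset.sum_congr rfl fun r _ => hstep r, Finset.sum_range_sub]
    have hper : (fun i => x (k + 1 + i)) = x := funext fun i => by rw [add_comm]; exact hx i
    simp [hV, hper, hs]

lemma measurable_walkMax {α : Type*} [MeasurableSpace α] {y : ℕ → α → ℝ}
    (hy : ∀ i, Measurable (y i)) (k : ℕ) : Measurable fun a => walkMax (fun i => y i a) k := by
  induction k with
  | zero => simp [walkMax_zero]
  | succ k ih =>
    simp_rw [walkMax_succ]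
    exact ih.max (Finset.measurable_fun_sum _ fun i _ => hy i)

variable {Ω : Type*} [MeasurableSpace Ω] {μ : Measure Ω}

lemma integrable_walkMax {y : ℕ → Ω → ℝ} (hy : ∀ i, Integrable (y i) μ) (k : ℕ) :
    Integrable (fun a => walkMax (fun i => y i a) k) μ := by
  induction k with
  | zero => simp [walkMax_zero]
  | succ k ih =>
    simp_rw [walkMax_succ]
    exact ih.sup (integrable_finsetSum _ fun i _ => hy i)

/-- Spitzer's identity `E max {0, S₁, …, S_m} = ∑_{k ≤ m} E[S_k⁺] / k`, for increments whose law is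
invariant under cyclic shifts of the first `k` of them, for each `k ≤ m`. -/
lemma integral_walkMax_eq {y : ℕ → Ω → ℝ}
    (hi : ∀ i, Integrable (y i) μ) (m : ℕ)
    (hy : ∀ k < m, ∀ r < k + 1, IdentDistrib (fun ω (j : Fin (k + 1)) => y j ω)
      (fun ω (j : Fin (k + 1)) => y ((r + j) % (k + 1)) ω) μ μ) :
    ∫ ω, walkMax (fun i => y i ω) m ∂μ
      = ∑ k ∈ Finset.range m,
          (∫ ω, max 0 (∑ i ∈ Finset.range (k + 1), y i ω) ∂μ) / ((k : ℝ) + 1) := by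
  induction m with
  | zero => simp [walkMax_zero]
  | succ k ih =>
    rw [Finset.sum_range_succ, ← ih fun k' hk' => hy k' (hk'.trans k.lt_succ_self),
      ← sub_eq_iff_eq_add', ← integral_sub (integrable_walkMax hi _) (integrable_walkMax hi _),
      eq_div_iff (by positivity)]
    -- `Φ` is the increment of the running maximum, as a function of the first `k + 1` terms.
    set Φ : (Fin (k + 1) → ℝ) → ℝ := fun v =>
      walkMax (fun i => v (Fin.ofNat (k + 1) i)) (k + 1)
        - walkMax (fun i => v (Fin.ofNat (k + 1) i)) k with hΦ
    have hΦm : Measurable Φ :=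
      (measurable_walkMax (fun i => measurable_pi_apply _) _).sub
        (measurable_walkMax (fun i => measurable_pi_apply _) _)
    have hval : ∀ ω, ∀ r, Φ (fun j => y ((r + j) % (k + 1)) ω)
        = walkMax (fun i => y ((r + i) % (k + 1)) ω) (k + 1)
          - walkMax (fun i => y ((r + i) % (k + 1)) ω) k := by
      intro ω r
      simp [hΦ]
    have hper : ∀ ω, ∑ r ∈ Finset.range (k + 1), Φ (fun j => y ((r + j) % (k + 1)) ω)
        = max 0 (∑ i ∈ Finset.range (k + 1), y i ω) := by
      intro ω
      have := sum_walkMax_sub_walkMax (x := fun i => y (i % (k + 1)) ω) (k := k) (by simp)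
      rw [Finset.sum_congr rfl fun r _ => hval ω r]
      rw [this]
      congr 1
      exact Finset.sum_congr rfl fun i hi => by rw [Nat.mod_eq_of_lt (Finset.mem_range.1 hi)]
    have h0 : ∀ ω, Φ (fun j => y j ω) = walkMax (fun i => y i ω) (k + 1)
        - walkMax (fun i => y i ω) k := by
      intro ω
      simp only [hΦ, Fin.val_ofNat]
      rw [walkMax_congr (k := k + 1) (y := fun i => y i ω)
        fun i hi => by rw [Nat.mod_eq_of_lt hi], walkMax_congr (k := k) (y := fun i => y i ω)
        fun i hi => by rw [Nat.mod_eq_of_lt (hi.trans k.lt_succ_self)]]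
    have hr : ∀ r ∈ Finset.range (k + 1), ∫ ω, Φ (fun j => y ((r + j) % (k + 1)) ω) ∂μ
        = ∫ ω, Φ (fun j => y j ω) ∂μ := fun r hr =>
      (((hy k k.lt_succ_self r (Finset.mem_range.1 hr)).comp hΦm).integral_eq).symm
    have hint : ∀ r, Integrable (fun ω => Φ (fun j => y ((r + j) % (k + 1)) ω)) μ := fun r => by
      simp_rw [hval]
      exact (integrable_walkMax (fun i => hi _) _).sub (integrable_walkMax (fun i => hi _) _)
    have := integral_finsetSum (μ := μ) (Finset.range (k + 1)) fun r _ => hint r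
    rw [Finset.sum_congr rfl hr, Finset.sum_const, Finset.card_range, nsmul_eq_mul] at this
    simp_rw [hper, h0] at this
    rw [this]
    push_cast
    ring

end

/-! ### Spitzer's identity for counts of i.i.d. labels -/

section

variable {Ω : Type*} [MeasurableSpace Ω] {μ : Measure Ω}

lemma abs_integral_le_sqrt [IsProbabilityMeasure μ] {Z : Ω → ℝ} (hZ : MemLp Z 2 μ) :
    ∫ ω, |Z ω| ∂μ ≤ √(∫ ω, Z ω ^ 2 ∂μ) := by
  have h1 := variance_nonneg (fun ω => |Z ω|) μ
  have h2 : MemLp (fun ω => |Z ω|) 2 μ := hZ.abs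
  rw [variance_eq_sub h2] at h1
  refine Real.le_sqrt_of_sq_le ?_
  simpa [sq_abs] using h1

/-- A centred random variable has `E Z⁺ = E |Z| / 2`, which is at most half the standard
deviation. -/
lemma integral_max_zero_le [IsProbabilityMeasure μ] {Z : Ω → ℝ} (hZ : MemLp Z 2 μ)
    (h0 : ∫ ω, Z ω ∂μ = 0) : ∫ ω, max 0 (Z ω) ∂μ ≤ √(∫ ω, Z ω ^ 2 ∂μ) / 2 := by
  have hi : Integrable Z μ := hZ.integrable (by norm_num)
  have h1 : ∫ ω, max 0 (Z ω) ∂μ = (∫ ω, |Z ω| ∂μ) / 2 := by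
    have e : ∀ ω, max 0 (Z ω) = (Z ω + |Z ω|) / 2 := fun ω => by
      rcases le_total 0 (Z ω) with h | h
      · rw [max_eq_right h, abs_of_nonneg h]; ring
      · rw [max_eq_left h, abs_of_nonpos h]; ring
    simp_rw [e]
    rw [integral_div, integral_add hi hi.abs, h0, zero_add]
  rw [h1]
  linarith [abs_integral_le_sqrt hZ]

/-- The terms in Spitzer's identity for a binomial bridge, compared with the increments of
`r ↦ 2 √r - r √r / 3`, an antiderivative of `(1 - r / 2) / √r`, which dominates
`√(r (1 - r)) / r`. -/
lemma sqrt_div_le_sub {c : ℝ} (hc : 0 ≤ c) (k : ℕ) (hk : ((k : ℝ) + 1) * c ≤ 1) :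
    √(((k : ℝ) + 1) * c * (1 - ((k : ℝ) + 1) * c)) / ((k : ℝ) + 1)
      ≤ (2 * √(((k : ℝ) + 1) * c) - √(((k : ℝ) + 1) * c) ^ 3 / 3)
        - (2 * √((k : ℝ) * c) - √((k : ℝ) * c) ^ 3 / 3) := by
  rcases hc.eq_or_lt with rfl | hc
  · simp
  set b := √(((k : ℝ) + 1) * c) with hb
  set s := √((k : ℝ) * c) with hs
  have hb2 : b ^ 2 = ((k : ℝ) + 1) * c := Real.sq_sqrt (by positivity)
  have hs2 : s ^ 2 = (k : ℝ) * c := Real.sq_sqrt (by positivity)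
  have hb0 : 0 < b := Real.sqrt_pos.2 (by positivity)
  have hs0 : 0 ≤ s := Real.sqrt_nonneg _
  have hsb : s ≤ b := Real.sqrt_le_sqrt (by nlinarith)
  have h1 : √(((k : ℝ) + 1) * c * (1 - ((k : ℝ) + 1) * c)) ≤ b * (1 - b ^ 2 / 2) := by
    rw [← hb2] at hk ⊢
    rw [Real.sqrt_mul (by positivity), Real.sqrt_sq hb0.le]
    refine mul_le_mul_of_nonneg_left ?_ hb0.le
    rw [Real.sqrt_le_left (by nlinarith)]
    nlinarith [sq_nonneg (b ^ 2)]
  have hk1 : (k : ℝ) + 1 = b ^ 2 / (b ^ 2 - s ^ 2) := by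
    rw [hb2, hs2, eq_div_iff (by ring_nf; exact hc.ne')]; ring
  have hbs : 0 < b ^ 2 - s ^ 2 := by rw [hb2, hs2]; linarith
  calc √(((k : ℝ) + 1) * c * (1 - ((k : ℝ) + 1) * c)) / ((k : ℝ) + 1)
      ≤ b * (1 - b ^ 2 / 2) / ((k : ℝ) + 1) := by gcongr
    _ = (b - s) * ((b + s) * (1 - b ^ 2 / 2)) / b := by rw [hk1]; field_simp; ring
    _ ≤ (2 * b - b ^ 3 / 3) - (2 * s - s ^ 3 / 3) := by
      rw [div_le_iff₀ hb0]
      have h2 : 0 ≤ (b - s) * (6 * (b - s) + b * (b ^ 2 + b * s - 2 * s ^ 2)) :=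
        mul_nonneg (by linarith) (by nlinarith [mul_nonneg hb0.le (sub_nonneg.2 hsb)])
      nlinarith [h2]

variable {E : Type*} [MeasurableSpace E] {ν : Measure E} {ι : Type*} [Fintype ι]

/-- Cyclically shifting labels of equal probability does not change the law of i.i.d. labels. -/
lemma identDistrib_rotate_labels [IsProbabilityMeasure μ] {X : ι → Ω → E}
    (hX : ∀ i, Measurable (X i)) (hind : iIndepFun X μ) (hlaw : ∀ i, μ.map (X i) = ν)
    {lab : E → ℕ} (hlab : Measurable lab) {K : ℕ} {c : ENNReal}
    (hc : ∀ j < K, ν (lab ⁻¹' {j}) = c) {r : ℕ} (hr : r < K) (F : ℝ → ℝ) (hF : Measurable F) :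
    IdentDistrib (fun ω (j : Fin K) => F (∑ i, if lab (X i ω) = j then 1 else 0))
      (fun ω (j : Fin K) => F (∑ i, if lab (X i ω) = (r + j) % K then 1 else 0)) μ μ := by
  have hmod : ∀ a, a < 2 * K → a % K = if a < K then a else a - K := fun a ha => by
    split_ifs with h
    · exact Nat.mod_eq_of_lt h
    · rw [Nat.mod_eq_sub_mod (not_lt.1 h), Nat.mod_eq_of_lt (by omega)]
  set σ : ℕ → ℕ := fun l => if l < K then (l + (K - r)) % K else l with hσ
  have hσj : ∀ l, ∀ j < K, (σ l = j ↔ l = (r + j) % K) := by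
    intro l j hj
    simp only [hσ]
    rw [hmod (r + j) (by omega)]
    by_cases hl : l < K
    · rw [if_pos hl, hmod _ (by omega)]
      split_ifs <;> omega
    · rw [if_neg hl]
      split_ifs <;> omega
  have hσj' : ∀ l, ∀ j, K ≤ j → (σ l = j ↔ l = j) := by
    intro l j hj
    simp only [hσ]
    by_cases hl : l < K
    · rw [if_pos hl]
      have := Nat.mod_lt (l + (K - r)) (show 0 < K by omega)
      constructor <;> intro <;> omega
    · rw [if_neg hl]
  have hσm : Measurable σ := Measurable.of_discrete
  have hσl : Measurable fun x => σ (lab x) := hσm.comp hlab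
  have hid : ∀ i, IdentDistrib (fun ω => lab (X i ω)) (fun ω => σ (lab (X i ω))) μ μ := by
    intro i
    refine ⟨(hlab.comp (hX i)).aemeasurable, (hσm.comp (hlab.comp (hX i))).aemeasurable, ?_⟩
    have e1 : μ.map (fun ω => lab (X i ω)) = ν.map lab := by
      rw [← hlaw i, Measure.map_map hlab (hX i)]; rfl
    have e2 : μ.map (fun ω => σ (lab (X i ω))) = ν.map (fun x => σ (lab x)) := by
      rw [← hlaw i, Measure.map_map hσl (hX i)]; rfl
    rw [e1, e2]
    refine Measure.ext_of_singleton fun j => ?_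
    rw [Measure.map_apply hlab (measurableSet_singleton j),
      Measure.map_apply hσl (measurableSet_singleton j)]
    by_cases hj : j < K
    · have : (fun x => σ (lab x)) ⁻¹' {j} = lab ⁻¹' {(r + j) % K} := by
        ext x; simp [hσj _ j hj]
      rw [this, hc j hj, hc _ (Nat.mod_lt _ (by omega))]
    · have : (fun x => σ (lab x)) ⁻¹' {j} = lab ⁻¹' {j} := by
        ext x; simp [hσj' _ j (not_lt.1 hj)]
      rw [this]
  have hpi : IdentDistrib (fun ω i => lab (X i ω)) (fun ω i => σ (lab (X i ω))) μ μ :=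
    IdentDistrib.pi hid (hind.comp (fun _ => lab) fun _ => hlab)
      (hind.comp (fun _ x => σ (lab x)) fun _ => hσl)
  have hm : Measurable fun (z : ι → ℕ) (j : Fin K) =>
      F (∑ i, if z i = (j : ℕ) then (1 : ℝ) else 0) := by
    refine measurable_pi_lambda _ fun j => hF.comp (Finset.measurable_fun_sum _ fun i _ => ?_)
    exact Measurable.ite (measurableSet_eq_fun (measurable_pi_apply i) measurable_const)
      measurable_const measurable_const
  have e : (fun ω (j : Fin K) => F (∑ i, if lab (X i ω) = (r + j) % K then (1 : ℝ) else 0))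
      = (fun (z : ι → ℕ) (j : Fin K) => F (∑ i, if z i = (j : ℕ) then (1 : ℝ) else 0))
        ∘ fun ω i => σ (lab (X i ω)) := by
    funext ω j
    simp only [Function.comp, hσj _ j j.2]
  rw [e]
  exact hpi.comp hm

/-- The centred sum of `n` i.i.d. `[0,1]`-valued variables of mean `p` has second moment at most
`n p (1 - p)`. -/
lemma integral_sum_sub_sq_le [IsProbabilityMeasure μ] {X : ι → Ω → E}
    (hX : ∀ i, Measurable (X i)) (hind : iIndepFun X μ) (hlaw : ∀ i, μ.map (X i) = ν)
    {f : E → ℝ} (hf : Measurable f) (hf01 : ∀ᵐ x ∂ν, f x ∈ Set.Icc (0 : ℝ) 1) {p : ℝ}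
    (hp : ∫ x, f x ∂ν = p) :
    MemLp (fun ω => ∑ i, f (X i ω) - Fintype.card ι * p) 2 μ ∧
      ∫ ω, (∑ i, f (X i ω) - Fintype.card ι * p) ∂μ = 0 ∧
      ∫ ω, (∑ i, f (X i ω) - Fintype.card ι * p) ^ 2 ∂μ ≤ Fintype.card ι * (p * (1 - p)) := by
  have hae : ∀ i, ∀ᵐ ω ∂μ, f (X i ω) ∈ Set.Icc (0 : ℝ) 1 := fun i =>
    ae_of_ae_map (hX i).aemeasurable (by rw [hlaw i]; exact hf01)
  have hm : ∀ i, Measurable fun ω => f (X i ω) := fun i => hf.comp (hX i)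
  have hLp : ∀ i, MemLp (fun ω => f (X i ω)) 2 μ := fun i =>
    memLp_of_bounded (hae i) (hm i).aestronglyMeasurable 2
  have hint : ∀ i, Integrable (fun ω => f (X i ω)) μ := fun i => (hLp i).integrable (by norm_num)
  have hmean : ∀ i, ∫ ω, f (X i ω) ∂μ = p := fun i => by
    rw [← hp, ← hlaw i, integral_map (hX i).aemeasurable hf.aestronglyMeasurable]
  have hsumLp : MemLp (fun ω => ∑ i, f (X i ω)) 2 μ := memLp_finsetSum _ fun i _ => hLp i
  have hEsum : ∫ ω, ∑ i, f (X i ω) ∂μ = Fintype.card ι * p := by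
    rw [integral_finsetSum _ fun i _ => hint i]
    simp [hmean]
  refine ⟨hsumLp.sub (memLp_const _), ?_, ?_⟩
  · rw [integral_sub (hsumLp.integrable (by norm_num)) (integrable_const _), hEsum]
    simp
  · have h1 : variance (fun ω => ∑ i, f (X i ω)) μ
        = ∫ ω, (∑ i, f (X i ω) - Fintype.card ι * p) ^ 2 ∂μ := by
      rw [variance_eq_integral hsumLp.aemeasurable, hEsum]
    have h2 : variance (∑ i, fun ω => f (X i ω)) μ = ∑ i, variance (fun ω => f (X i ω)) μ :=
      IndepFun.variance_sum (fun i _ => hLp i) fun i _ j _ hij =>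
        (hind.indepFun hij).comp hf hf
    have h3 : (∑ i, fun ω => f (X i ω)) = fun ω => ∑ i, f (X i ω) := by
      funext ω; simp
    rw [h3] at h2
    rw [← h1, h2, ← nsmul_eq_mul, ← Finset.card_univ, ← Finset.sum_const]
    refine Finset.sum_le_sum fun i _ => ?_
    rw [variance_eq_sub (hLp i), hmean i]
    have : ∫ ω, f (X i ω) ^ 2 ∂μ ≤ ∫ ω, f (X i ω) ∂μ := by
      refine integral_mono_ae (hLp i).integrable_sq (hint i) ((hae i).mono fun ω hω => ?_)
      nlinarith [hω.1, hω.2]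
    rw [hmean i] at this
    simp only [Pi.pow_apply]
    nlinarith

lemma sum_label_increments (l : ι → ℕ) (n c δ : ℝ) (k : ℕ) :
    ∑ j ∈ Finset.range k, δ * ((∑ i, if l i = j then (1 : ℝ) else 0) - n * c)
      = δ * (∑ i, (Set.Iio k).indicator (1 : ℕ → ℝ) (l i) - n * (k * c)) := by
  rw [← Finset.mul_sum, Finset.sum_sub_distrib, Finset.sum_comm]
  congr 2
  · refine Finset.sum_congr rfl fun i _ => ?_
    simp [Set.indicator]
  · simp; ring

/-- A log-free maximal inequality for empirical counts of nested events `{lab < j}`, `j ≤ m`, whose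
successive differences have equal probability: their increments are exchangeable, so Spitzer's
identity reduces the maximum to the second moments of the single counts. The sign `δ` covers both
one-sided deviations. -/
lemma integral_walkMax_labels_le [IsProbabilityMeasure μ] {X : ι → Ω → E}
    (hX : ∀ i, Measurable (X i)) (hind : iIndepFun X μ) (hlaw : ∀ i, μ.map (X i) = ν)
    [IsProbabilityMeasure ν] {lab : E → ℕ} (hlab : Measurable lab) {m : ℕ} {c : ℝ} (hc : 0 ≤ c)
    (hlabc : ∀ j < m, ν (lab ⁻¹' {j}) = ENNReal.ofReal c) {δ : ℝ} (hδ : δ ^ 2 = 1) :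
    ∫ ω, walkMax (fun j => δ * ((∑ i, if lab (X i ω) = j then (1 : ℝ) else 0)
      - Fintype.card ι * c)) m ∂μ ≤ 5 / 6 * √(Fintype.card ι) := by
  set n : ℝ := (Fintype.card ι : ℝ) with hn
  set y : ℕ → Ω → ℝ := fun j ω => δ * ((∑ i, if lab (X i ω) = j then (1 : ℝ) else 0) - n * c)
    with hy
  have hindm : ∀ s : Set ℕ, Measurable fun x => s.indicator (1 : ℕ → ℝ) (lab x) := fun s =>
    (measurable_one.indicator MeasurableSet.of_discrete).comp hlab
  have hνlt : ∀ j ≤ m, ν.real (lab ⁻¹' Set.Iio j) = j * c := by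
    intro j hj
    induction j with
    | zero => simp
    | succ j ih =>
      have : lab ⁻¹' Set.Iio (j + 1) = lab ⁻¹' Set.Iio j ∪ lab ⁻¹' {j} := by
        ext x
        simp only [Set.mem_preimage, Set.mem_Iio, Set.mem_union, Set.mem_singleton_iff]
        omega
      rw [this, measureReal_union _ (hlab (measurableSet_singleton j)), ih (by omega),
        measureReal_def, hlabc j (by omega), ENNReal.toReal_ofReal hc]
      · push_cast; ring
      · rw [Set.disjoint_left]; intro x hx hx'
        simp only [Set.mem_preimage, Set.mem_Iio, Set.mem_singleton_iff] at hx hx'; omega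
  have hmc : m * c ≤ 1 := by
    rw [← hνlt m le_rfl]; exact measureReal_le_one
  have hpartial : ∀ k ω, ∑ j ∈ Finset.range k, y j ω
      = δ * (∑ i, (Set.Iio k).indicator (1 : ℕ → ℝ) (lab (X i ω)) - n * (k * c)) :=
    fun k ω => sum_label_increments (fun i => lab (X i ω)) n c δ k
  have hyi : ∀ j, Integrable (y j) μ := by
    intro j
    refine Integrable.const_mul (Integrable.sub (integrable_finsetSum _ fun i _ => ?_)
      (integrable_const _)) δ
    have : Measurable fun ω => if lab (X i ω) = j then (1 : ℝ) else 0 :=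
      Measurable.ite ((hlab.comp (hX i)) (measurableSet_singleton j)) measurable_const
        measurable_const
    refine integrable_of_ae_mem_Icc this (a := 0) (b := 1) (Eventually.of_forall fun ω => ?_)
    split_ifs <;> simp
  have hspitzer := integral_walkMax_eq (y := y) hyi m fun k hk r hr =>
    identDistrib_rotate_labels hX hind hlaw hlab (fun j hj => hlabc j (by omega)) hr
      (fun z => δ * (z - n * c)) (by fun_prop)
  rw [hspitzer]
  have hterm : ∀ k < m, (∫ ω, max 0 (∑ j ∈ Finset.range (k + 1), y j ω) ∂μ) / ((k : ℝ) + 1)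
      ≤ √n / 2 * ((2 * √(((k + 1 : ℕ) : ℝ) * c) - √(((k + 1 : ℕ) : ℝ) * c) ^ 3 / 3)
        - (2 * √((k : ℝ) * c) - √((k : ℝ) * c) ^ 3 / 3)) := by
    intro k hk
    have hkc : ((k : ℝ) + 1) * c ≤ 1 := by
      refine le_trans (mul_le_mul_of_nonneg_right ?_ hc) hmc
      exact_mod_cast hk
    obtain ⟨h1, h2, h3⟩ := integral_sum_sub_sq_le hX hind hlaw (hindm (Set.Iio (k + 1)))
      (Eventually.of_forall fun x => by
        by_cases h : lab x ∈ Set.Iio (k + 1)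
        · rw [Set.indicator_of_mem h]; simp
        · rw [Set.indicator_of_notMem h]; simp)
      (p := ((k + 1 : ℕ) : ℝ) * c) (by
        rw [← hνlt (k + 1) hk, ← integral_indicator_one (hlab MeasurableSet.of_discrete)]
        rfl)
    have h4 := integral_max_zero_le (h1.const_mul δ) (by rw [integral_const_mul, h2, mul_zero])
    simp_rw [hpartial]
    have h5 : ∫ ω, (δ * (∑ i, (Set.Iio (k + 1)).indicator (1 : ℕ → ℝ) (lab (X i ω))
        - Fintype.card ι * (((k + 1 : ℕ) : ℝ) * c))) ^ 2 ∂μ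
        ≤ n * (((k : ℝ) + 1) * c * (1 - ((k : ℝ) + 1) * c)) := by
      simp_rw [mul_pow, hδ, one_mul]
      push_cast at h3 ⊢
      exact h3
    have h6 := sqrt_div_le_sub hc k hkc
    calc _ ≤ √(n * (((k : ℝ) + 1) * c * (1 - ((k : ℝ) + 1) * c))) / 2 / ((k : ℝ) + 1) := by
          gcongr
          exact h4.trans (by gcongr)
      _ = √n / 2 * (√(((k : ℝ) + 1) * c * (1 - ((k : ℝ) + 1) * c)) / ((k : ℝ) + 1)) := by
          rw [Real.sqrt_mul (by positivity)]; ring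
      _ ≤ _ := by
          push_cast
          gcongr
  refine (Finset.sum_le_sum fun k hk => hterm k (Finset.mem_range.1 hk)).trans ?_
  rw [← Finset.mul_sum, Finset.sum_range_sub
    (fun k : ℕ => 2 * √((k : ℝ) * c) - √((k : ℝ) * c) ^ 3 / 3)]
  have hb0 : 0 ≤ √((m : ℝ) * c) := Real.sqrt_nonneg _
  have hb1 : √((m : ℝ) * c) ≤ 1 := Real.sqrt_le_one.2 hmc
  have hb : 2 * √((m : ℝ) * c) - √((m : ℝ) * c) ^ 3 / 3 ≤ 5 / 3 := by
    generalize √((m : ℝ) * c) = b at hb0 hb1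
    nlinarith [mul_nonneg (sub_nonneg.2 hb1) (by nlinarith : 0 ≤ 5 - b - b ^ 2)]
  have := Real.sqrt_nonneg n
  simp only [Nat.cast_zero, zero_mul, Real.sqrt_zero]
  nlinarith

end

/-! ### Empirical counts of a continuous variable -/

section

variable {Ω : Type*} [MeasurableSpace Ω] {μ : Measure Ω}
variable {E : Type*} [MeasurableSpace E] {ν : Measure E} {ι : Type*} [Fintype ι]

lemma measurable_sup'_max_zero {κ α : Type*} [MeasurableSpace α] (s : Finset κ) (hs : s.Nonempty)
    {f : κ → α → ℝ} (hf : ∀ q, Measurable (f q)) :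
    Measurable fun a => s.sup' hs fun q => max 0 (f q a) := by
  have := Finset.measurable_sup' hs (f := fun q a => max 0 (f q a))
    fun q _ => measurable_const.max (hf q)
  convert this using 1
  funext a
  simp

lemma sup'_max_zero_mem_Icc {κ : Type*} (s : Finset κ) (hs : s.Nonempty) {f : κ → ℝ} {b : ℝ}
    (hb : 0 ≤ b) (hf : ∀ q ∈ s, f q ≤ b) :
    (s.sup' hs fun q => max 0 (f q)) ∈ Set.Icc 0 b := by
  obtain ⟨q, hq⟩ := hs
  exact ⟨(le_max_left 0 (f q)).trans (Finset.le_sup' (fun q => max 0 (f q)) hq),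
    Finset.sup'_le _ _ fun q hq => max_le hb (hf q hq)⟩

/-- The centred and signed count of the samples in `A` at which `Z` exceeds `q`. -/
noncomputable def countDev (ν : Measure E) (A : Set E) (Z : E → ℝ) (δ q : ℝ) (x : ι → E) : ℝ :=
  δ * (∑ i, (A ∩ {e | q < Z e}).indicator (1 : E → ℝ) (x i)
    - Fintype.card ι * ν.real (A ∩ {e | q < Z e}))

lemma abs_countDev_le [IsProbabilityMeasure ν] (A : Set E) (Z : E → ℝ) {δ : ℝ} (hδ : δ ^ 2 = 1)
    (q : ℝ) (x : ι → E) : |countDev ν A Z δ q x| ≤ Fintype.card ι := by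
  have hδ1 : |δ| = 1 := by
    rcases eq_or_eq_neg_of_sq_eq_sq δ 1 (by rw [hδ, one_pow]) with rfl | rfl <;> simp
  have h1 : ∀ i, (A ∩ {e | q < Z e}).indicator (1 : E → ℝ) (x i) ∈ Set.Icc (0 : ℝ) 1 := fun i => by
    by_cases h : x i ∈ A ∩ {e | q < Z e}
    · rw [Set.indicator_of_mem h]; simp
    · rw [Set.indicator_of_notMem h]; simp
  have h2 : 0 ≤ ∑ i, (A ∩ {e | q < Z e}).indicator (1 : E → ℝ) (x i) :=
    Finset.sum_nonneg fun i _ => (h1 i).1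
  have h3 : ∑ i, (A ∩ {e | q < Z e}).indicator (1 : E → ℝ) (x i) ≤ Fintype.card ι := by
    simpa using Finset.sum_le_sum (s := Finset.univ) fun i _ => (h1 i).2
  have h4 : ν.real (A ∩ {e | q < Z e}) ≤ 1 := measureReal_le_one
  have h5 : 0 ≤ ν.real (A ∩ {e | q < Z e}) := measureReal_nonneg
  have h6 : (0 : ℝ) ≤ Fintype.card ι := Nat.cast_nonneg _
  rw [countDev, abs_mul, hδ1, one_mul, abs_le]
  constructor <;> nlinarith

/-- The labels cutting the event `A` along the levels of `Z`: if `x` decreases, then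
`{l < k} = A ∩ {x k < Z}`. -/
lemma exists_label {A : Set E} (hA : MeasurableSet A) {Z : E → ℝ} (hZ : Measurable Z) (m : ℕ)
    {x : ℕ → ℝ} (hx : ∀ j k, j < k → k ≤ m → x k < x j) :
    ∃ l : E → ℕ, Measurable l ∧ ∀ k, 1 ≤ k → k ≤ m → l ⁻¹' Set.Iio k = A ∩ {e | x k < Z e} := by
  classical
  refine ⟨fun e => if e ∈ A then ∑ k ∈ Finset.Icc 1 m, if x k < Z e then 0 else 1 else m,
    Measurable.ite hA (Finset.measurable_fun_sum _ fun k _ => Measurable.ite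
      (measurableSet_lt measurable_const hZ) measurable_const measurable_const) measurable_const,
    fun k hk1 hkm => ?_⟩
  ext e
  by_cases he : e ∈ A
  swap
  · simp [he, hkm]
  simp only [Set.mem_preimage, he, if_true, Set.mem_Iio, Set.mem_inter_iff, true_and,
    Set.mem_ofPred_eq]
  constructor
  · intro h
    by_contra hlt
    refine absurd h (not_lt.2 ?_)
    calc k = ∑ j ∈ Finset.Icc 1 k, 1 := by simp
      _ ≤ ∑ j ∈ Finset.Icc 1 k, if x j < Z e then 0 else 1 := by
        refine Finset.sum_le_sum fun j hj => ?_
        rw [Finset.mem_Icc] at hj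
        have : ¬ x j < Z e := fun hj' => hlt <| by
          rcases hj.2.eq_or_lt with rfl | hjk
          · exact hj'
          · exact (hx j k hjk hkm).trans hj'
        simp [this]
      _ ≤ _ := Finset.sum_le_sum_of_subset (Finset.Icc_subset_Icc_right hkm)
  · intro h
    calc _ ≤ ∑ j ∈ Finset.Icc 1 m, if j ∈ Finset.Icc 1 (k - 1) then 1 else 0 := by
          refine Finset.sum_le_sum fun j hj => ?_
          rw [Finset.mem_Icc] at hj
          by_cases hjk : j < k
          · rw [if_pos (Finset.mem_Icc.2 ⟨hj.1, by omega⟩)]; split_ifs <;> simp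
          · have : x j < Z e := by
              rcases (not_lt.1 hjk).eq_or_lt with rfl | hkj
              · exact h
              · exact (hx k j hkj hj.2).trans h
            simp [this]
      _ ≤ k - 1 := by
          rw [← Finset.sum_filter, Finset.sum_const, smul_eq_mul, mul_one]
          calc _ ≤ (Finset.Icc 1 (k - 1)).card :=
                Finset.card_le_card fun j hj => (Finset.mem_filter.1 hj).2
            _ = k - 1 := by simp
      _ < k := by omega

/-- A one-sided Dvoretzky–Kiefer–Wolfowitz inequality in mean for the sub-distribution of a real
variable `Z` on an event `A`: comparison with the quantiles that cut the law of `Z` on `A` into `m`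
parts of equal probability, and `m → ∞`. -/
lemma integral_sup_countDev_le [IsProbabilityMeasure μ] [IsProbabilityMeasure ν] {X : ι → Ω → E}
    (hX : ∀ i, Measurable (X i)) (hind : iIndepFun X μ) (hlaw : ∀ i, μ.map (X i) = ν)
    {A : Set E} (hA : MeasurableSet A) {Z : E → ℝ} (hZ : Measurable Z)
    (hZ01 : ∀ᵐ e ∂ν, Z e ∈ Set.Icc (0 : ℝ) 1) (hatom : ∀ q, ν {e | Z e = q} = 0)
    {δ : ℝ} (hδ : δ ^ 2 = 1) (s : Finset ℝ) (hs : s.Nonempty)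
    (hs01 : ∀ q ∈ s, q ∈ Set.Icc (0 : ℝ) 1) :
    ∫ ω, s.sup' hs (fun q => max 0 (countDev ν A Z δ q fun i => X i ω)) ∂μ
      ≤ 5 / 6 * √(Fintype.card ι) := by
  set n : ℝ := (Fintype.card ι : ℝ) with hn
  have hn0 : 0 ≤ n := Nat.cast_nonneg _
  set G : ℝ → ℝ := fun q => ν.real (A ∩ {e | q < Z e}) with hG
  have hanti : Antitone G := fun q q' h => measureReal_mono
    (Set.inter_subset_inter_right _ fun e (he : q' < Z e) => h.trans_lt he)
  have hmeasS : ∀ q, MeasurableSet (A ∩ {e | q < Z e}) := fun q =>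
    hA.inter (measurableSet_lt measurable_const hZ)
  have hcont : Continuous G := by
    have e : G = fun q => ∫ x, (A ∩ {e | q < Z e}).indicator (1 : E → ℝ) x ∂ν :=
      funext fun q => (integral_indicator_one (hmeasS q)).symm
    rw [e, continuous_iff_continuousAt]
    intro q
    refine continuousAt_of_dominated (bound := fun _ => 1) (Eventually.of_forall fun q' =>
      (measurable_one.indicator (hmeasS q')).aestronglyMeasurable)
      (Eventually.of_forall fun q' => Eventually.of_forall fun x => ?_) (integrable_const _) ?_
    · by_cases hx : x ∈ A ∩ {e | q' < Z e}
      · rw [Set.indicator_of_mem hx]; simp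
      · rw [Set.indicator_of_notMem hx]; simp
    · have : ∀ᵐ x ∂ν, Z x ≠ q := by
        rw [ae_iff]; simpa using hatom q
      filter_upwards [this] with x hx
      rcases lt_or_gt_of_ne hx with h1 | h1
      · refine ContinuousAt.congr (f := fun _ => (0 : ℝ)) continuousAt_const ?_
        filter_upwards [lt_mem_nhds h1] with q' hq'
        simp [Set.indicator, hq'.le]
      · refine ContinuousAt.congr (f := fun _ => A.indicator (1 : E → ℝ) x) continuousAt_const ?_
        filter_upwards [gt_mem_nhds h1] with q' hq'
        by_cases hx' : x ∈ A <;> simp [hx', hq']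
  set p := ν.real A with hp
  have hp0 : 0 ≤ p := measureReal_nonneg
  have hp1 : p ≤ 1 := measureReal_le_one
  have hGm1 : G (-1) = p := measureReal_congr (by
    filter_upwards [hZ01] with e he
    have : (-1 : ℝ) < Z e := by linarith [he.1]
    exact propext ⟨fun h => h.1, fun h => ⟨h, this⟩⟩)
  have hG2 : G 2 = 0 := by
    have : ν.real (A ∩ {e | 2 < Z e}) = ν.real (∅ : Set E) := measureReal_congr (by
      filter_upwards [hZ01] with e he
      have : ¬ 2 < Z e := by linarith [he.2]
      exact propext ⟨fun h => absurd h.2 this, fun h => absurd h (Set.notMem_empty e)⟩)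
    simpa using this
  have hcdm : ∀ q, Measurable fun ω => countDev ν A Z δ q fun i => X i ω := fun q =>
    ((Finset.measurable_fun_sum _ fun i _ =>
      (measurable_one.indicator (hmeasS q)).comp (hX i)).sub measurable_const).const_mul δ
  have hVi : Integrable (fun ω => s.sup' hs fun q => max 0 (countDev ν A Z δ q fun i => X i ω)) μ :=
    integrable_of_ae_mem_Icc (measurable_sup'_max_zero s hs hcdm)
      (Eventually.of_forall fun ω => sup'_max_zero_mem_Icc s hs hn0 fun q _ =>
        (le_abs_self _).trans (abs_countDev_le A Z hδ q _))
  rcases hp0.eq_or_lt with hpz | hppos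
  · -- If `A` is null, then all counts vanish almost surely.
    have hz : ∀ᵐ ω ∂μ, ∀ i, X i ω ∉ A := by
      rw [ae_all_iff]
      intro i
      refine ae_of_ae_map (p := fun e => e ∉ A) (hX i).aemeasurable ?_
      rw [hlaw i, ae_iff]
      simpa using (measureReal_eq_zero_iff).1 (hp ▸ hpz.symm)
    have hGz : ∀ q, ν.real (A ∩ {e | q < Z e}) = 0 := fun q => le_antisymm
      ((measureReal_mono Set.inter_subset_left).trans_eq hpz.symm) measureReal_nonneg
    have : (fun ω => s.sup' hs fun q => max 0 (countDev ν A Z δ q fun i => X i ω)) =ᵐ[μ] 0 := by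
      filter_upwards [hz] with ω hω
      have : ∀ q, countDev ν A Z δ q (fun i => X i ω) = 0 := fun q => by
        simp [countDev, hGz, Set.indicator, hω]
      simp [this]
    rw [integral_congr_ae this]
    simp only [Pi.zero_apply, integral_zero]
    positivity
  refine le_of_forall_pos_le_add fun ε hε => ?_
  obtain ⟨m, hm⟩ := exists_nat_gt (max 1 (n / ε))
  have hm1 : (1 : ℝ) < m := (le_max_left _ _).trans_lt hm
  have hm0 : (0 : ℝ) < m := by linarith
  have hm1' : 1 < m := by exact_mod_cast hm1
  have hnm : n * (p / m) ≤ ε := by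
    have h1 : n / ε < m := (le_max_right _ _).trans_lt hm
    rw [div_lt_iff₀ hε] at h1
    rw [mul_div_assoc', div_le_iff₀ hm0]
    nlinarith
  set c := p / m with hc
  have hc0 : 0 < c := by positivity
  have hmc : m * c = p := by rw [hc]; field_simp
  have hquant : ∀ k : ℕ, ∃ x : ℝ, (k ≤ m → G x = k * c) ∧ (k = 0 → x = 2) ∧ (k = m → x = -1) := by
    intro k
    rcases eq_or_ne k 0 with rfl | hk0
    · exact ⟨2, fun _ => by simp [hG2], fun _ => rfl, fun h => by omega⟩
    rcases eq_or_ne k m with rfl | hkm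
    · exact ⟨-1, fun _ => by rw [hGm1, hmc], fun h => absurd h hk0, fun _ => rfl⟩
    by_cases hle : k ≤ m
    · have := intermediate_value_Icc' (show (-1 : ℝ) ≤ 2 by norm_num) hcont.continuousOn
      rw [hGm1, hG2] at this
      obtain ⟨x, -, hx⟩ := this (show (k : ℝ) * c ∈ Set.Icc 0 p from ⟨by positivity, by
        rw [← hmc]; gcongr⟩)
      exact ⟨x, fun _ => hx, fun h => absurd h hk0, fun h => absurd h hkm⟩
    · exact ⟨0, fun h => absurd h hle, fun h => absurd h hk0, fun h => absurd h hkm⟩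
  choose x hxG hx0 hxm using hquant
  have hxanti : ∀ j k, j < k → k ≤ m → x k < x j := by
    intro j k hjk hkm
    by_contra hle
    have h1 := hanti (not_lt.1 hle)
    rw [hxG j (by omega), hxG k hkm] at h1
    have : (j : ℝ) < k := by exact_mod_cast hjk
    nlinarith
  obtain ⟨l, hl, hlk⟩ := exists_label hA hZ m hxanti
  have hlk' : ∀ k ≤ m, ν.real (l ⁻¹' Set.Iio k) = k * c := by
    intro k hk
    rcases Nat.eq_zero_or_pos k with rfl | hk0
    · simp
    · rw [hlk k hk0 hk, ← hxG k hk]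
  have hlabc : ∀ j < m, ν (l ⁻¹' {j}) = ENNReal.ofReal c := by
    intro j hj
    have h1 : l ⁻¹' Set.Iio (j + 1) = l ⁻¹' Set.Iio j ∪ l ⁻¹' {j} := by
      ext x; simp only [Set.mem_preimage, Set.mem_Iio, Set.mem_union, Set.mem_singleton_iff]; omega
    have h2 := hlk' (j + 1) hj
    rw [h1, measureReal_union _ (hl (measurableSet_singleton j)), hlk' j hj.le] at h2
    · rw [← ofReal_measureReal]
      congr 1
      push_cast at h2
      linarith
    · rw [Set.disjoint_left]; intro x hx hx'
      simp only [Set.mem_preimage, Set.mem_Iio, Set.mem_singleton_iff] at hx hx'; omega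
  have hmain := integral_walkMax_labels_le hX hind hlaw hl hc0.le hlabc hδ
  have hyi : ∀ j, Integrable (fun ω => δ * ((∑ i, if l (X i ω) = j then (1 : ℝ) else 0) - n * c))
      μ := by
    intro j
    refine Integrable.const_mul (Integrable.sub (integrable_finsetSum _ fun i _ => ?_)
      (integrable_const _)) δ
    have : Measurable fun ω => if l (X i ω) = j then (1 : ℝ) else 0 :=
      Measurable.ite ((hl.comp (hX i)) (measurableSet_singleton j)) measurable_const
        measurable_const
    refine integrable_of_ae_mem_Icc this (a := 0) (b := 1) (Eventually.of_forall fun ω => ?_)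
    split_ifs <;> simp
  have hpt : ∀ ω, s.sup' hs (fun q => max 0 (countDev ν A Z δ q fun i => X i ω))
      ≤ walkMax (fun j => δ * ((∑ i, if l (X i ω) = j then (1 : ℝ) else 0) - n * c)) m + ε := by
    intro ω
    refine Finset.sup'_le _ _ fun q hq => max_le (add_nonneg (walkMax_nonneg _ _) hε.le) ?_
    -- `x (k + 1) < q ≤ x k` are the neighbouring quantiles of `q`.
    have hex : ∃ k, x (k + 1) < q ∧ k < m := ⟨m - 1, by
      rw [show m - 1 + 1 = m by omega, hxm m rfl]; linarith [(hs01 q hq).1], by omega⟩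
    classical
    set k := Nat.find hex with hk
    obtain ⟨hk1, hkm⟩ := Nat.find_spec hex
    have hk2 : q ≤ x k := by
      rcases Nat.eq_zero_or_pos k with h0 | h0
      · rw [hx0 k h0]; linarith [(hs01 q hq).2]
      · have := Nat.find_min hex (m := k - 1) (by omega)
        rw [show k - 1 + 1 = k by omega] at this
        by_contra hcon
        exact this ⟨not_le.1 hcon, by omega⟩
    have hGk : G (x k) = k * c := hxG k hkm.le
    have hGk1 : G (x (k + 1)) = k * c + c := by rw [hxG (k + 1) hkm]; push_cast; ring
    have hGq1 : G q ≤ k * c + c := hGk1 ▸ hanti hk1.le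
    have hGq2 : k * c ≤ G q := hGk ▸ hanti hk2
    have hup : ∀ e, (A ∩ {e | q < Z e}).indicator (1 : E → ℝ) e
        ≤ (Set.Iio (k + 1)).indicator (1 : ℕ → ℝ) (l e) := by
      intro e
      by_cases he : e ∈ A ∩ {e | q < Z e}
      · have : l e ∈ Set.Iio (k + 1) := by
          have : e ∈ A ∩ {e | x (k + 1) < Z e} := ⟨he.1, hk1.trans he.2⟩
          rwa [← hlk (k + 1) (by omega) hkm] at this
        rw [Set.indicator_of_mem he, Set.indicator_of_mem this]; simp
      · rw [Set.indicator_of_notMem he]; exact Set.indicator_nonneg (by simp) _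
    have hdown : ∀ e, (Set.Iio k).indicator (1 : ℕ → ℝ) (l e)
        ≤ (A ∩ {e | q < Z e}).indicator (1 : E → ℝ) e := by
      intro e
      by_cases he : l e ∈ Set.Iio k
      · have h0 : 1 ≤ k := by have : l e < k := he; omega
        have h1 : e ∈ A ∩ {e | x k < Z e} := by rw [← hlk k h0 hkm.le]; exact he
        have : e ∈ A ∩ {e | q < Z e} := ⟨h1.1, hk2.trans_lt h1.2⟩
        rw [Set.indicator_of_mem he, Set.indicator_of_mem this]; simp
      · rw [Set.indicator_of_notMem he]; exact Set.indicator_nonneg (by simp) _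
    have hs1 := Finset.sum_le_sum (s := (Finset.univ : Finset ι)) fun i _ => hup (X i ω)
    have hs2 := Finset.sum_le_sum (s := (Finset.univ : Finset ι)) fun i _ => hdown (X i ω)
    have hw1 := sum_range_le_walkMax
      (fun j => δ * ((∑ i, if l (X i ω) = j then (1 : ℝ) else 0) - n * c)) hkm
    have hw2 := sum_range_le_walkMax
      (fun j => δ * ((∑ i, if l (X i ω) = j then (1 : ℝ) else 0) - n * c)) hkm.le
    rw [sum_label_increments (fun i => l (X i ω)) n c δ] at hw1 hw2
    push_cast at hw1
    rcases eq_or_eq_neg_of_sq_eq_sq δ 1 (by rw [hδ, one_pow]) with rfl | rfl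
    · simp only [countDev, one_mul] at hw1 ⊢
      have : n * (k * c + c) ≤ n * G q + n * c := by nlinarith
      simp only [← hn, hG] at this ⊢
      linarith
    · simp only [countDev] at hw2 ⊢
      have : n * G q ≤ n * (k * c) + n * c := by nlinarith
      simp only [← hn, hG] at this ⊢
      linarith
  calc _ ≤ ∫ ω, (walkMax (fun j => δ * ((∑ i, if l (X i ω) = j then (1 : ℝ) else 0) - n * c)) m
        + ε) ∂μ := integral_mono hVi ((integrable_walkMax hyi m).add (integrable_const ε)) hpt
    _ ≤ _ := by
      rw [integral_add (integrable_walkMax hyi m) (integrable_const ε)]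
      simp only [integral_const, probReal_univ, one_smul]
      gcongr

end

/-! ### The empirical marginal revenue -/

section

variable {Ω : Type*} [MeasurableSpace Ω] {μ : Measure Ω} {ι : Type*} [Fintype ι]
variable {𝒟 : Measure Outcome} [IsProbabilityMeasure 𝒟] {L : ℝ}

instance isProbabilityMeasure_restrict_unitInterval :
    IsProbabilityMeasure (volume.restrict (Set.Icc (0 : ℝ) 1)) := ⟨by simp⟩

/-- The event that the price exceeds `u`. -/
def priceAbove (u : ℝ) : Set Outcome := {x | u < price x}

/-- Layer cake: a marginal sale is the average over `u` of the indicator that the price exceeds `u`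
and the demand exceeds `q`. -/
lemma integral_indicator_priceAbove {x : Outcome} (hx : price x ∈ Set.Icc (0 : ℝ) 1) (q : ℝ) :
    ∫ u in Set.Icc (0 : ℝ) 1, (priceAbove u ∩ {e | q < demand e}).indicator (1 : Outcome → ℝ) x
      = marginalSale q x := by
  by_cases hq : q < demand x
  · have e : ∀ u, (priceAbove u ∩ {e | q < demand e}).indicator (1 : Outcome → ℝ) x
        = (Set.Iio (price x)).indicator (1 : ℝ → ℝ) u := fun u => by
      by_cases hu : u < price x
      · rw [Set.indicator_of_mem (show x ∈ priceAbove u ∩ {e | q < demand e} from ⟨hu, hq⟩),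
          Set.indicator_of_mem (show u ∈ Set.Iio (price x) from hu)]; rfl
      · rw [Set.indicator_of_notMem (fun h : x ∈ priceAbove u ∩ {e | q < demand e} => hu h.1),
          Set.indicator_of_notMem (fun h : u ∈ Set.Iio (price x) => hu h)]
    simp_rw [e]
    rw [integral_indicator_one measurableSet_Iio, measureReal_restrict_apply measurableSet_Iio]
    have : Set.Iio (price x) ∩ Set.Icc 0 1 = Set.Ico 0 (price x) := by
      ext u
      simp only [Set.mem_inter_iff, Set.mem_Iio, Set.mem_Icc, Set.mem_Ico]
      constructor
      · rintro ⟨h1, h2, -⟩; exact ⟨h2, h1⟩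
      · rintro ⟨h1, h2⟩; exact ⟨h2, h1, h2.le.trans hx.2⟩
    rw [this, Real.volume_real_Ico_of_le hx.1]
    simp [marginalSale, hq]
  · have e : ∀ u, (priceAbove u ∩ {e | q < demand e}).indicator (1 : Outcome → ℝ) x = 0 :=
      fun u => Set.indicator_of_notMem (fun h => hq h.2) _
    simp only [e]; simp [marginalSale, hq]

lemma measurable_indicator_priceAbove {α : Type*} [MeasurableSpace α] {f : α → Outcome}
    (hf : Measurable f) (q : ℝ) : Measurable fun z : α × ℝ =>
      (priceAbove z.2 ∩ {e | q < demand e}).indicator (1 : Outcome → ℝ) (f z.1) := by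
  have : (fun z : α × ℝ =>
      (priceAbove z.2 ∩ {e | q < demand e}).indicator (1 : Outcome → ℝ) (f z.1))
      = ({z : α × ℝ | z.2 < price (f z.1)} ∩ {z | q < demand (f z.1)}).indicator 1 := by
    funext z; rfl
  rw [this]
  refine measurable_one.indicator ((measurableSet_lt measurable_snd ?_).inter
    (measurableSet_lt measurable_const ?_))
  · exact measurable_price.comp (hf.comp measurable_fst)
  · exact measurable_demand.comp (hf.comp measurable_fst)

lemma LearningAssumption.integral_measureReal_priceAbove (h : LearningAssumption 𝒟 L) (q : ℝ) :
    ∫ u in Set.Icc (0 : ℝ) 1, 𝒟.real (priceAbove u ∩ {e | q < demand e})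
      = marginalRevenue 𝒟 q := by
  have hm := measurable_indicator_priceAbove (measurable_id (α := Outcome)) q
  have hint : Integrable (fun z : Outcome × ℝ =>
      (priceAbove z.2 ∩ {e | q < demand e}).indicator (1 : Outcome → ℝ) z.1)
      (𝒟.prod (volume.restrict (Set.Icc (0 : ℝ) 1))) :=
    integrable_of_ae_mem_Icc hm (a := 0) (b := 1) (Eventually.of_forall fun z => by
      by_cases hz : z.1 ∈ priceAbove z.2 ∩ {e | q < demand e}
      · rw [Set.indicator_of_mem hz]; simp
      · rw [Set.indicator_of_notMem hz]; simp)
  have e1 : ∀ u, 𝒟.real (priceAbove u ∩ {e | q < demand e})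
      = ∫ x, (priceAbove u ∩ {e | q < demand e}).indicator (1 : Outcome → ℝ) x ∂𝒟 := fun u =>
    (integral_indicator_one ((measurableSet_lt measurable_const measurable_price).inter
      (measurableSet_lt measurable_const measurable_demand))).symm
  simp_rw [e1]
  rw [← integral_integral_swap hint]
  exact integral_congr_ae (h.price_mem.mono fun x hx => integral_indicator_priceAbove hx q)

lemma measurable_countDev_priceAbove {X : ι → Ω → Outcome} (hX : ∀ i, Measurable (X i)) (δ q : ℝ) :
    Measurable fun z : Ω × ℝ => countDev 𝒟 (priceAbove z.2) demand δ q fun i => X i z.1 := by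
  have hGm : Measurable fun u : ℝ => 𝒟.real (priceAbove u ∩ {e | q < demand e}) :=
    Antitone.measurable fun u u' huu => measureReal_mono
      (Set.inter_subset_inter_left _ fun e (he : u' < price e) => huu.trans_lt he)
  unfold countDev
  exact ((Finset.measurable_fun_sum _ fun i _ => measurable_indicator_priceAbove (hX i) q).sub
      ((hGm.comp measurable_snd).const_mul _)).const_mul δ

lemma integrable_countDev_priceAbove {δ : ℝ} (hδ : δ ^ 2 = 1) (q : ℝ) (x : ι → Outcome) :
    Integrable (fun u => countDev 𝒟 (priceAbove u) demand δ q x)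
      (volume.restrict (Set.Icc (0 : ℝ) 1)) :=
  Integrable.of_bound ((measurable_countDev_priceAbove (X := fun i (_ : Unit) => x i)
    (fun _ => measurable_const) δ q).comp
      (measurable_prodMk_left (x := ()))).aestronglyMeasurable (Fintype.card ι)
    (Eventually.of_forall fun u => abs_countDev_le (priceAbove u) demand hδ q x)

lemma LearningAssumption.integral_countDev_priceAbove (h : LearningAssumption 𝒟 L) (δ q : ℝ)
    {x : ι → Outcome} (hx : ∀ i, price (x i) ∈ Set.Icc (0 : ℝ) 1) :
    ∫ u in Set.Icc (0 : ℝ) 1, countDev 𝒟 (priceAbove u) demand δ q x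
      = δ * (∑ i, marginalSale q (x i) - Fintype.card ι * marginalRevenue 𝒟 q) := by
  have hi1 : ∀ i, Integrable (fun u =>
      (priceAbove u ∩ {e | q < demand e}).indicator (1 : Outcome → ℝ) (x i))
      (volume.restrict (Set.Icc (0 : ℝ) 1)) := fun i =>
    integrable_of_ae_mem_Icc ((measurable_indicator_priceAbove (f := fun _ : Unit => x i)
      measurable_const q).comp (measurable_prodMk_left (x := ()))) (a := 0) (b := 1)
      (Eventually.of_forall fun u => by
        by_cases hz : x i ∈ priceAbove u ∩ {e | q < demand e}
        · simp [Set.indicator_of_mem hz]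
        · simp [Set.indicator_of_notMem hz])
  have hi2 : Integrable (fun u => 𝒟.real (priceAbove u ∩ {e | q < demand e}))
      (volume.restrict (Set.Icc (0 : ℝ) 1)) := by
    refine integrable_of_ae_mem_Icc (Antitone.measurable fun u u' huu => measureReal_mono
      (Set.inter_subset_inter_left _ fun e (he : u' < price e) => huu.trans_lt he))
      (a := 0) (b := 1) (Eventually.of_forall fun u => ⟨measureReal_nonneg, measureReal_le_one⟩)
  simp only [countDev]
  rw [integral_const_mul, integral_sub (integrable_finsetSum _ fun i _ => hi1 i)
    (hi2.const_mul _), integral_finsetSum _ fun i _ => hi1 i, integral_const_mul,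
    h.integral_measureReal_priceAbove q]
  congr 2
  exact Finset.sum_congr rfl fun i _ => integral_indicator_priceAbove (hx i) q

/-- The log-free maximal inequality for the empirical marginal revenue: the mean of the largest
one-sided deviation of `∑ i, marginalSale q (X i)` over finitely many `q` is at most `5/6 √n`. -/
lemma LearningAssumption.integral_sup_marginalSale_le (h : LearningAssumption 𝒟 L)
    [IsProbabilityMeasure μ] {X : ι → Ω → Outcome}
    (hX : ∀ i, Measurable (X i)) (hind : iIndepFun X μ) (hlaw : ∀ i, μ.map (X i) = 𝒟)
    {δ : ℝ} (hδ : δ ^ 2 = 1) (s : Finset ℝ) (hs : s.Nonempty)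
    (hs01 : ∀ q ∈ s, q ∈ Set.Icc (0 : ℝ) 1) :
    ∫ ω, s.sup' hs (fun q => max 0 (δ * (∑ i, marginalSale q (X i ω)
      - Fintype.card ι * marginalRevenue 𝒟 q))) ∂μ ≤ 5 / 6 * √(Fintype.card ι) := by
  set lam : Measure ℝ := volume.restrict (Set.Icc (0 : ℝ) 1) with hlam
  set V : Ω × ℝ → ℝ := fun z => s.sup' hs fun q =>
    max 0 (countDev 𝒟 (priceAbove z.2) demand δ q fun i => X i z.1) with hV
  have hn0 : (0 : ℝ) ≤ Fintype.card ι := Nat.cast_nonneg _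
  have hVmem : ∀ z, V z ∈ Set.Icc (0 : ℝ) (Fintype.card ι) := fun z =>
    sup'_max_zero_mem_Icc s hs hn0 fun q _ => (le_abs_self _).trans (abs_countDev_le _ _ hδ q _)
  have hVm : Measurable V := measurable_sup'_max_zero s hs fun q =>
    measurable_countDev_priceAbove hX δ q
  have hVi : Integrable V (μ.prod lam) :=
    integrable_of_ae_mem_Icc hVm (Eventually.of_forall hVmem)
  have hprice : ∀ᵐ ω ∂μ, ∀ i, price (X i ω) ∈ Set.Icc (0 : ℝ) 1 := by
    rw [ae_all_iff]
    exact fun i => ae_of_ae_map (p := fun x => price x ∈ Set.Icc (0 : ℝ) 1) (hX i).aemeasurable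
      (by rw [hlaw i]; exact h.price_mem)
  have hVω : ∀ ω, Integrable (fun u => V (ω, u)) lam := fun ω =>
    integrable_of_ae_mem_Icc (hVm.comp measurable_prodMk_left)
      (Eventually.of_forall fun u => hVmem (ω, u))
  have hle : ∀ᵐ ω ∂μ, s.sup' hs (fun q => max 0 (δ * (∑ i, marginalSale q (X i ω)
      - Fintype.card ι * marginalRevenue 𝒟 q))) ≤ ∫ u, V (ω, u) ∂lam := by
    filter_upwards [hprice] with ω hω
    refine Finset.sup'_le _ _ fun q hq => max_le
      (integral_nonneg fun u => (hVmem (ω, u)).1) ?_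
    rw [← h.integral_countDev_priceAbove δ q hω]
    refine integral_mono (integrable_countDev_priceAbove hδ q _) (hVω ω) fun u => ?_
    exact (le_max_right 0 _).trans
      (Finset.le_sup' (fun q => max 0 (countDev 𝒟 (priceAbove u) demand δ q fun i => X i ω)) hq)
  have hLm : Measurable fun ω => s.sup' hs (fun q => max 0 (δ * (∑ i, marginalSale q (X i ω)
      - Fintype.card ι * marginalRevenue 𝒟 q))) :=
    measurable_sup'_max_zero s hs fun q => ((Finset.measurable_fun_sum _ fun i _ =>
      (measurable_marginalSale q).comp (hX i)).sub measurable_const).const_mul δ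
  have hLi : Integrable (fun ω => s.sup' hs (fun q => max 0 (δ * (∑ i, marginalSale q (X i ω)
      - Fintype.card ι * marginalRevenue 𝒟 q)))) μ := by
    refine integrable_of_ae_mem_Icc hLm (a := 0) (b := Fintype.card ι) ?_
    filter_upwards [hprice] with ω hω
    refine sup'_max_zero_mem_Icc s hs hn0 fun q _ => ?_
    rw [← h.integral_countDev_priceAbove δ q hω]
    exact (integral_mem_Icc_of_ae
      ((measurable_countDev_priceAbove hX δ q).comp (measurable_prodMk_left (x := ω)))
      (a := -(Fintype.card ι : ℝ)) (b := Fintype.card ι) (Eventually.of_forall fun u =>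
        abs_le.1 (abs_countDev_le (priceAbove u) demand hδ q fun i => X i ω))).2
  calc _ ≤ ∫ ω, ∫ u, V (ω, u) ∂lam ∂μ := integral_mono_ae hLi hVi.integral_prod_left hle
    _ = ∫ u, ∫ ω, V (ω, u) ∂μ ∂lam := integral_integral_swap hVi
    _ ≤ ∫ u, 5 / 6 * √(Fintype.card ι) ∂lam := by
        refine integral_mono hVi.integral_prod_right (integrable_const _) fun u => ?_
        exact integral_sup_countDev_le hX hind hlaw
          (measurableSet_lt measurable_const measurable_price) measurable_demand h.demand_mem
          h.measure_demand_eq hδ s hs hs01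
    _ = _ := by simp

end

section

variable {Ω : Type*} [MeasurableSpace Ω] {μ : Measure Ω}
variable {𝒟 : Measure Outcome} {L : ℝ} {T : ℕ} {X : ℕ → Ω → Outcome} {W Q : ℕ → Ω → ℝ}

/-! ### The draws of Nature along a play -/

/-- The draws of the rounds `1, …, T` are i.i.d. with law `𝒟`. -/
structure IidDraws (𝒟 : Measure Outcome) (μ : Measure Ω) (T : ℕ) (X : ℕ → Ω → Outcome) :
    Prop where
  measurable : ∀ t ∈ Finset.Icc 1 T, Measurable (X t)
  law : ∀ t ∈ Finset.Icc 1 T, μ.map (X t) = 𝒟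
  indep : iIndepFun (fun t : Finset.Icc 1 T => X t) μ

/-- Draws that are independent of the past one by one are jointly independent. -/
lemma FollowsProtocol.iidDraws [IsProbabilityMeasure μ] (h : FollowsProtocol 𝒟 μ T X W Q) :
    IidDraws 𝒟 μ T X := by
  obtain ⟨ℱ, hℱ⟩ := h
  refine ⟨fun t ht => (hℱ t ht).2.2.1.mono (ℱ.le _) le_rfl, fun t ht => (hℱ t ht).2.2.2.1.map_eq,
    ?_⟩
  rw [iIndepFun_iff_measure_inter_preimage_eq_mul]
  intro S
  induction S using Finset.induction_on_max with
  | empty => intro sets _; simp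
  | insert a S hlt ih =>
    intro sets hsets
    have ha : a ∉ S := fun h => lt_irrefl _ (hlt a h)
    rw [Finset.prod_insert ha, ← ih fun i hi => hsets i (Finset.mem_insert_of_mem hi),
      Finset.set_biInter_insert]
    refine (Indep_iff _ _ _).1 (hℱ a a.2).2.2.2.2 _ _
      ⟨sets a, hsets a (Finset.mem_insert_self a S), rfl⟩ ?_
    refine Finset.measurableSet_biInter _ fun i hi => ?_
    have h1 : Measurable[ℱ a] (X i) := (hℱ i i.2).2.2.1.mono (ℱ.mono (hlt i hi)) le_rfl
    exact h1 (hsets i (Finset.mem_insert_of_mem hi))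

lemma FollowsProtocol.measurable_wholesale (h : FollowsProtocol 𝒟 μ T X W Q) {t : ℕ}
    (ht : t ∈ Finset.Icc 1 T) : Measurable (W t) := by
  obtain ⟨ℱ, hℱ⟩ := h
  exact (hℱ t ht).1.mono (ℱ.le _) le_rfl

lemma FollowsProtocol.measurable_quantity (h : FollowsProtocol 𝒟 μ T X W Q) {t : ℕ}
    (ht : t ∈ Finset.Icc 1 T) : Measurable (Q t) := by
  obtain ⟨ℱ, hℱ⟩ := h
  exact (hℱ t ht).2.1.mono (ℱ.le _) le_rfl

lemma FollowsProtocol.indepFun_quantity (h : FollowsProtocol 𝒟 μ T X W Q) {t : ℕ}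
    (ht : t ∈ Finset.Icc 1 T) : IndepFun (X t) (Q t) μ := by
  obtain ⟨ℱ, hℱ⟩ := h
  exact (IndepFun_iff_Indep _ _ _).2
    (indep_of_indep_of_le_right (hℱ t ht).2.2.2.2 (hℱ t ht).2.1.comap_le)

lemma FollowsProtocol.indep_wholesale (h : FollowsProtocol 𝒟 μ T X W Q) {t : ℕ}
    (ht : t ∈ Finset.Icc 1 T) : Indep (MeasurableSpace.comap (X t) inferInstance)
      (MeasurableSpace.comap (W t) inferInstance) μ := by
  obtain ⟨ℱ, hℱ⟩ := h
  exact indep_of_indep_of_le_right (hℱ t ht).2.2.2.2 (hℱ t ht).1.comap_le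

namespace IidDraws

lemma ae_of_ae (h : IidDraws 𝒟 μ T X) {p : Outcome → Prop} (hp : ∀ᵐ x ∂𝒟, p x) :
    ∀ᵐ ω ∂μ, ∀ t ∈ Finset.Icc 1 T, p (X t ω) := by
  rw [ae_all_iff]
  intro t
  by_cases ht : t ∈ Finset.Icc 1 T
  · have := ae_of_ae_map (p := p) (h.measurable t ht).aemeasurable (by rw [h.law t ht]; exact hp)
    filter_upwards [this] with ω hω _ using hω
  · exact Eventually.of_forall fun ω h' => absurd h' ht

lemma integral_comp (h : IidDraws 𝒟 μ T X) {t : ℕ} (ht : t ∈ Finset.Icc 1 T) {f : Outcome → ℝ}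
    (hf : Measurable f) : ∫ ω, f (X t ω) ∂μ = ∫ x, f x ∂𝒟 := by
  rw [← h.law t ht, integral_map (h.measurable t ht).aemeasurable hf.aestronglyMeasurable]

lemma indep_subset (h : IidDraws 𝒟 μ T X) {S : Finset ℕ} (hS : S ⊆ Finset.Icc 1 T) :
    iIndepFun (fun t : S => X t) μ :=
  h.indep.precomp (g := fun t : S => (⟨t, hS t.2⟩ : Finset.Icc 1 T)) fun _ _ hab =>
    Subtype.ext (congrArg (fun t : Finset.Icc 1 T => (t : ℕ)) hab)

/-- The largest one-sided deviation of the empirical marginal revenue of the rounds in `S`, over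
the points of the finite set `s`, multiplied by the number of rounds. -/
noncomputable def supDev (𝒟 : Measure Outcome) {α : Type*} (X : ℕ → α → Outcome) (δ : ℝ)
    (s : Finset ℝ) (hs : s.Nonempty) (S : Finset ℕ) (ω : α) : ℝ :=
  s.sup' hs fun q => max 0 (δ * (∑ t ∈ S, marginalSale q (X t ω) - S.card * marginalRevenue 𝒟 q))

lemma supDev_nonneg {α : Type*} {X : ℕ → α → Outcome} {δ : ℝ} {s : Finset ℝ}
    {hs : s.Nonempty} {S : Finset ℕ} (ω : α) :
    0 ≤ supDev 𝒟 X δ s hs S ω := by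
  obtain ⟨q, hq⟩ := hs
  exact (le_max_left _ _).trans (Finset.le_sup' (fun q => max 0 (δ * (∑ t ∈ S,
    marginalSale q (X t ω) - S.card * marginalRevenue 𝒟 q))) hq)

lemma le_supDev {α : Type*} {X : ℕ → α → Outcome} {δ q : ℝ} {s : Finset ℝ}
    {hs : s.Nonempty} {S : Finset ℕ} (hq : q ∈ s) (ω : α) :
    δ * (∑ t ∈ S, marginalSale q (X t ω) - S.card * marginalRevenue 𝒟 q)
      ≤ supDev 𝒟 X δ s hs S ω :=
  (le_max_right _ _).trans (Finset.le_sup' (fun q => max 0 (δ * (∑ t ∈ S,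
    marginalSale q (X t ω) - S.card * marginalRevenue 𝒟 q))) hq)

variable [IsProbabilityMeasure μ]

/-- The mean absolute deviation of a sum of `[0,1]`-valued functions of the draws. -/
lemma integral_abs_le (h : IidDraws 𝒟 μ T X) {S : Finset ℕ} (hS : S ⊆ Finset.Icc 1 T)
    {f : Outcome → ℝ} (hf : Measurable f) (hf01 : ∀ᵐ x ∂𝒟, f x ∈ Set.Icc (0 : ℝ) 1) :
    Integrable (fun ω => ∑ t ∈ S, f (X t ω) - S.card * ∫ x, f x ∂𝒟) μ ∧
    ∫ ω, |∑ t ∈ S, f (X t ω) - S.card * ∫ x, f x ∂𝒟| ∂μ ≤ √S.card / 2 := by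
  set p := ∫ x, f x ∂𝒟 with hp
  obtain ⟨h1, -, h3⟩ := integral_sum_sub_sq_le (X := fun t : S => X t)
    (fun t => h.measurable t (hS t.2)) (h.indep_subset hS) (fun t => h.law t (hS t.2)) hf hf01
    hp.symm
  have e : ∀ ω, ∑ t : S, f (X t ω) - Fintype.card S * p = ∑ t ∈ S, f (X t ω) - S.card * p :=
    fun ω => by rw [Finset.sum_coe_sort S fun t => f (X t ω), Fintype.card_coe]
  simp_rw [e] at h1 h3
  refine ⟨h1.integrable (by norm_num), (abs_integral_le_sqrt h1).trans ?_⟩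
  have h4 : p * (1 - p) ≤ 1 / 4 := by nlinarith [sq_nonneg (p - 1 / 2)]
  have h5 : (0 : ℝ) ≤ S.card := Nat.cast_nonneg _
  rw [Fintype.card_coe] at h3
  refine (Real.sqrt_le_sqrt (h3.trans (mul_le_mul_of_nonneg_left h4 h5))).trans ?_
  rw [Real.sqrt_mul h5, show (1 / 4 : ℝ) = (1 / 2) ^ 2 by norm_num, Real.sqrt_sq (by norm_num)]
  linarith

/-- Hoeffding's inequality for the draws of the rounds in `S`. -/
lemma hoeffding (h : IidDraws 𝒟 μ T X) {S : Finset ℕ} (hS : S ⊆ Finset.Icc 1 T)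
    (hS0 : S.Nonempty) {f : Outcome → ℝ} (hf : Measurable f)
    (hf01 : ∀ᵐ x ∂𝒟, f x ∈ Set.Icc (0 : ℝ) 1) {δ : ℝ} (hδ : δ ^ 2 = 1) {y n : ℝ} (hy : 0 ≤ y)
    (hn : S.card ≤ n) :
    μ.real {ω | y ≤ δ * (∑ t ∈ S, f (X t ω) - S.card * ∫ x, f x ∂𝒟)}
      ≤ Real.exp (-2 * y ^ 2 / n) := by
  set p := ∫ x, f x ∂𝒟 with hp
  have hsub : ∀ t : S, HasSubgaussianMGF (fun ω => δ * (f (X t ω) - p)) (1 / 4) μ := by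
    intro t
    have ht := hS t.2
    have h1 := hasSubgaussianMGF_of_mem_Icc (X := fun ω => f (X t ω)) (a := 0) (b := 1)
      (hf.comp (h.measurable t ht)).aemeasurable
      (ae_of_ae_map (p := fun x => f x ∈ Set.Icc (0 : ℝ) 1) (h.measurable t ht).aemeasurable
        (by rw [h.law t ht]; exact hf01))
    rw [h.integral_comp ht hf] at h1
    have e1 : (‖(1 : ℝ) - 0‖₊ / 2) ^ 2 = 1 / 4 := by ext; norm_num
    rw [e1] at h1
    rcases eq_or_eq_neg_of_sq_eq_sq δ 1 (by rw [hδ, one_pow]) with rfl | rfl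
    · simpa only [one_mul] using h1
    · have e2 : (fun ω => -1 * (f (X t ω) - p)) = -fun ω => f (X t ω) - p := by
        funext ω; simp
      rw [e2]
      exact h1.neg
  have hind : iIndepFun (fun t : S => fun ω => δ * (f (X t ω) - p)) μ :=
    (h.indep_subset hS).comp (fun _ x => δ * (f x - p)) fun _ => (hf.sub_const p).const_mul δ
  have h1 := HasSubgaussianMGF.measure_sum_ge_le_of_iIndepFun hind (s := Finset.univ)
    (fun t _ => hsub t) hy
  have e : ∀ ω, ∑ t : S, δ * (f (X t ω) - p) = δ * (∑ t ∈ S, f (X t ω) - S.card * p) := fun ω => by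
    rw [← Finset.mul_sum, Finset.sum_sub_distrib, Finset.sum_coe_sort S fun t => f (X t ω)]
    simp
  simp_rw [e] at h1
  refine h1.trans (Real.exp_le_exp.2 ?_)
  have hc0 : (0 : ℝ) < S.card := by exact_mod_cast hS0.card_pos
  have e2 : (2 : ℝ) * ((∑ _t : S, (1 / 4 : NNReal) : NNReal) : ℝ) = S.card / 2 := by
    simp; ring
  rw [e2, neg_div, neg_mul, neg_div, neg_le_neg_iff, div_div_eq_mul_div, mul_comm]
  gcongr

variable [IsProbabilityMeasure 𝒟]

lemma integral_supDev_le (h : IidDraws 𝒟 μ T X) (hD : LearningAssumption 𝒟 L) {S : Finset ℕ}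
    (hS : S ⊆ Finset.Icc 1 T) {δ : ℝ} (hδ : δ ^ 2 = 1) (s : Finset ℝ) (hs : s.Nonempty)
    (hs01 : ∀ q ∈ s, q ∈ Set.Icc (0 : ℝ) 1) :
    Integrable (supDev 𝒟 X δ s hs S) μ ∧
      ∫ ω, supDev 𝒟 X δ s hs S ω ∂μ ≤ 5 / 6 * √S.card := by
  have h1 := hD.integral_sup_marginalSale_le (X := fun t : S => X t)
    (fun t => h.measurable t (hS t.2)) (h.indep_subset hS) (fun t => h.law t (hS t.2)) hδ s hs hs01
  have e : ∀ q ω, ∑ t : S, marginalSale q (X t ω) = ∑ t ∈ S, marginalSale q (X t ω) :=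
    fun q ω => Finset.sum_coe_sort S fun t => marginalSale q (X t ω)
  simp_rw [e, Fintype.card_coe] at h1
  refine ⟨?_, h1⟩
  have hm : Measurable (supDev 𝒟 X δ s hs S) := measurable_sup'_max_zero s hs fun q =>
    ((Finset.measurable_fun_sum _ fun t ht =>
      (measurable_marginalSale q).comp (h.measurable t (hS ht))).sub measurable_const).const_mul δ
  refine integrable_of_ae_mem_Icc hm (a := 0) (b := S.card) ?_
  filter_upwards [h.ae_of_ae hD.price_mem] with ω hω
  refine sup'_max_zero_mem_Icc s hs (Nat.cast_nonneg _) fun q _ => ?_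
  have h2 : ∑ t ∈ S, marginalSale q (X t ω) ∈ Set.Icc (0 : ℝ) S.card := by
    refine ⟨Finset.sum_nonneg fun t ht => (marginalSale_mem_Icc (hω t (hS ht)) q).1, ?_⟩
    simpa using Finset.sum_le_sum fun t ht => (marginalSale_mem_Icc (hω t (hS ht)) q).2
  have h3 : (S.card : ℝ) * marginalRevenue 𝒟 q ∈ Set.Icc (0 : ℝ) S.card :=
    ⟨mul_nonneg (Nat.cast_nonneg _) (hD.marginalRevenue_mem q).1,
      mul_le_of_le_one_right (Nat.cast_nonneg _) (hD.marginalRevenue_mem q).2⟩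
  rcases eq_or_eq_neg_of_sq_eq_sq δ 1 (by rw [hδ, one_pow]) with rfl | rfl <;>
    linarith [h2.1, h2.2, h3.1, h3.2]

end IidDraws

end

/-! ### Grid sizes -/

lemma rpow_third_le_gridSize (T : ℕ) : (T : ℝ) ^ (1 / 3 : ℝ) ≤ gridSize T := Nat.le_ceil _

lemma gridSize_lt (T : ℕ) : (gridSize T : ℝ) < (T : ℝ) ^ (1 / 3 : ℝ) + 1 :=
  Nat.ceil_lt_add_one (by positivity)

lemma rpow_third_pow (T : ℕ) : ((T : ℝ) ^ (1 / 3 : ℝ)) ^ 3 = T := by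
  rw [← Real.rpow_natCast, ← Real.rpow_mul (Nat.cast_nonneg T)]
  norm_num

lemma blocks_eq (T : ℕ) : blocks T = gridSize T + 1 :=
  Nat.ceil_add_one (by positivity)

lemma three_le_gridSize {T : ℕ} (hT : 12 ≤ T) : 3 ≤ gridSize T := by
  have h1 : (2 : ℝ) < (T : ℝ) ^ (1 / 3 : ℝ) := by
    have h3 := rpow_third_pow T
    have hT' : (12 : ℝ) ≤ T := by exact_mod_cast hT
    by_contra hle
    have : ((T : ℝ) ^ (1 / 3 : ℝ)) ^ 3 ≤ 2 ^ 3 := by gcongr; exact not_lt.1 hle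
    linarith
  have := h1.trans_le (rpow_third_le_gridSize T)
  exact_mod_cast this

lemma explore_le {T : ℕ} (hT : 12 ≤ T) : gridSize T ^ 2 + gridSize T ≤ T := by
  have h3 := rpow_third_pow T
  have hlt := gridSize_lt T
  have hx0 : 0 ≤ (T : ℝ) ^ (1 / 3 : ℝ) := by positivity
  generalize (T : ℝ) ^ (1 / 3 : ℝ) = x at *
  rcases le_or_gt x 3 with hx | hx
  · have : (gridSize T : ℝ) < 4 := by linarith
    have : gridSize T < 4 := by exact_mod_cast this
    nlinarith
  · have h1 : (gridSize T : ℝ) ^ 2 + gridSize T ≤ T := by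
      have : (0 : ℝ) ≤ gridSize T := Nat.cast_nonneg _
      nlinarith [mul_pos (sub_pos.2 hx) (sub_pos.2 hx),
        mul_pos (mul_pos (sub_pos.2 hx) (sub_pos.2 hx)) (sub_pos.2 hx)]
    exact_mod_cast h1

/-! ### Pathwise analysis of a play -/

/-- One realization of a play: the moves of both players along given draws in `[0,1]^3`. -/
structure IsRealization (T : ℕ) (x : ℕ → Outcome) (w q : ℕ → ℝ) : Prop where
  cost_mem : ∀ t ∈ Finset.Icc 1 T, cost (x t) ∈ Set.Icc (0 : ℝ) 1
  price_mem : ∀ t ∈ Finset.Icc 1 T, price (x t) ∈ Set.Icc (0 : ℝ) 1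
  demand_mem : ∀ t ∈ Finset.Icc 1 T, demand (x t) ∈ Set.Icc (0 : ℝ) 1
  sweep : ∀ t ∈ Finset.Icc 1 (gridSize T + 1), ∀ s ∈ Finset.Icc 1 (gridSize T),
    w ((t - 1) * gridSize T + s) = (s : ℝ) / ((gridSize T : ℝ) + 1)
  first_mem : q 1 ∈ quantityGrid T
  leader : ∀ t ∈ Finset.Icc 2 T, q t ∈ quantityGrid T ∧ ∀ r ∈ quantityGrid T,
    1 / ((t : ℝ) - 1) * (∑ s ∈ Finset.Icc 1 (t - 1), min r (demand (x s)) * price (x s)) - r * w t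
      ≤ 1 / ((t : ℝ) - 1) * (∑ s ∈ Finset.Icc 1 (t - 1), min (q t) (demand (x s)) * price (x s))
        - q t * w t

/-- The round `S` of the last sweep whose price the supplier commits to, with the cost estimate
`c`. -/
structure IsCommitment (T : ℕ) (w q : ℕ → ℝ) (c : ℝ) (S : ℕ) : Prop where
  mem : S ∈ Finset.Icc (gridSize T ^ 2 + 1) (gridSize T ^ 2 + gridSize T)
  isMax : ∀ s ∈ Finset.Icc (gridSize T ^ 2 + 1) (gridSize T ^ 2 + gridSize T),
    q s * (w s - c) ≤ q S * (w S - c)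
  commit : ∀ t ∈ Finset.Icc (gridSize T ^ 2 + gridSize T + 1) T, w t = w S

/-- The sum of the marginal sales at `q` over the first `n` rounds. -/
noncomputable def saleSum (x : ℕ → Outcome) (n : ℕ) (q : ℝ) : ℝ :=
  ∑ s ∈ Finset.Icc 1 n, marginalSale q (x s)

lemma saleSum_add (x : ℕ → Outcome) (n j : ℕ) (r : ℝ) :
    saleSum x (n + j) r
      = saleSum x n r + ∑ t ∈ Finset.Icc (n + 1) (n + j), marginalSale r (x t) := by
  have hsplit : Finset.Icc 1 (n + j) = Finset.Icc 1 n ∪ Finset.Icc (n + 1) (n + j) := by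
    ext i; simp only [Finset.mem_union, Finset.mem_Icc]; omega
  have hdisj : Disjoint (Finset.Icc 1 n) (Finset.Icc (n + 1) (n + j)) := by
    rw [Finset.disjoint_left]; intro i hi hi'; rw [Finset.mem_Icc] at hi hi'; omega
  rw [saleSum, saleSum, hsplit, Finset.sum_union hdisj]

section Realization

variable {T : ℕ} {x : ℕ → Outcome} {w q : ℕ → ℝ}

lemma quantityGrid_mem {r : ℝ} (hr : r ∈ quantityGrid T) :
    1 / ((gridSize T : ℝ) + 1) ≤ r ∧ r ≤ 1 := by
  obtain ⟨k, hk, rfl⟩ := hr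
  rw [Finset.mem_Icc] at hk
  have h1 : (1 : ℝ) ≤ k := by exact_mod_cast hk.1
  have h2 : (k : ℝ) ≤ gridSize T := by exact_mod_cast hk.2
  constructor
  · gcongr
  · rw [div_le_one (by positivity)]; linarith

namespace IsRealization

lemma quantity_mem_grid (h : IsRealization T x w q) {t : ℕ} (ht : t ∈ Finset.Icc 1 T) :
    q t ∈ quantityGrid T := by
  rw [Finset.mem_Icc] at ht
  rcases ht.1.eq_or_lt with rfl | h1
  · exact h.first_mem
  · exact (h.leader t (Finset.mem_Icc.2 ⟨h1, ht.2⟩)).1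

lemma quantity_pos (h : IsRealization T x w q) {t : ℕ} (ht : t ∈ Finset.Icc 1 T) : 0 < q t :=
  lt_of_lt_of_le (by positivity) (quantityGrid_mem (h.quantity_mem_grid ht)).1

lemma quantity_le_one (h : IsRealization T x w q) {t : ℕ} (ht : t ∈ Finset.Icc 1 T) : q t ≤ 1 :=
  (quantityGrid_mem (h.quantity_mem_grid ht)).2

lemma saleSum_antitone (h : IsRealization T x w q) {n : ℕ} (hn : n ≤ T) :
    Antitone (saleSum x n) := fun _ _ hq => Finset.sum_le_sum fun s hs =>
  marginalSale_antitone (h.price_mem s (Finset.Icc_subset_Icc_right hn hs)).1 hq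

/-- The first-order conditions of the leader on the grid: its quantity `k / (N + 1)` is where the
empirical marginal revenue crosses the wholesale price, up to one grid step. -/
lemma leader_bracket (h : IsRealization T x w q) {t : ℕ} (ht : t ∈ Finset.Icc 2 T)
    (hw : 0 ≤ w t) : ∃ k ∈ Finset.Icc 1 (gridSize T), q t = (k : ℝ) / ((gridSize T : ℝ) + 1) ∧
      (2 ≤ k → ((t - 1 : ℕ) : ℝ) * w t
        ≤ saleSum x (t - 1) (((k - 1 : ℕ) : ℝ) / ((gridSize T : ℝ) + 1))) ∧
      saleSum x (t - 1) (((k + 1 : ℕ) : ℝ) / ((gridSize T : ℝ) + 1)) ≤ ((t - 1 : ℕ) : ℝ) * w t := by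
  obtain ⟨⟨k, hk, hqk⟩, hmax⟩ := h.leader t ht
  rw [Finset.mem_Icc] at ht hk
  set H : ℝ := (gridSize T : ℝ) + 1 with hH
  have hH0 : 0 < H := by positivity
  set n : ℕ := t - 1 with hn
  have hnt : (t : ℝ) - 1 = (n : ℝ) := by rw [hn]; push_cast [show 1 ≤ t by omega]; ring
  have hn0 : (0 : ℝ) < n := by exact_mod_cast (show 0 < n by omega)
  have hsub : ∀ s ∈ Finset.Icc 1 n, s ∈ Finset.Icc 1 T := fun s hs =>
    Finset.Icc_subset_Icc_right (by omega) hs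
  have hgrad : ∀ r r' : ℝ, (∑ s ∈ Finset.Icc 1 n, min r' (demand (x s)) * price (x s))
      - ∑ s ∈ Finset.Icc 1 n, min r (demand (x s)) * price (x s) ≤ (r' - r) * saleSum x n r := by
    intro r r'
    rw [← Finset.sum_sub_distrib, saleSum, Finset.mul_sum]
    exact Finset.sum_le_sum fun s hs => revenue_sub_le (h.price_mem s (hsub s hs)).1 r r'
  have hopt : ∀ r ∈ quantityGrid T, (q t - r) * (n * w t)
      ≤ (∑ s ∈ Finset.Icc 1 n, min (q t) (demand (x s)) * price (x s))
        - ∑ s ∈ Finset.Icc 1 n, min r (demand (x s)) * price (x s) := by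
    intro r hr
    have h1 := hmax r hr
    rw [hnt] at h1
    set A := ∑ s ∈ Finset.Icc 1 n, min r (demand (x s)) * price (x s)
    set B := ∑ s ∈ Finset.Icc 1 n, min (q t) (demand (x s)) * price (x s)
    have h2 : (n : ℝ) * (1 / (n : ℝ) * A - r * w t) ≤ n * (1 / (n : ℝ) * B - q t * w t) := by gcongr
    have h3 : ∀ z : ℝ, (n : ℝ) * (1 / (n : ℝ) * z) = z := fun z => by field_simp
    rw [mul_sub, mul_sub, h3, h3] at h2
    linarith
  refine ⟨k, Finset.mem_Icc.2 hk, hqk, fun hk2 => ?_, ?_⟩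
  · have h1 := hopt (((k - 1 : ℕ) : ℝ) / H) ⟨k - 1, Finset.mem_Icc.2 (by omega), rfl⟩
    have h2 := hgrad (((k - 1 : ℕ) : ℝ) / H) (q t)
    have h3 : q t - ((k - 1 : ℕ) : ℝ) / H = 1 / H := by
      rw [hqk]; push_cast [show 1 ≤ k by omega]; ring
    rw [h3] at h1 h2
    exact le_of_mul_le_mul_left (h1.trans h2) (by positivity)
  · rcases hk.2.eq_or_lt with hkN | hkN
    · have h0 : ((k + 1 : ℕ) : ℝ) / H = 1 := by
        rw [div_eq_one_iff_eq hH0.ne', hH, hkN]; push_cast; ring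
      have h1 : saleSum x n 1 = 0 := Finset.sum_eq_zero fun s hs => by
        simp [marginalSale, (h.demand_mem s (hsub s hs)).2]
      rw [h0, h1]
      positivity
    · have h1 := hopt (((k + 1 : ℕ) : ℝ) / H) ⟨k + 1, Finset.mem_Icc.2 (by omega), rfl⟩
      have h2 := hgrad (((k + 1 : ℕ) : ℝ) / H) (q t)
      have h3 : q t - ((k + 1 : ℕ) : ℝ) / H = -(1 / H) := by
        rw [hqk]; push_cast; ring
      rw [h3, neg_mul] at h1 h2
      exact le_of_mul_le_mul_left (by linarith : 1 / H * _ ≤ 1 / H * _) (by positivity)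

/-- The wholesale price of round `N² + s` in the last sweep. -/
lemma last_sweep (h : IsRealization T x w q) {s : ℕ} (hs : s ∈ Finset.Icc 1 (gridSize T)) :
    w (gridSize T ^ 2 + s) = (s : ℝ) / ((gridSize T : ℝ) + 1) := by
  have := h.sweep (gridSize T + 1) (Finset.mem_Icc.2 ⟨by omega, le_rfl⟩) s hs
  rwa [Nat.add_sub_cancel, ← sq] at this

lemma explore_mem (h : IsRealization T x w q) {t : ℕ}
    (ht : t ∈ Finset.Icc 1 (gridSize T ^ 2 + gridSize T)) : w t ∈ Set.Icc (0 : ℝ) 1 := by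
  rw [Finset.mem_Icc] at ht
  set N := gridSize T with hN
  have hN0 : 0 < N := by
    rcases Nat.eq_zero_or_pos N with h0 | h0
    · simp [h0] at ht; omega
    · exact h0
  have h1 := Nat.div_add_mod (t - 1) N
  have h2 := Nat.mod_lt (t - 1) hN0
  have h3 : (t - 1) / N < N + 1 := by
    rw [Nat.div_lt_iff_lt_mul hN0]; nlinarith [ht.1, ht.2, Nat.sub_lt ht.1 one_pos]
  generalize (t - 1) / N = a at h1 h3
  generalize (t - 1) % N = b at h1 h2
  have h4 := h.sweep (a + 1) (Finset.mem_Icc.2 ⟨by omega, by omega⟩) (b + 1)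
    (Finset.mem_Icc.2 ⟨by omega, by omega⟩)
  rw [Nat.add_sub_cancel, show a * N + (b + 1) = t by
    rw [mul_comm]; omega] at h4
  rw [h4]
  constructor
  · positivity
  · rw [div_le_one (by positivity)]
    have : ((b + 1 : ℕ) : ℝ) ≤ N := by exact_mod_cast (show b + 1 ≤ N by omega)
    linarith

/-- Over the last sweep the quantities decrease: the price moves by `1 / (N + 1)` from round to
round, while one new observation moves the empirical marginal revenue by at most `1 / N²`. -/
lemma last_sweep_antitone (hT : 12 ≤ T) (h : IsRealization T x w q) {s s' : ℕ}
    (hs : s ∈ Finset.Icc 1 (gridSize T)) (hs' : s' ∈ Finset.Icc 1 (gridSize T)) (hss : s < s') :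
    q (gridSize T ^ 2 + s') ≤ q (gridSize T ^ 2 + s) := by
  have hN3 := three_le_gridSize hT
  have hexp := explore_le hT
  have hw := h.last_sweep hs
  have hw' := h.last_sweep hs'
  rw [Finset.mem_Icc] at hs hs'
  set N := gridSize T with hN
  by_contra hlt
  rw [not_le] at hlt
  have hN9 : 9 ≤ N ^ 2 := by nlinarith
  obtain ⟨hg, hmax⟩ := h.leader (N ^ 2 + s) (Finset.mem_Icc.2 (by omega))
  obtain ⟨hg', hmax'⟩ := h.leader (N ^ 2 + s') (Finset.mem_Icc.2 (by omega))
  have h1 := hmax _ hg'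
  have h2 := hmax' _ hg
  set r := q (N ^ 2 + s) with hr
  set r' := q (N ^ 2 + s') with hr'
  set n : ℕ := N ^ 2 + s - 1 with hn
  set n' : ℕ := N ^ 2 + s' - 1 with hn'
  have en : ((N ^ 2 + s : ℕ) : ℝ) - 1 = n := by
    rw [hn, Nat.cast_sub (by omega)]; simp
  have en' : ((N ^ 2 + s' : ℕ) : ℝ) - 1 = n' := by
    rw [hn', Nat.cast_sub (by omega)]; simp
  rw [en, hw] at h1
  rw [en', hw'] at h2
  have hn0 : (0 : ℝ) < n := by exact_mod_cast (show 0 < n by omega)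
  have hn0' : (0 : ℝ) < n' := by exact_mod_cast (show 0 < n' by omega)
  have hcancel : ∀ m : ℕ, (0 : ℝ) < m → ∀ A B a b : ℝ,
      1 / (m : ℝ) * A - a ≤ 1 / (m : ℝ) * B - b → m * (b - a) ≤ B - A := by
    intro m hm A B a b hab
    have h4 : (m : ℝ) * (1 / (m : ℝ) * A - a) ≤ m * (1 / (m : ℝ) * B - b) := by gcongr
    have h5 : ∀ z : ℝ, (m : ℝ) * (1 / (m : ℝ) * z) = z := fun z => by field_simp
    rw [mul_sub, mul_sub, h5, h5] at h4
    linarith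
  have h3 := hcancel n hn0 _ _ _ _ h1
  have h4 := hcancel n' hn0' _ _ _ _ h2
  rw [← Finset.sum_sub_distrib] at h3 h4
  have hsplit : Finset.Icc 1 n' = Finset.Icc 1 n ∪ Finset.Icc (n + 1) n' := by
    ext i; simp only [Finset.mem_union, Finset.mem_Icc]; omega
  have hdisj : Disjoint (Finset.Icc 1 n) (Finset.Icc (n + 1) n') := by
    rw [Finset.disjoint_left]; intro i hi hi'; rw [Finset.mem_Icc] at hi hi'; omega
  rw [hsplit, Finset.sum_union hdisj] at h4
  have h5 : ∑ i ∈ Finset.Icc (n + 1) n', (min r' (demand (x i)) * price (x i)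
      - min r (demand (x i)) * price (x i)) ≤ ∑ i ∈ Finset.Icc (n + 1) n', (r' - r) := by
    refine Finset.sum_le_sum fun i hi => ?_
    rw [Finset.mem_Icc] at hi
    have hp := h.price_mem i (Finset.mem_Icc.2 (by omega))
    have h6 := revenue_sub_le hp.1 r r'
    have h7 := (marginalSale_mem_Icc hp r)
    nlinarith [h7.1, h7.2]
  rw [Finset.sum_const, Nat.card_Icc, nsmul_eq_mul] at h5
  have hj : ((n' + 1 - (n + 1) : ℕ) : ℝ) = (s' : ℝ) - s := by
    rw [← Nat.cast_sub hss.le]; congr 1; omega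
  have hnn : (n' : ℝ) = n + ((s' : ℝ) - s) := by rw [← en, ← en']; push_cast; ring
  rw [hj] at h5
  rw [Finset.sum_sub_distrib] at h3
  rw [Finset.sum_sub_distrib] at h4
  have hss' : (0 : ℝ) < (s' : ℝ) - s := by rw [sub_pos]; exact_mod_cast hss
  have hNn : (N : ℝ) + 1 ≤ n' := by
    have : N + 1 ≤ n' := by nlinarith [show n' + 1 = N ^ 2 + s' by omega]
    exact_mod_cast this
  have hs0 : (1 : ℝ) ≤ s := by exact_mod_cast hs.1
  have hN0 : (0 : ℝ) < (N : ℝ) + 1 := by positivity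
  set S1 := ∑ s ∈ Finset.Icc 1 n, min r' (demand (x s)) * price (x s)
  set S2 := ∑ s ∈ Finset.Icc 1 n, min r (demand (x s)) * price (x s)
  have h6 : (n' : ℝ) * ((r' - r) * ((s' : ℝ) / (N + 1)))
      ≤ (n : ℝ) * ((r' - r) * ((s : ℝ) / (N + 1))) + ((s' : ℝ) - s) * (r' - r) := by linarith
  have hrr : 0 < r' - r := sub_pos.2 hlt
  have h7 : (n' : ℝ) * ((s' : ℝ) / (N + 1)) ≤ (n : ℝ) * ((s : ℝ) / (N + 1)) + ((s' : ℝ) - s) := by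
    have : (r' - r) * ((n' : ℝ) * ((s' : ℝ) / (N + 1)))
        ≤ (r' - r) * ((n : ℝ) * ((s : ℝ) / (N + 1)) + ((s' : ℝ) - s)) := by linarith
    exact le_of_mul_le_mul_left this hrr
  have h8 : (n' : ℝ) * s' ≤ (n : ℝ) * s + ((s' : ℝ) - s) * (N + 1) := by
    have := mul_le_mul_of_nonneg_right h7 hN0.le
    have e1 : (n' : ℝ) * ((s' : ℝ) / (N + 1)) * (N + 1) = n' * s' := by field_simp
    have e2 : ((n : ℝ) * ((s : ℝ) / (N + 1)) + ((s' : ℝ) - s)) * (N + 1)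
        = n * s + (s' - s) * (N + 1) := by field_simp
    rwa [e1, e2] at this
  nlinarith

end IsRealization

end Realization

/-! ### The supplier's loss along a realization -/

section Realization

variable {T : ℕ} {x : ℕ → Outcome} {w q : ℕ → ℝ}

/-- Two quantities that the leader buys at the same price differ by at most two grid steps plus the
deviations of the empirical marginal revenue, divided by the slope of the marginal revenue. -/
lemma IsRealization.quantity_sub_le (h : IsRealization T x w q) {t t' : ℕ}
    (ht : t ∈ Finset.Icc 2 T) (ht' : t' ∈ Finset.Icc 2 T) (hw : 0 ≤ w t) (hww : w t' = w t)
    {g : ℝ → ℝ} {a α β : ℝ} (ha : 0 < a)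
    (hg : ∀ r r' : ℝ, 0 ≤ r → r ≤ r' → r' ≤ 1 → a * (r' - r) ≤ g r - g r')
    (hα : 0 ≤ α) (hβ : 0 ≤ β)
    (hup : ∀ k : ℕ, 1 ≤ k → k < gridSize T →
      saleSum x (t - 1) ((k : ℝ) / ((gridSize T : ℝ) + 1))
        ≤ ((t - 1 : ℕ) : ℝ) * (g ((k : ℝ) / ((gridSize T : ℝ) + 1)) + α))
    (hlow : ∀ k : ℕ, k ≤ gridSize T + 1 →
      ((t' - 1 : ℕ) : ℝ) * (g ((k : ℝ) / ((gridSize T : ℝ) + 1)) - β)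
        ≤ saleSum x (t' - 1) ((k : ℝ) / ((gridSize T : ℝ) + 1))) :
    q t - q t' ≤ 2 / ((gridSize T : ℝ) + 1) + (α + β) / a := by
  obtain ⟨k, hk, hqk, hk1, -⟩ := h.leader_bracket ht hw
  obtain ⟨l, hl, hql, -, hl1⟩ := h.leader_bracket ht' (hww ▸ hw)
  rw [Finset.mem_Icc] at ht ht' hk hl
  have hn : (0 : ℝ) < ((t - 1 : ℕ) : ℝ) := by exact_mod_cast (show 0 < t - 1 by omega)
  have hn' : (0 : ℝ) < ((t' - 1 : ℕ) : ℝ) := by exact_mod_cast (show 0 < t' - 1 by omega)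
  set H : ℝ := (gridSize T : ℝ) + 1 with hH
  have hH0 : 0 < H := by positivity
  have hB : 0 ≤ (α + β) / a := by positivity
  rcases Nat.lt_or_ge k (l + 3) with hkl | hkl
  · have h1 : (k : ℝ) ≤ l + 2 := by exact_mod_cast (show k ≤ l + 2 by omega)
    have h2 : (k : ℝ) / H ≤ ((l : ℝ) + 2) / H := by gcongr
    rw [add_div] at h2
    rw [hqk, hql]
    linarith
  · have h1 := (hk1 (by omega)).trans (hup (k - 1) (by omega) (by omega))
    have h2 := (hlow (l + 1) (by omega)).trans hl1
    have h3 := le_of_mul_le_mul_left h1 hn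
    have h4 := le_of_mul_le_mul_left h2 hn'
    have h5 := hg (((l + 1 : ℕ) : ℝ) / H) (((k - 1 : ℕ) : ℝ) / H) (by positivity)
      (by gcongr; omega) (by
        rw [div_le_one hH0]
        have : ((k - 1 : ℕ) : ℝ) ≤ gridSize T := by
          exact_mod_cast (show k - 1 ≤ gridSize T by omega)
        linarith)
    have h6 : ((k - 1 : ℕ) : ℝ) / H - ((l + 1 : ℕ) : ℝ) / H ≤ (α + β) / a := by
      rw [le_div_iff₀ ha]; linarith
    have h7 : ((k - 1 : ℕ) : ℝ) = k - 1 := by push_cast [show 1 ≤ k by omega]; ring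
    rw [h7] at h6
    push_cast at h6
    rw [hqk, hql]
    have e : (k : ℝ) / H - l / H = ((k : ℝ) - 1) / H - ((l : ℝ) + 1) / H + 2 / H := by ring
    linarith

/-- A price of the sweep just below the equilibrium price is almost as good for the supplier as the
equilibrium, as soon as the empirical marginal revenue is not underestimated by more than `ε` at
one grid point, just below the equilibrium quantity. Neither choice depends on the realization. -/
lemma exists_good_price {g : ℝ → ℝ} {qs c ε : ℝ} (T : ℕ) (hN : 1 ≤ gridSize T)
    (hg : Antitone g) (hqs : qs ∈ Set.Ioo (0 : ℝ) 1) (hc : 0 ≤ c) (hcw : c < g qs)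
    (hw1 : g qs ≤ 1) (hε : 0 ≤ ε) :
    ∃ s ∈ Finset.Icc 1 (gridSize T), ∃ k ≤ gridSize T, ∀ (x : ℕ → Outcome) (w q : ℕ → ℝ),
      12 ≤ T → IsRealization T x w q →
      ((gridSize T ^ 2 + s - 1 : ℕ) : ℝ) * (g ((k : ℝ) / ((gridSize T : ℝ) + 1)) - ε)
        ≤ saleSum x (gridSize T ^ 2 + s - 1) ((k : ℝ) / ((gridSize T : ℝ) + 1)) →
      qs * (g qs - c) - q (gridSize T ^ 2 + s) * (w (gridSize T ^ 2 + s) - c)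
        ≤ ε + 2 / ((gridSize T : ℝ) + 1) := by
  set H : ℝ := (gridSize T : ℝ) + 1 with hH
  have hH0 : 0 < H := by positivity
  have hN1 : (1 : ℝ) ≤ gridSize T := by exact_mod_cast hN
  by_cases hcase : 1 / H < g qs - ε
  swap
  · refine ⟨1, Finset.mem_Icc.2 ⟨le_rfl, hN⟩, 0, Nat.zero_le _, fun x w q hT h _ => ?_⟩
    have hexp := explore_le hT
    have hmem : gridSize T ^ 2 + 1 ∈ Finset.Icc 1 T := Finset.mem_Icc.2 (by omega)
    have hq0 := (h.quantity_pos hmem).le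
    have hq1 := h.quantity_le_one hmem
    rw [h.last_sweep (Finset.mem_Icc.2 ⟨le_rfl, hN⟩)]
    push_cast
    rw [← hH]
    rw [not_lt] at hcase
    have h1 : qs * (g qs - c) ≤ g qs - c := by nlinarith [hqs.2]
    have h2 : 2 / H = 1 / H + 1 / H := by ring
    have h3 : 0 < 1 / H := by positivity
    rcases le_total c (1 / H) with h4 | h4
    · nlinarith [mul_nonneg hq0 (sub_nonneg.2 h4)]
    · nlinarith [mul_le_of_le_one_left (sub_nonneg.2 h4) hq1]
  · have hzpos : 0 < g qs - ε := lt_trans (by positivity) hcase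
    set m := ⌈(g qs - ε) * H⌉₊ with hm
    have hm1 : (g qs - ε) * H ≤ m := Nat.le_ceil _
    have hm2 : (m : ℝ) < (g qs - ε) * H + 1 := Nat.ceil_lt_add_one (by positivity)
    have hm3 : 2 ≤ m := by
      have : (1 : ℝ) < m := by
        rw [div_lt_iff₀ hH0] at hcase; linarith
      exact_mod_cast this
    have hm4 : m ≤ gridSize T + 1 := by
      have : (m : ℝ) < (gridSize T + 2 : ℕ) := by push_cast; nlinarith
      have : m < gridSize T + 2 := by exact_mod_cast this
      omega
    set m' := ⌈qs * H⌉₊ with hm'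
    have hm1' : qs * H ≤ m' := Nat.le_ceil _
    have hm2' : (m' : ℝ) < qs * H + 1 := Nat.ceil_lt_add_one (mul_pos hqs.1 hH0).le
    have hm3' : 1 ≤ m' := by
      have : (0 : ℝ) < m' := (mul_pos hqs.1 hH0).trans_le hm1'
      exact_mod_cast this
    have hm4' : m' ≤ gridSize T + 1 := by
      have : (m' : ℝ) < (gridSize T + 2 : ℕ) := by push_cast; nlinarith [hqs.2]
      have : m' < gridSize T + 2 := by exact_mod_cast this
      omega
    have hms : m - 1 ∈ Finset.Icc 1 (gridSize T) := Finset.mem_Icc.2 (by omega)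
    refine ⟨m - 1, hms, m' - 1, by omega, fun x w q hT h hdev => ?_⟩
    have hexp := explore_le hT
    have hN3 := three_le_gridSize hT
    have hN9 : 9 ≤ gridSize T ^ 2 := by nlinarith
    have hmem : gridSize T ^ 2 + (m - 1) ∈ Finset.Icc 1 T := Finset.mem_Icc.2 (by omega)
    have hmem2 : gridSize T ^ 2 + (m - 1) ∈ Finset.Icc 2 T := Finset.mem_Icc.2 (by omega)
    have hws := h.last_sweep hms
    obtain ⟨l, hl, hql, -, hl1⟩ := h.leader_bracket hmem2 (by rw [hws]; positivity)
    have hq0 := (h.quantity_pos hmem).le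
    have hq1 := h.quantity_le_one hmem
    have hcast : ((m - 1 : ℕ) : ℝ) = m - 1 := by push_cast [show 1 ≤ m by omega]; ring
    have hcast' : ((m' - 1 : ℕ) : ℝ) = m' - 1 := by push_cast [hm3']; ring
    have hn0 : (0 : ℝ) < ((gridSize T ^ 2 + (m - 1) - 1 : ℕ) : ℝ) := by
      exact_mod_cast (show 0 < gridSize T ^ 2 + (m - 1) - 1 by omega)
    set p := w (gridSize T ^ 2 + (m - 1)) with hp
    have hp1 : p < g qs - ε := by
      rw [hws, hcast, div_lt_iff₀ hH0]; linarith
    have hp2 : g qs - ε - 1 / H ≤ p := by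
      rw [hws, hcast, le_div_iff₀ hH0]
      have : (g qs - ε - 1 / H) * H = (g qs - ε) * H - 1 := by field_simp
      linarith
    have hk1 : ((m' - 1 : ℕ) : ℝ) / H ≤ qs := by rw [hcast', div_le_iff₀ hH0]; linarith
    have hk2 : qs - 1 / H ≤ ((m' - 1 : ℕ) : ℝ) / H := by
      rw [hcast', le_div_iff₀ hH0]
      have : (qs - 1 / H) * H = qs * H - 1 := by field_simp
      linarith
    have hkl : m' - 1 ≤ l := by
      by_contra hlt
      have h1 : ((l + 1 : ℕ) : ℝ) / H ≤ ((m' - 1 : ℕ) : ℝ) / H := by gcongr; omega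
      have h2 := h.saleSum_antitone (n := gridSize T ^ 2 + (m - 1) - 1) (by omega) h1
      have h3 := le_of_mul_le_mul_left (hdev.trans (h2.trans hl1)) hn0
      have h4 := hg hk1
      linarith
    have hq2 : qs - 1 / H ≤ q (gridSize T ^ 2 + (m - 1)) := by
      rw [hql]
      refine hk2.trans ?_
      gcongr
    have e2 : 2 / H = 1 / H + 1 / H := by ring
    have hHpos : 0 < 1 / H := by positivity
    set Q := q (gridSize T ^ 2 + (m - 1))
    rcases le_total c p with h4 | h4
    · have h5 : (qs - 1 / H) * (p - c) ≤ Q * (p - c) :=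
        mul_le_mul_of_nonneg_right hq2 (sub_nonneg.2 h4)
      have h6 : 1 / H * (p - c) ≤ 1 / H := mul_le_of_le_one_right hHpos.le (by linarith)
      have h7 : qs * (g qs - p) ≤ g qs - p :=
        mul_le_of_le_one_left (by linarith) hqs.2.le
      linarith
    · have h5 : Q * (c - p) ≤ c - p := mul_le_of_le_one_left (sub_nonneg.2 h4) hq1
      have h6 : qs * (g qs - c) ≤ g qs - c := mul_le_of_le_one_left (by linarith) hqs.2.le
      linarith

namespace IsCommitment

variable {c ec : ℝ} {S : ℕ}

/-- The committed price is nearly optimal within the last sweep for the true mean cost `ec`. -/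
lemma value_le (hT : 12 ≤ T) (h : IsRealization T x w q) (hS : IsCommitment T w q c S) {s : ℕ}
    (hs : s ∈ Finset.Icc 1 (gridSize T)) :
    q (gridSize T ^ 2 + s) * (w (gridSize T ^ 2 + s) - ec) ≤ q S * (w S - ec) + |c - ec| := by
  have hexp := explore_le hT
  have hS' := Finset.mem_Icc.1 hS.mem
  rw [Finset.mem_Icc] at hs
  have hmax := hS.isMax (gridSize T ^ 2 + s) (Finset.mem_Icc.2 (by omega))
  have hm1 : gridSize T ^ 2 + s ∈ Finset.Icc 1 T := Finset.mem_Icc.2 (by omega)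
  have hm2 : S ∈ Finset.Icc 1 T := Finset.mem_Icc.2 (by omega)
  have h1 : |(q (gridSize T ^ 2 + s) - q S) * (c - ec)| ≤ 1 * |c - ec| := by
    rw [abs_mul]
    gcongr
    rw [abs_le]
    constructor <;> linarith [h.quantity_pos hm1, h.quantity_pos hm2, h.quantity_le_one hm1,
      h.quantity_le_one hm2]
  have h2 := le_abs_self ((q (gridSize T ^ 2 + s) - q S) * (c - ec))
  nlinarith

lemma wholesale_mem (h : IsRealization T x w q) (hS : IsCommitment T w q c S) :
    w S ∈ Set.Icc (0 : ℝ) 1 := by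
  have hS' := Finset.mem_Icc.1 hS.mem
  exact h.explore_mem (Finset.mem_Icc.2 (by omega))

/-- The committed price is hardly below the mean cost: if the highest price of the grid exceeds the
estimated cost, then it yields a positive estimated utility; otherwise all prices of the grid yield
a loss, and the highest price yields the smallest one because it also sells the least. -/
lemma cost_sub_le (hT : 12 ≤ T) (h : IsRealization T x w q) (hS : IsCommitment T w q c S)
    (hec : ec ≤ 1) : ec - w S ≤ |c - ec| + 1 / ((gridSize T : ℝ) + 1) := by
  have hexp := explore_le hT
  have hN3 := three_le_gridSize hT
  have hS' := Finset.mem_Icc.1 hS.mem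
  have hNm : gridSize T ∈ Finset.Icc 1 (gridSize T) := Finset.mem_Icc.2 (by omega)
  have hmax := hS.isMax (gridSize T ^ 2 + gridSize T) (Finset.mem_Icc.2 (by omega))
  have hwN := h.last_sweep hNm
  have hm1 : gridSize T ^ 2 + gridSize T ∈ Finset.Icc 1 T := Finset.mem_Icc.2 (by omega)
  have hm2 : S ∈ Finset.Icc 1 T := Finset.mem_Icc.2 (by omega)
  have hH0 : (0 : ℝ) < (gridSize T : ℝ) + 1 := by positivity
  have hqN := h.quantity_pos hm1
  have hqS := h.quantity_pos hm2
  have habs := neg_abs_le (c - ec)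
  have hpos : 0 < 1 / ((gridSize T : ℝ) + 1) := by positivity
  rcases lt_or_ge c (w (gridSize T ^ 2 + gridSize T)) with hlt | hge
  · have h1 : 0 < q S * (w S - c) := (mul_pos hqN (sub_pos.2 hlt)).trans_le hmax
    have h2 : 0 < w S - c := by
      by_contra hneg
      exact absurd h1 (not_lt.2 (mul_nonpos_of_nonneg_of_nonpos hqS.le (not_lt.1 hneg)))
    linarith
  · have hSN : S = gridSize T ^ 2 + gridSize T := by
      by_contra hne
      obtain ⟨s, rfl⟩ : ∃ s, S = gridSize T ^ 2 + s := ⟨S - gridSize T ^ 2, by omega⟩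
      have hs : s ∈ Finset.Icc 1 (gridSize T) := Finset.mem_Icc.2 (by omega)
      have hanti := h.last_sweep_antitone hT hs hNm (by omega)
      have hws := h.last_sweep hs
      have hlt : w (gridSize T ^ 2 + s) < w (gridSize T ^ 2 + gridSize T) := by
        rw [hws, hwN]
        gcongr
        omega
      nlinarith
    rw [hSN, hwN]
    have : (gridSize T : ℝ) / ((gridSize T : ℝ) + 1) = 1 - 1 / ((gridSize T : ℝ) + 1) := by
      field_simp; ring
    rw [this]
    linarith [abs_nonneg (c - ec)]

/-- The loss of the supplier in a round after the commitment. -/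
lemma loss_le (hT : 12 ≤ T) (h : IsRealization T x w q) (hS : IsCommitment T w q c S)
    (hec0 : 0 ≤ ec) (hec : ec ≤ 1) {u ε B : ℝ} {s t : ℕ} (hs : s ∈ Finset.Icc 1 (gridSize T))
    (ht : t ∈ Finset.Icc (gridSize T ^ 2 + gridSize T + 1) T)
    (hu : u - q (gridSize T ^ 2 + s) * (w (gridSize T ^ 2 + s) - ec)
      ≤ ε + 2 / ((gridSize T : ℝ) + 1))
    (hB : 0 ≤ B) (hq : q S - q t ≤ 2 / ((gridSize T : ℝ) + 1) + B) :
    u - q t * (w t - ec)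
      ≤ ε + 5 / ((gridSize T : ℝ) + 1) + 2 * |c - ec| + (1 - ec) * B := by
  have h1 := hS.value_le (ec := ec) hT h hs
  have h2 := hS.cost_sub_le hT h hec
  have hexp := explore_le hT
  have hS' := Finset.mem_Icc.1 hS.mem
  have hwS := hS.wholesale_mem h
  rw [hS.commit t ht]
  rw [Finset.mem_Icc] at ht
  have hm1 : t ∈ Finset.Icc 1 T := Finset.mem_Icc.2 (by omega)
  have hm2 : S ∈ Finset.Icc 1 T := Finset.mem_Icc.2 (by omega)
  have hqt := h.quantity_le_one hm1
  have hqS := h.quantity_pos hm2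
  set H : ℝ := (gridSize T : ℝ) + 1 with hH
  have hHpos : 0 < 1 / H := by positivity
  have e2 : 2 / H = 2 * (1 / H) := by ring
  have e5 : 5 / H = 5 * (1 / H) := by ring
  rw [e2] at hu hq
  rw [e5]
  have hBc : 0 ≤ (1 - ec) * B := mul_nonneg (by linarith) hB
  have hdev := abs_nonneg (c - ec)
  rcases le_total ec (w S) with h4 | h4
  · have h5 : (q S - q t) * (w S - ec) ≤ (2 * (1 / H) + B) * (w S - ec) :=
      mul_le_mul_of_nonneg_right hq (sub_nonneg.2 h4)
    have h6 : (2 * (1 / H) + B) * (w S - ec) ≤ (2 * (1 / H) + B) * (1 - ec) :=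
      mul_le_mul_of_nonneg_left (by linarith [hwS.2]) (by positivity)
    have h7 : 2 * (1 / H) * (1 - ec) ≤ 2 * (1 / H) :=
      mul_le_of_le_one_right (by positivity) (by linarith)
    linarith
  · have h5 : (q t - q S) * (ec - w S) ≤ ec - w S :=
      mul_le_of_le_one_left (sub_nonneg.2 h4) (by linarith)
    linarith

end IsCommitment

end Realization

/-! ### The regret of the supplier -/

section

/-- The final numerical estimate, with `x = T^{1/3}`, `l = √(ln T)` and `A = (1 - E[C]) / (E[P] L)`.
The coefficient of `A` on the left exceeds `1` only as long as `√x ≤ 6 (5/3 + l/√2)`, hence for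
moderate `x`, where the excess is absorbed by the slack in the other terms. -/
lemma regret_numeric {x l A : ℝ} (hl : 0 ≤ l) (hA : 0 ≤ A) (hx : x = Real.exp (l ^ 2 / 3))
    (hbig : 16 + A + 7 * l < x) :
    1 + 3 / x + 2 / x ^ 2 + 8 + l / 2 + A * (5 / 6 + (l / √2 + 5 / 3) / √x) ≤ 16 + A + 7 * l := by
  have hx16 : 16 < x := by linarith
  have h1 : 3 / x + 2 / x ^ 2 ≤ 0.2 := by
    have h2 : 3 / x ≤ 3 / 16 := by gcongr
    have h3 : 2 / x ^ 2 ≤ 2 / 16 ^ 2 := by gcongr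
    linarith
  set r := √x with hr
  have hr2 : r ^ 2 = x := Real.sq_sqrt (by linarith)
  have hr0 : 0 < r := Real.sqrt_pos.2 (by linarith)
  have hrexp : r = Real.exp (l ^ 2 / 6) := by
    rw [hr, hx, Real.sqrt_eq_iff_mul_self_eq (Real.exp_pos _).le (Real.exp_pos _).le,
      ← Real.exp_add]
    congr 1; ring
  set b := l / √2 + 5 / 3 with hb
  have hs2 : 1 / √2 ≤ 0.7072 := by
    rw [div_le_iff₀ (by positivity)]
    have : (1.4141 : ℝ) ≤ √2 := Real.le_sqrt_of_sq_le (by norm_num)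
    linarith
  have hb1 : b ≤ 0.7072 * l + 5 / 3 := by
    have : l / √2 = l * (1 / √2) := by ring
    rw [hb, this]
    nlinarith
  have hb0 : 0 ≤ b := by positivity
  have key : A * (b / r - 1 / 6) ≤ 6.8 + 6.5 * l := by
    rcases le_or_gt (b / r) (1 / 6) with hc | hc
    · nlinarith
    · have hAx : A * (b / r - 1 / 6) ≤ r ^ 2 * (b / r - 1 / 6) := by
        refine mul_le_mul_of_nonneg_right ?_ (by linarith)
        linarith
      have e : r ^ 2 * (b / r - 1 / 6) = r * b - r ^ 2 / 6 := by field_simp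
      have hamgm : r * b - r ^ 2 / 6 ≤ 3 / 2 * b ^ 2 := by nlinarith [sq_nonneg (r - 3 * b)]
      have hl455 : l ≤ 4.55 := by
        by_contra hlt
        rw [not_le] at hlt
        have h6 : r < 6 * b := by
          rw [lt_div_iff₀ hr0] at hc; linarith
        have he1 : (20 : ℝ) ≤ Real.exp 3 := by
          have : Real.exp 3 = Real.exp 1 ^ 3 := by rw [← Real.exp_nat_mul]; norm_num
          rw [this]
          have := Real.exp_one_gt_d9
          calc (20 : ℝ) ≤ 2.718 ^ 3 := by norm_num
            _ ≤ _ := by gcongr; linarith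
        have he2 : (1.55 : ℝ) ≤ Real.exp 0.45 := by
          have := Real.quadratic_le_exp_of_nonneg (show (0 : ℝ) ≤ 0.45 by norm_num)
          linarith
        have he3 : (31 : ℝ) ≤ Real.exp 3.45 := by
          rw [show (3.45 : ℝ) = 3 + 0.45 by norm_num, Real.exp_add]
          nlinarith
        have he4 : 31 * (1 + (l ^ 2 / 6 - 3.45)) ≤ r := by
          rw [hrexp, show l ^ 2 / 6 = 3.45 + (l ^ 2 / 6 - 3.45) by ring, Real.exp_add]
          have h7 := Real.add_one_le_exp (l ^ 2 / 6 - 3.45)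
          have h8 : 0 ≤ l ^ 2 / 6 - 3.45 := by nlinarith
          have := mul_le_mul he3 h7 (by linarith) (by positivity)
          linarith
        nlinarith
      have hb2 : b ^ 2 ≤ (0.7072 * l + 5 / 3) ^ 2 := by gcongr
      nlinarith
  have e : A * (5 / 6 + b / r) = A + A * (b / r - 1 / 6) := by ring
  rw [e]
  linarith

lemma sum_inv_sqrt_le (n : ℕ) : ∑ k ∈ Finset.Icc 1 n, 1 / √(k : ℝ) ≤ 2 * √(n : ℝ) := by
  induction n with
  | zero => simp
  | succ n ih =>
    rw [Finset.sum_Icc_succ_top (by omega)]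
    have h1 : 0 < √((n + 1 : ℕ) : ℝ) := Real.sqrt_pos.2 (by positivity)
    have h2 : √((n + 1 : ℕ) : ℝ) ^ 2 = n + 1 := by
      rw [Real.sq_sqrt (by positivity)]; push_cast; ring
    have h3 : √(n : ℝ) ^ 2 = n := Real.sq_sqrt (by positivity)
    have h4 := Real.sqrt_nonneg (n : ℝ)
    have h5 : 1 / √((n + 1 : ℕ) : ℝ) ≤ 2 * √((n + 1 : ℕ) : ℝ) - 2 * √(n : ℝ) := by
      rw [div_le_iff₀ h1]
      nlinarith [sq_nonneg (√((n + 1 : ℕ) : ℝ) - √(n : ℝ))]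
    linarith

/-- The grid `{0, 1/(N+1), …, 1}`. -/
noncomputable def gridPoints (N : ℕ) : Finset ℝ :=
  (Finset.range (N + 2)).image fun k : ℕ => (k : ℝ) / ((N : ℝ) + 1)

lemma gridPoints_nonempty (N : ℕ) : (gridPoints N).Nonempty := by simp [gridPoints]

lemma mem_gridPoints {N k : ℕ} (hk : k ≤ N + 1) : (k : ℝ) / ((N : ℝ) + 1) ∈ gridPoints N :=
  Finset.mem_image.2 ⟨k, Finset.mem_range.2 (by omega), rfl⟩

lemma gridPoints_mem_Icc {N : ℕ} : ∀ r ∈ gridPoints N, r ∈ Set.Icc (0 : ℝ) 1 := by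
  intro r hr
  obtain ⟨k, hk, rfl⟩ := Finset.mem_image.1 hr
  rw [Finset.mem_range] at hk
  refine ⟨by positivity, ?_⟩
  rw [div_le_one (by positivity)]
  exact_mod_cast (show k ≤ N + 1 by omega)

variable {Ω : Type*} [MeasurableSpace Ω] {μ : Measure Ω} [IsProbabilityMeasure μ]
variable {𝒟 : Measure Outcome} [IsProbabilityMeasure 𝒟] {L : ℝ} {T : ℕ} {X : ℕ → Ω → Outcome}
  {W Q : ℕ → Ω → ℝ}

lemma IsPlay.realization (h : IsPlay 𝒟 μ T X W Q) (hD : LearningAssumption 𝒟 L) :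
    ∀ᵐ ω ∂μ, IsRealization T (fun t => X t ω) (fun t => W t ω) fun t => Q t ω := by
  filter_upwards [h.protocol.iidDraws.ae_of_ae hD.support] with ω hω
  refine ⟨fun t ht => (hω t ht).1, fun t ht => (hω t ht).2.1, fun t ht => (hω t ht).2.2,
    fun t ht s hs => h.supplier.1 ω t (by rwa [blocks_eq]) s hs, h.retailer.1 ω, fun t ht => ?_⟩
  obtain ⟨h1, h2⟩ := h.retailer.2.2 ω t ht
  exact ⟨h1, fun r hr => h2 hr⟩

omit [IsProbabilityMeasure μ] [IsProbabilityMeasure 𝒟] in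
lemma IsPlay.commitment (h : IsPlay 𝒟 μ T X W Q) (ω : Ω) :
    ∃ S, IsCommitment T (fun t => W t ω) (fun t => Q t ω) (costEstimate T X ω) S := by
  obtain ⟨S, h1, h2, h3⟩ := h.supplier.2 ω
  have e : blocks T * gridSize T = gridSize T ^ 2 + gridSize T := by rw [blocks_eq]; ring
  rw [e] at h1 h2 h3
  exact ⟨S, h1, h2, h3⟩

/-- The wholesale price stays in `[0,1]`. -/
lemma IsRealization.wholesale_mem {x : ℕ → Outcome} {w q : ℕ → ℝ} {c : ℝ} {S : ℕ}
    (h : IsRealization T x w q) (hS : IsCommitment T w q c S) {t : ℕ} (ht : t ∈ Finset.Icc 1 T) :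
    w t ∈ Set.Icc (0 : ℝ) 1 := by
  rw [Finset.mem_Icc] at ht
  by_cases h1 : t ≤ gridSize T ^ 2 + gridSize T
  · exact h.explore_mem (Finset.mem_Icc.2 ⟨ht.1, h1⟩)
  · rw [hS.commit t (Finset.mem_Icc.2 ⟨by omega, ht.2⟩)]
    exact hS.wholesale_mem h

/-- The supplier's expected utility in a round: the cost of the round is independent of the
quantity. -/
lemma IsPlay.integral_sigma (h : IsPlay 𝒟 μ T X W Q) (hD : LearningAssumption 𝒟 L) {t : ℕ}
    (ht : t ∈ Finset.Icc 1 T) :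
    Integrable (fun ω => Q t ω * (W t ω - ∫ x, cost x ∂𝒟)) μ ∧
    ∫ ω, sigma (W t ω) (Q t ω) (cost (X t ω)) ∂μ
      = ∫ ω, Q t ω * (W t ω - ∫ x, cost x ∂𝒟) ∂μ := by
  have hiid := h.protocol.iidDraws
  have hQm := h.protocol.measurable_quantity ht
  have hWm := h.protocol.measurable_wholesale ht
  have hCm : Measurable fun ω => cost (X t ω) := measurable_cost.comp (hiid.measurable t ht)
  have hreal := h.realization hD
  have hQ : ∀ᵐ ω ∂μ, Q t ω ∈ Set.Icc (0 : ℝ) 1 := hreal.mono fun ω hω =>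
    ⟨(hω.quantity_pos ht).le, hω.quantity_le_one ht⟩
  have hW : ∀ᵐ ω ∂μ, W t ω ∈ Set.Icc (0 : ℝ) 1 := hreal.mono fun ω hω =>
    hω.wholesale_mem (h.commitment ω).choose_spec ht
  have hC : ∀ᵐ ω ∂μ, cost (X t ω) ∈ Set.Icc (0 : ℝ) 1 := hreal.mono fun ω hω => hω.cost_mem t ht
  have hmul : ∀ {f g : Ω → ℝ}, Measurable f → Measurable g → (∀ᵐ ω ∂μ, f ω ∈ Set.Icc (0 : ℝ) 1) →
      (∀ᵐ ω ∂μ, g ω ∈ Set.Icc (0 : ℝ) 1) → Integrable (fun ω => f ω * g ω) μ := by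
    intro f g hf hg hf1 hg1
    refine integrable_of_ae_mem_Icc (hf.mul hg) (a := 0) (b := 1) ?_
    filter_upwards [hf1, hg1] with ω h1 h2
    exact ⟨mul_nonneg h1.1 h2.1, mul_le_one₀ h1.2 h2.1 h2.2⟩
  have hQW := hmul hQm hWm hQ hW
  have hQC := hmul hQm hCm hQ hC
  have hQi : Integrable (Q t) μ := integrable_of_ae_mem_Icc hQm hQ
  have hind : IndepFun (Q t) (fun ω => cost (X t ω)) μ :=
    ((h.protocol.indepFun_quantity ht).comp measurable_cost measurable_id).symm
  have h1 := hind.integral_fun_mul_eq_mul_integral hQm.aestronglyMeasurable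
    hCm.aestronglyMeasurable
  rw [hiid.integral_comp ht measurable_cost] at h1
  have e : (fun ω => Q t ω * (W t ω - ∫ x, cost x ∂𝒟))
      = fun ω => Q t ω * W t ω - Q t ω * ∫ x, cost x ∂𝒟 := funext fun ω => by ring
  rw [e]
  refine ⟨hQW.sub (hQi.mul_const _), ?_⟩
  simp only [sigma]
  rw [integral_sub hQW hQC, integral_sub hQW (hQi.mul_const _), h1, integral_mul_const]

lemma IsPlay.loss_le_one (h : IsPlay 𝒟 μ T X W Q) (hD : LearningAssumption 𝒟 L) {qs : ℝ}
    (hqs : qs ∈ Set.Ioo (0 : ℝ) 1) (hpos : 0 < supplierValue 𝒟 qs) :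
    ∀ᵐ ω ∂μ, ∀ t ∈ Finset.Icc 1 T,
      supplierValue 𝒟 qs - Q t ω * (W t ω - ∫ x, cost x ∂𝒟) ≤ 1 := by
  filter_upwards [h.realization hD] with ω hω t ht
  have h1 := hω.wholesale_mem (h.commitment ω).choose_spec ht
  have h2 := hω.quantity_pos ht
  have h3 := hω.quantity_le_one ht
  have h4 := hD.mean_cost_mem
  have h5 := (hD.marginalRevenue_mem qs).2
  have h6 : 0 < marginalRevenue 𝒟 qs - ∫ x, cost x ∂𝒟 := by
    by_contra hneg
    exact absurd hpos (not_lt.2 (mul_nonpos_of_nonneg_of_nonpos hqs.1.le (not_lt.1 hneg)))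
  have h7 : supplierValue 𝒟 qs ≤ marginalRevenue 𝒟 qs - ∫ x, cost x ∂𝒟 :=
    mul_le_of_le_one_left h6.le hqs.2.le
  have h8 : Q t ω * (∫ x, cost x ∂𝒟) ≤ ∫ x, cost x ∂𝒟 := mul_le_of_le_one_left h4.1 h3
  have h9 : 0 ≤ Q t ω * W t ω := mul_nonneg h2.le h1.1
  nlinarith

end

/-! ### Exceptional events in the regret bound -/

section

variable {Ω : Type*} [MeasurableSpace Ω] {μ : Measure Ω} [IsProbabilityMeasure μ]
variable {𝒟 : Measure Outcome} [IsProbabilityMeasure 𝒟] {L : ℝ} {T : ℕ} {X : ℕ → Ω → Outcome}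
  {W Q : ℕ → Ω → ℝ}

/-- The event that during the last sweep the sales observed since its beginning exceed their
expectation by `y` at some grid point. -/
def sweepExcess (𝒟 : Measure Outcome) (X : ℕ → Ω → Outcome) (N : ℕ) (y : ℝ) : Set Ω :=
  ⋃ j ∈ Finset.Icc 1 (N - 1), ⋃ k ∈ Finset.Icc 1 (N - 1),
    {ω | y ≤ 1 * (∑ t ∈ Finset.Icc (N ^ 2 + 1) (N ^ 2 + j),
        marginalSale ((k : ℝ) / ((N : ℝ) + 1)) (X t ω)
      - (Finset.Icc (N ^ 2 + 1) (N ^ 2 + j)).card * marginalRevenue 𝒟 ((k : ℝ) / ((N : ℝ) + 1)))}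

/-- The event that the average sales of the rounds up to `n` fall short of their expectation by `ε`
at the point `r`. -/
def saleShortfall (𝒟 : Measure Outcome) (X : ℕ → Ω → Outcome) (n : ℕ) (r ε : ℝ) : Set Ω :=
  {ω | n * ε ≤ -1 * (∑ t ∈ Finset.Icc 1 n, marginalSale r (X t ω)
    - (Finset.Icc 1 n).card * marginalRevenue 𝒟 r)}

lemma IidDraws.measureReal_sweepExcess_le (h : IidDraws 𝒟 μ T X) (hD : LearningAssumption 𝒟 L)
    {N : ℕ} (hN : N ^ 2 + N ≤ T) {y : ℝ} (hy : 0 ≤ y) :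
    μ.real (sweepExcess 𝒟 X N y) ≤ ((N - 1 : ℕ) : ℝ) ^ 2 * Real.exp (-2 * y ^ 2 / N) := by
  have hj : ∀ j ∈ Finset.Icc 1 (N - 1), ∀ k ∈ Finset.Icc 1 (N - 1),
      μ.real {ω | y ≤ 1 * (∑ t ∈ Finset.Icc (N ^ 2 + 1) (N ^ 2 + j),
          marginalSale ((k : ℝ) / ((N : ℝ) + 1)) (X t ω)
        - (Finset.Icc (N ^ 2 + 1) (N ^ 2 + j)).card
          * marginalRevenue 𝒟 ((k : ℝ) / ((N : ℝ) + 1)))} ≤ Real.exp (-2 * y ^ 2 / N) := by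
    intro j hj k _
    rw [Finset.mem_Icc] at hj
    refine h.hoeffding (fun t ht => ?_) (Finset.nonempty_Icc.2 (by omega))
      (measurable_marginalSale _) (hD.marginalSale_mem _) (by norm_num) hy ?_
    · rw [Finset.mem_Icc] at ht ⊢; omega
    · rw [Nat.card_Icc]; exact_mod_cast (by omega)
  refine (measureReal_biUnion_finset_le _ _).trans ?_
  refine (Finset.sum_le_sum fun j hj' => (measureReal_biUnion_finset_le _ _).trans
    (Finset.sum_le_sum fun k hk' => hj j hj' k hk')).trans ?_
  simp only [Finset.sum_const, Nat.card_Icc, Nat.add_sub_cancel, nsmul_eq_mul]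
  exact le_of_eq (by ring)

lemma IidDraws.measureReal_saleShortfall_le (h : IidDraws 𝒟 μ T X) (hD : LearningAssumption 𝒟 L)
    {n : ℕ} (hn0 : 0 < n) (hn : n ≤ T) (r : ℝ) {ε : ℝ} (hε : 0 ≤ ε) :
    μ.real (saleShortfall 𝒟 X n r ε) ≤ Real.exp (-2 * (n * ε ^ 2)) := by
  have h1 := h.hoeffding (S := Finset.Icc 1 n) (Finset.Icc_subset_Icc_right hn)
    (Finset.nonempty_Icc.2 hn0) (measurable_marginalSale r) (hD.marginalSale_mem r)
    (δ := -1) (by norm_num) (y := n * ε) (n := n) (by positivity) (by simp)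
  refine h1.trans (le_of_eq ?_)
  have : (n : ℝ) ≠ 0 := by positivity
  congr 1
  field_simp

/-- The loss of the supplier in a round after the commitment, in terms of the fluctuations of the
cost estimate and of the empirical marginal revenue. The quantity bought at the committed price can
drop if the marginal revenue was overestimated in the last sweep and is underestimated later. -/
lemma IsPlay.loss_le (h : IsPlay 𝒟 μ T X W Q) (hT : 12 ≤ T) (hD : LearningAssumption 𝒟 L) {qs : ℝ}
    (hqs : qs ∈ Set.Ioo (0 : ℝ) 1) (hpos : 0 < supplierValue 𝒟 qs) {ε y : ℝ} (hε : 0 ≤ ε)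
    (hy : 0 ≤ y) :
    ∃ s ∈ Finset.Icc 1 (gridSize T), ∃ k ≤ gridSize T, ∀ᵐ ω ∂μ,
      ∀ t ∈ Finset.Icc (gridSize T ^ 2 + gridSize T + 1) T,
      supplierValue 𝒟 qs - Q t ω * (W t ω - ∫ x, cost x ∂𝒟)
        ≤ ε + 5 / ((gridSize T : ℝ) + 1) + 2 * |costEstimate T X ω - ∫ x, cost x ∂𝒟|
          + (1 - ∫ x, cost x ∂𝒟) / ((∫ x, price x ∂𝒟) * L)
            * ((IidDraws.supDev 𝒟 X 1 (gridPoints (gridSize T)) (gridPoints_nonempty _)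
                  (Finset.Icc 1 (gridSize T ^ 2)) ω + y) / (gridSize T : ℝ) ^ 2
              + IidDraws.supDev 𝒟 X (-1) (gridPoints (gridSize T)) (gridPoints_nonempty _)
                  (Finset.Icc 1 (t - 1)) ω / ((t - 1 : ℕ) : ℝ))
          + (saleShortfall 𝒟 X (gridSize T ^ 2 + s - 1) ((k : ℝ) / ((gridSize T : ℝ) + 1)) ε
              ∪ sweepExcess 𝒟 X (gridSize T) y).indicator 1 ω := by
  have hN3 := three_le_gridSize hT
  have hexp := explore_le hT
  have hg6 : 0 < marginalRevenue 𝒟 qs - ∫ x, cost x ∂𝒟 := by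
    by_contra hneg
    exact absurd hpos (not_lt.2 (mul_nonpos_of_nonneg_of_nonpos hqs.1.le (not_lt.1 hneg)))
  obtain ⟨s, hs, k, hk, hgood⟩ := exists_good_price (g := marginalRevenue 𝒟) (qs := qs)
    (c := ∫ x, cost x ∂𝒟) (ε := ε) T (by omega) hD.marginalRevenue_antitone hqs
    hD.mean_cost_mem.1 (sub_pos.1 hg6) (hD.marginalRevenue_mem qs).2 hε
  refine ⟨s, hs, k, hk, ?_⟩
  filter_upwards [h.realization hD, h.loss_le_one hD hqs hpos] with ω hω hone t ht
  obtain ⟨S, hS⟩ := h.commitment ω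
  have ht' := Finset.mem_Icc.1 ht
  set N := gridSize T with hN
  set ec := ∫ x, cost x ∂𝒟 with hec
  have hec1 := hD.mean_cost_mem
  set a := (∫ x, price x ∂𝒟) * L with ha
  have ha0 : 0 < a := mul_pos hD.mean_price_pos hD.pos
  set V := IidDraws.supDev 𝒟 X 1 (gridPoints N) (gridPoints_nonempty _) (Finset.Icc 1 (N ^ 2)) ω
    with hV
  set V' := IidDraws.supDev 𝒟 X (-1) (gridPoints N) (gridPoints_nonempty _)
    (Finset.Icc 1 (t - 1)) ω with hV'
  have hV0 : 0 ≤ V := IidDraws.supDev_nonneg ω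
  have hV0' : 0 ≤ V' := IidDraws.supDev_nonneg ω
  have hA0 : 0 ≤ (1 - ec) / a := div_nonneg (by linarith [hec1.2]) ha0.le
  have hn0 : (0 : ℝ) < ((t - 1 : ℕ) : ℝ) := by exact_mod_cast (show 0 < t - 1 by omega)
  have hN0 : (0 : ℝ) < N := by exact_mod_cast (show 0 < N by omega)
  have hα : 0 ≤ (V + y) / (N : ℝ) ^ 2 := by positivity
  have hβ : 0 ≤ V' / ((t - 1 : ℕ) : ℝ) := by positivity
  by_cases hbad : ω ∈ saleShortfall 𝒟 X (N ^ 2 + s - 1) ((k : ℝ) / ((N : ℝ) + 1)) ε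
      ∪ sweepExcess 𝒟 X N y
  · rw [Set.indicator_of_mem hbad, Pi.one_apply]
    have h1 := hone t (Finset.mem_Icc.2 ⟨by omega, ht'.2⟩)
    have h2 : 0 ≤ (1 - ec) / a * ((V + y) / (N : ℝ) ^ 2 + V' / ((t - 1 : ℕ) : ℝ)) :=
      mul_nonneg hA0 (add_nonneg hα hβ)
    have h3 : 0 ≤ 5 / ((N : ℝ) + 1) := by positivity
    have h4 := abs_nonneg (costEstimate T X ω - ec)
    linarith
  · rw [Set.indicator_of_notMem hbad, add_zero]
    rw [Set.mem_union, not_or] at hbad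
    obtain ⟨hb1, hb2⟩ := hbad
    rw [saleShortfall, Set.mem_ofPred_eq, not_le] at hb1
    have hb2' : ∀ j ∈ Finset.Icc 1 (N - 1), ∀ k ∈ Finset.Icc 1 (N - 1),
        ∑ t ∈ Finset.Icc (N ^ 2 + 1) (N ^ 2 + j), marginalSale ((k : ℝ) / ((N : ℝ) + 1)) (X t ω)
          ≤ j * marginalRevenue 𝒟 ((k : ℝ) / ((N : ℝ) + 1)) + y := by
      intro j hj k hk
      by_contra hlt
      rw [not_le] at hlt
      refine hb2 (Set.mem_biUnion hj (Set.mem_biUnion hk ?_))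
      rw [Set.mem_ofPred_eq, Nat.card_Icc,
        show N ^ 2 + j + 1 - (N ^ 2 + 1) = j by omega]
      linarith
    have hS' := Finset.mem_Icc.1 hS.mem
    rw [← hN] at hS'
    have hN1 : 1 ≤ N ^ 2 := Nat.one_le_pow _ _ (by omega)
    have hq := hω.quantity_sub_le (t := S) (t' := t) (Finset.mem_Icc.2 (by omega))
      (Finset.mem_Icc.2 (by omega)) (hS.wholesale_mem hω).1 (hS.commit t ht)
      (g := marginalRevenue 𝒟) ha0
      (fun r r' h1 h2 h3 => hD.marginalRevenue_sub_ge h1 h2 h3) hα hβ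
      (fun k hk1 hkN => by
        obtain ⟨j, hj⟩ : ∃ j, S - 1 = N ^ 2 + j := ⟨S - 1 - N ^ 2, by omega⟩
        have h1 := IidDraws.le_supDev (𝒟 := 𝒟) (X := X) (δ := 1) (hs := gridPoints_nonempty N)
          (S := Finset.Icc 1 (N ^ 2)) (mem_gridPoints (N := N) (k := k) (by omega)) ω
        rw [Nat.card_Icc, Nat.add_sub_cancel, one_mul, ← hV] at h1
        have h2 : ∑ t ∈ Finset.Icc (N ^ 2 + 1) (N ^ 2 + j),
            marginalSale ((k : ℝ) / ((N : ℝ) + 1)) (X t ω)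
            ≤ j * marginalRevenue 𝒟 ((k : ℝ) / ((N : ℝ) + 1)) + y := by
          rcases Nat.eq_zero_or_pos j with rfl | hj0
          · simpa using hy
          · exact hb2' j (Finset.mem_Icc.2 (by omega)) k (Finset.mem_Icc.2 (by omega))
        rw [hj, saleSum_add, saleSum]
        have h3 : (N : ℝ) ^ 2 * ((V + y) / (N : ℝ) ^ 2) = V + y := by field_simp
        have h4 : 0 ≤ (j : ℝ) * ((V + y) / (N : ℝ) ^ 2) := by positivity
        push_cast at h1 ⊢
        linarith)
      (fun k hk1 => by
        have h1 := IidDraws.le_supDev (𝒟 := 𝒟) (X := X) (δ := -1) (hs := gridPoints_nonempty N)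
          (S := Finset.Icc 1 (t - 1)) (mem_gridPoints (N := N) (k := k) hk1) ω
        rw [Nat.card_Icc, Nat.add_sub_cancel, ← hV'] at h1
        have h3 : ((t - 1 : ℕ) : ℝ) * (V' / ((t - 1 : ℕ) : ℝ)) = V' := by field_simp
        rw [saleSum, mul_sub, h3]
        linarith)
    have hu := hgood (fun t => X t ω) (fun t => W t ω) (fun t => Q t ω) hT hω (by
      rw [saleSum]
      rw [Nat.card_Icc, Nat.add_sub_cancel] at hb1
      rw [mul_sub]
      linarith)
    have hfin := hS.loss_le hT hω hec1.1 hec1.2 hs ht hu (by positivity) hq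
    refine hfin.trans (le_of_eq ?_)
    ring

end

/-! ### The expected regret -/

section

variable {Ω : Type*} [MeasurableSpace Ω] {μ : Measure Ω} [IsProbabilityMeasure μ]
variable {𝒟 : Measure Outcome} [IsProbabilityMeasure 𝒟] {L : ℝ} {T : ℕ} {X : ℕ → Ω → Outcome}
  {W Q : ℕ → Ω → ℝ}

lemma IidDraws.integral_costEstimate_le (h : IidDraws 𝒟 μ T X) (hT : 12 ≤ T)
    (hD : LearningAssumption 𝒟 L) :
    Integrable (fun ω => |costEstimate T X ω - ∫ x, cost x ∂𝒟|) μ ∧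
    ∫ ω, |costEstimate T X ω - ∫ x, cost x ∂𝒟| ∂μ ≤ 1 / (2 * gridSize T) := by
  have hN3 := three_le_gridSize hT
  have hexp := explore_le hT
  obtain ⟨h1, h2⟩ := h.integral_abs_le (S := Finset.Icc 1 (gridSize T ^ 2))
    (Finset.Icc_subset_Icc_right (by omega)) measurable_cost hD.cost_mem
  rw [Nat.card_Icc, Nat.add_sub_cancel] at h1 h2
  set N := gridSize T with hN
  have hN0 : (0 : ℝ) < N := by exact_mod_cast (show 0 < N by omega)
  have e : ∀ ω, |costEstimate T X ω - ∫ x, cost x ∂𝒟| = 1 / (N : ℝ) ^ 2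
      * |∑ t ∈ Finset.Icc 1 (N ^ 2), cost (X t ω) - ((N ^ 2 : ℕ) : ℝ) * ∫ x, cost x ∂𝒟| := by
    intro ω
    have e1 : costEstimate T X ω - ∫ x, cost x ∂𝒟 = 1 / (N : ℝ) ^ 2
        * (∑ t ∈ Finset.Icc 1 (N ^ 2), cost (X t ω) - ((N ^ 2 : ℕ) : ℝ) * ∫ x, cost x ∂𝒟) := by
      rw [costEstimate, ← hN]
      push_cast
      field_simp
    rw [e1, abs_mul, abs_of_pos (show 0 < 1 / (N : ℝ) ^ 2 by positivity)]
  simp_rw [e]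
  refine ⟨h1.abs.const_mul _, ?_⟩
  rw [integral_const_mul]
  refine (mul_le_mul_of_nonneg_left h2 (by positivity)).trans (le_of_eq ?_)
  push_cast
  rw [Real.sqrt_sq hN0.le]
  field_simp

/-- The expected loss in a round after the commitment. -/
lemma IsPlay.integral_loss_le (h : IsPlay 𝒟 μ T X W Q) (hT : 12 ≤ T)
    (hD : LearningAssumption 𝒟 L) {qs : ℝ} (hqs : qs ∈ Set.Ioo (0 : ℝ) 1)
    (hpos : 0 < supplierValue 𝒟 qs) {ε y : ℝ} (hε : 0 ≤ ε) (hy : 0 ≤ y) {t : ℕ}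
    (ht : t ∈ Finset.Icc (gridSize T ^ 2 + gridSize T + 1) T) :
    supplierValue 𝒟 qs - ∫ ω, sigma (W t ω) (Q t ω) (cost (X t ω)) ∂μ
      ≤ ε + 5 / ((gridSize T : ℝ) + 1) + 1 / gridSize T
        + (1 - ∫ x, cost x ∂𝒟) / ((∫ x, price x ∂𝒟) * L)
          * (5 / 6 / gridSize T + y / (gridSize T : ℝ) ^ 2 + 5 / 6 * (1 / √((t - 1 : ℕ) : ℝ)))
        + (Real.exp (-2 * (gridSize T ^ 2 * ε ^ 2))
          + ((gridSize T - 1 : ℕ) : ℝ) ^ 2 * Real.exp (-2 * y ^ 2 / gridSize T)) := by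
  have hN3 := three_le_gridSize hT
  have hexp := explore_le hT
  have hiid := h.protocol.iidDraws
  have ht' := Finset.mem_Icc.1 ht
  obtain ⟨hint, hsig⟩ := h.integral_sigma hD (t := t) (Finset.mem_Icc.2 ⟨by omega, ht'.2⟩)
  obtain ⟨s, hs, k, hk, hloss⟩ := h.loss_le hT hD hqs hpos hε hy
  rw [Finset.mem_Icc] at hs
  obtain ⟨hc1, hc2⟩ := hiid.integral_costEstimate_le hT hD
  obtain ⟨hV1, hV2⟩ := hiid.integral_supDev_le hD (S := Finset.Icc 1 (gridSize T ^ 2))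
    (Finset.Icc_subset_Icc_right (by omega)) (δ := 1) (by norm_num) (gridPoints (gridSize T))
    (gridPoints_nonempty _) gridPoints_mem_Icc
  obtain ⟨hU1, hU2⟩ := hiid.integral_supDev_le hD (S := Finset.Icc 1 (t - 1))
    (Finset.Icc_subset_Icc_right (by omega)) (δ := -1) (by norm_num) (gridPoints (gridSize T))
    (gridPoints_nonempty _) gridPoints_mem_Icc
  rw [Nat.card_Icc, Nat.add_sub_cancel] at hV2 hU2
  have hb1 := hiid.measureReal_saleShortfall_le hD (n := gridSize T ^ 2 + s - 1) (by
    have : 1 ≤ gridSize T ^ 2 := Nat.one_le_pow _ _ (by omega)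
    omega) (by omega) ((k : ℝ) / ((gridSize T : ℝ) + 1)) hε
  have hb2 := hiid.measureReal_sweepExcess_le hD (N := gridSize T) hexp hy
  have hm1 : MeasurableSet (saleShortfall 𝒟 X (gridSize T ^ 2 + s - 1)
      ((k : ℝ) / ((gridSize T : ℝ) + 1)) ε) := by
    refine measurableSet_le measurable_const (Measurable.const_mul (Measurable.sub_const
      (Finset.measurable_fun_sum _ fun t ht => (measurable_marginalSale _).comp
        (hiid.measurable t ?_)) _) _)
    rw [Finset.mem_Icc] at ht ⊢
    omega
  have hm2 : MeasurableSet (sweepExcess 𝒟 X (gridSize T) y) := by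
    refine Finset.measurableSet_biUnion _ fun j hj => Finset.measurableSet_biUnion _ fun k _ => ?_
    refine measurableSet_le measurable_const (Measurable.const_mul (Measurable.sub_const
      (Finset.measurable_fun_sum _ fun t ht => (measurable_marginalSale _).comp
        (hiid.measurable t ?_)) _) _)
    rw [Finset.mem_Icc] at ht hj ⊢
    omega
  set N := gridSize T with hN
  set ec := ∫ x, cost x ∂𝒟 with hec
  set A := (1 - ec) / ((∫ x, price x ∂𝒟) * L) with hA
  have hA0 : 0 ≤ A := div_nonneg (by linarith [hD.mean_cost_mem.2])
    (mul_pos hD.mean_price_pos hD.pos).le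
  set bad := saleShortfall 𝒟 X (N ^ 2 + s - 1) ((k : ℝ) / ((N : ℝ) + 1)) ε ∪ sweepExcess 𝒟 X N y
    with hbad
  have hbadm : MeasurableSet bad := hm1.union hm2
  set V := IidDraws.supDev 𝒟 X 1 (gridPoints N) (gridPoints_nonempty _) (Finset.Icc 1 (N ^ 2))
    with hV
  set V' := IidDraws.supDev 𝒟 X (-1) (gridPoints N) (gridPoints_nonempty _) (Finset.Icc 1 (t - 1))
    with hV'
  have hN0 : (0 : ℝ) < N := by exact_mod_cast (show 0 < N by omega)
  have hn0 : (0 : ℝ) < ((t - 1 : ℕ) : ℝ) := by exact_mod_cast (show 0 < t - 1 by omega)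
  have hI1 : Integrable (bad.indicator (1 : Ω → ℝ)) μ := (integrable_const (1 : ℝ)).indicator hbadm
  have hI2 : Integrable (fun ω => (V ω + y) / (N : ℝ) ^ 2 + V' ω / ((t - 1 : ℕ) : ℝ)) μ :=
    ((hV1.add (integrable_const y)).div_const _).add (hU1.div_const _)
  have hmono := integral_mono_ae (((integrable_const (supplierValue 𝒟 qs)).sub hint))
    ((((integrable_const (ε + 5 / ((N : ℝ) + 1))).add (hc1.const_mul 2)).add
      (hI2.const_mul A)).add hI1) (hloss.mono fun ω hω => hω t ht)
  rw [integral_add' (((integrable_const (ε + 5 / ((N : ℝ) + 1))).add (hc1.const_mul 2)).add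
      (hI2.const_mul A)) hI1, integral_add' ((integrable_const (ε + 5 / ((N : ℝ) + 1))).add
      (hc1.const_mul 2)) (hI2.const_mul A), integral_add' (integrable_const _) (hc1.const_mul 2),
    integral_sub' (integrable_const _) hint, integral_const_mul, integral_const_mul,
    integral_indicator_one hbadm] at hmono
  have hsum : ∫ ω, (V ω + y) / (N : ℝ) ^ 2 + V' ω / ((t - 1 : ℕ) : ℝ) ∂μ
      = (∫ ω, V ω ∂μ + y) / (N : ℝ) ^ 2 + (∫ ω, V' ω ∂μ) / ((t - 1 : ℕ) : ℝ) := by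
    have hVy : Integrable (fun ω => V ω + y) μ := hV1.add (integrable_const y)
    rw [integral_add (hVy.div_const _) (hU1.div_const _), integral_div, integral_div,
      integral_add hV1 (integrable_const y), integral_const, probReal_univ, one_smul]
  rw [hsum] at hmono
  simp only [integral_const, probReal_univ, one_smul] at hmono
  rw [← hsig] at hmono
  have hbr : μ.real bad ≤ Real.exp (-2 * (N ^ 2 * ε ^ 2))
      + ((N - 1 : ℕ) : ℝ) ^ 2 * Real.exp (-2 * y ^ 2 / N) := by
    refine (measureReal_union_le _ _).trans (add_le_add (hb1.trans ?_) hb2)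
    refine Real.exp_le_exp.2 ?_
    have : ((N ^ 2 : ℕ) : ℝ) ≤ ((N ^ 2 + s - 1 : ℕ) : ℝ) := by exact_mod_cast (by omega)
    push_cast at this
    nlinarith [sq_nonneg ε]
  have hVb : (∫ ω, V ω ∂μ + y) / (N : ℝ) ^ 2 ≤ 5 / 6 / N + y / (N : ℝ) ^ 2 := by
    rw [add_div]
    refine add_le_add_left ?_ _
    push_cast at hV2
    rw [Real.sqrt_sq hN0.le] at hV2
    rw [div_le_div_iff₀ (by positivity) hN0]
    nlinarith
  have hUb : (∫ ω, V' ω ∂μ) / ((t - 1 : ℕ) : ℝ) ≤ 5 / 6 * (1 / √((t - 1 : ℕ) : ℝ)) := by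
    rw [div_le_iff₀ hn0]
    refine hU2.trans (le_of_eq ?_)
    rw [mul_assoc, one_div_mul_eq_div, Real.div_sqrt]
  have hAb := mul_le_mul_of_nonneg_left (add_le_add hVb hUb) hA0
  have e2 : 2 * (1 / (2 * (N : ℝ))) = 1 / N := by field_simp
  linarith

lemma regret_average {x r : ℝ} (hr0 : 0 < r) (hr : r ^ 2 = x) (l m A : ℝ) :
    1 / x ^ 3 * ((x ^ 2 + 3 * x + 2) + (x ^ 3 * ((l / 2 + 8 + A * (5 / 6 + m / r)) / x)
        + A * (5 / 6) * (2 * (x * r))))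
      = (1 + 3 / x + 2 / x ^ 2 + 8 + l / 2 + A * (5 / 6 + (m + 5 / 3) / r)) / x := by
  subst hr
  field_simp
  ring

/-- The supplier's regret bound. -/
lemma IsPlay.regret_le (h : IsPlay 𝒟 μ T X W Q) (hT : 12 ≤ T) (hD : LearningAssumption 𝒟 L)
    {qs : ℝ} (hqs : qs ∈ Set.Ioo (0 : ℝ) 1) (hpos : 0 < supplierValue 𝒟 qs) :
    supplierValue 𝒟 qs
        - 1 / (T : ℝ) * ∑ t ∈ Finset.Icc 1 T, ∫ ω, sigma (W t ω) (Q t ω) (cost (X t ω)) ∂μ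
      ≤ (16 + (1 - ∫ x, cost x ∂𝒟) / ((∫ x, price x ∂𝒟) * L) + 7 * √(Real.log T))
        * (T : ℝ) ^ (-(1 / 3) : ℝ) := by
  have hN3 := three_le_gridSize hT
  have hexp := explore_le hT
  set A := (1 - ∫ x, cost x ∂𝒟) / ((∫ x, price x ∂𝒟) * L) with hA
  have hA0 : 0 ≤ A := div_nonneg (by linarith [hD.mean_cost_mem.2])
    (mul_pos hD.mean_price_pos hD.pos).le
  have hT0 : (0 : ℝ) < T := by positivity
  have hT1 : (1 : ℝ) ≤ T := by exact_mod_cast (show 1 ≤ T by omega)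
  set l := √(Real.log T) with hl
  have hl0 : 0 ≤ l := Real.sqrt_nonneg _
  have hl2 : l ^ 2 = Real.log T := Real.sq_sqrt (Real.log_nonneg hT1)
  have hxN := rpow_third_le_gridSize T
  have hNx := gridSize_lt T
  have hx3 := rpow_third_pow T
  have hxinv : (T : ℝ) ^ (-(1 / 3) : ℝ) = ((T : ℝ) ^ (1 / 3 : ℝ))⁻¹ := Real.rpow_neg hT0.le _
  have hxexp : (T : ℝ) ^ (1 / 3 : ℝ) = Real.exp (l ^ 2 / 3) := by
    rw [hl2, Real.rpow_def_of_pos hT0]; congr 1; ring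
  rw [hxinv, ← div_eq_mul_inv]
  set x := (T : ℝ) ^ (1 / 3 : ℝ) with hx
  have hx0 : 0 < x := by positivity
  set N := gridSize T with hN
  have hN0 : (0 : ℝ) < N := by exact_mod_cast (show 0 < N by omega)
  set loss := fun t => supplierValue 𝒟 qs - ∫ ω, sigma (W t ω) (Q t ω) (cost (X t ω)) ∂μ with hloss
  have e : supplierValue 𝒟 qs
      - 1 / (T : ℝ) * ∑ t ∈ Finset.Icc 1 T, ∫ ω, sigma (W t ω) (Q t ω) (cost (X t ω)) ∂μ
      = 1 / (T : ℝ) * ∑ t ∈ Finset.Icc 1 T, loss t := by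
    rw [hloss, Finset.sum_sub_distrib, Finset.sum_const, Nat.card_Icc, Nat.add_sub_cancel,
      nsmul_eq_mul]
    field_simp
  rw [e]
  have hone : ∀ t ∈ Finset.Icc 1 T, loss t ≤ 1 := by
    intro t ht
    obtain ⟨hint, hsig⟩ := h.integral_sigma hD ht
    have h1 := integral_mono_ae ((integrable_const (supplierValue 𝒟 qs)).sub hint)
      (integrable_const 1) ((h.loss_le_one hD hqs hpos).mono fun ω hω => hω t ht)
    rw [integral_sub' (integrable_const _) hint, integral_const, integral_const, probReal_univ,
      one_smul, one_smul, ← hsig] at h1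
    exact h1
  rcases le_or_gt x (16 + A + 7 * l) with hsmall | hbig
  · have h1 : 1 / (T : ℝ) * ∑ t ∈ Finset.Icc 1 T, loss t ≤ 1 := by
      rw [one_div_mul_eq_div, div_le_one hT0]
      simpa using Finset.sum_le_sum hone
    refine h1.trans ?_
    rwa [one_le_div hx0]
  -- The threshold `ε` makes the first exceptional event have probability at most `T^{-1/2}`, and
  -- `y` makes the second one have probability at most `N² / T`.
  set ε := l / (2 * N) with hε
  set y := l * √(N / 2 : ℝ) with hy
  have hε0 : 0 ≤ ε := by positivity
  have hy0 : 0 ≤ y := by positivity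
  have hp1 : Real.exp (-2 * (N ^ 2 * ε ^ 2)) ≤ 1 / x := by
    rw [hxexp, one_div, ← Real.exp_neg]
    refine Real.exp_le_exp.2 ?_
    have : (N : ℝ) ^ 2 * ε ^ 2 = l ^ 2 / 4 := by rw [hε]; field_simp; norm_num
    rw [this]
    nlinarith [sq_nonneg l]
  have hp2 : ((N - 1 : ℕ) : ℝ) ^ 2 * Real.exp (-2 * y ^ 2 / N) ≤ 1 / x := by
    have e1 : -2 * y ^ 2 / N = -(l ^ 2) := by
      have : √(N / 2 : ℝ) ^ 2 = N / 2 := Real.sq_sqrt (by positivity)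
      rw [hy, mul_pow, this]
      generalize l ^ 2 = z
      field_simp
    have e2 : ((N - 1 : ℕ) : ℝ) ≤ x := by
      rw [Nat.cast_sub (by omega)]; push_cast; linarith
    rw [e1, Real.exp_neg, hl2, Real.exp_log hT0, ← hx3]
    calc ((N - 1 : ℕ) : ℝ) ^ 2 * (x ^ 3)⁻¹ ≤ x ^ 2 * (x ^ 3)⁻¹ := by gcongr
      _ = 1 / x := by field_simp
  set K := ε + 5 / ((N : ℝ) + 1) + 1 / N + A * (5 / 6 / N + y / (N : ℝ) ^ 2) + 2 / x with hK
  have hK0 : 0 ≤ K := by positivity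
  have hlate : ∀ t ∈ Finset.Icc (N ^ 2 + N + 1) T,
      loss t ≤ K + A * (5 / 6) * (1 / √((t - 1 : ℕ) : ℝ)) := by
    intro t ht
    have h1 := h.integral_loss_le hT hD hqs hpos hε0 hy0 ht
    rw [← hN, ← hA] at h1
    have e3 : 2 / x = 1 / x + 1 / x := by ring
    rw [hK, e3]
    simp only [hloss]
    linarith
  have hsplit : Finset.Icc 1 T = Finset.Icc 1 (N ^ 2 + N) ∪ Finset.Icc (N ^ 2 + N + 1) T := by
    ext i; simp only [Finset.mem_union, Finset.mem_Icc]; omega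
  have hdisj : Disjoint (Finset.Icc 1 (N ^ 2 + N)) (Finset.Icc (N ^ 2 + N + 1) T) := by
    rw [Finset.disjoint_left]; intro i hi hi'; rw [Finset.mem_Icc] at hi hi'; omega
  have hs1 : ∑ t ∈ Finset.Icc 1 (N ^ 2 + N), loss t ≤ (N : ℝ) ^ 2 + N := by
    have h1 : ∑ t ∈ Finset.Icc 1 (N ^ 2 + N), loss t ≤ ∑ t ∈ Finset.Icc 1 (N ^ 2 + N), (1 : ℝ) :=
      Finset.sum_le_sum fun t ht => hone t (Finset.Icc_subset_Icc_right (by omega) ht)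
    simpa using h1
  have hs3 : ∑ t ∈ Finset.Icc (N ^ 2 + N + 1) T, 1 / √((t - 1 : ℕ) : ℝ) ≤ 2 * √(T : ℝ) := by
    refine le_trans ?_ (sum_inv_sqrt_le T)
    rw [← Finset.sum_image (f := fun k : ℕ => 1 / √(k : ℝ)) (g := fun t => t - 1)]
    · refine Finset.sum_le_sum_of_subset_of_nonneg (fun k hk => ?_) fun _ _ _ => by positivity
      obtain ⟨t, ht, rfl⟩ := Finset.mem_image.1 hk
      rw [Finset.mem_Icc] at ht ⊢
      omega
    · intro i hi j hj hij
      rw [Finset.mem_coe, Finset.mem_Icc] at hi hj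
      simp only at hij
      omega
  have hs2 : ∑ t ∈ Finset.Icc (N ^ 2 + N + 1) T, loss t ≤ T * K + A * (5 / 6) * (2 * √(T : ℝ)) := by
    refine (Finset.sum_le_sum hlate).trans ?_
    rw [Finset.sum_add_distrib, ← Finset.mul_sum, Finset.sum_const, nsmul_eq_mul, Nat.card_Icc]
    refine add_le_add (mul_le_mul_of_nonneg_right ?_ hK0)
      (mul_le_mul_of_nonneg_left hs3 (by positivity))
    exact_mod_cast (show T + 1 - (N ^ 2 + N + 1) ≤ T by omega)
  have hnum := regret_numeric hl0 hA0 hxexp hbig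
  set r := √x with hr
  have hr0 : 0 < r := Real.sqrt_pos.2 hx0
  have hr2 : r ^ 2 = x := Real.sq_sqrt hx0.le
  have hsT : √(T : ℝ) = x * r := by
    rw [← hx3, Real.sqrt_eq_iff_mul_self_eq (by positivity) (by positivity)]
    calc x ^ 3 = x ^ 2 * r ^ 2 := by rw [hr2]; ring
      _ = x * r * (x * r) := by ring
  have hyN : y / (N : ℝ) ^ 2 ≤ l / √2 / (x * r) := by
    have hrN : r ≤ √(N : ℝ) := Real.sqrt_le_sqrt hxN
    have hsN : √(N : ℝ) ^ 2 = N := Real.sq_sqrt hN0.le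
    have hsN0 : 0 < √(N : ℝ) := Real.sqrt_pos.2 hN0
    have e1 : y / (N : ℝ) ^ 2 = l / √2 / (N * √(N : ℝ)) := by
      rw [hy, Real.sqrt_div hN0.le]
      rw [show (N : ℝ) ^ 2 = N * (√(N : ℝ) * √(N : ℝ)) by rw [← sq, hsN]; ring]
      field_simp
    rw [e1]
    gcongr
  have hKx : K ≤ (l / 2 + 8 + A * (5 / 6 + l / √2 / r)) / x := by
    have h1 : ε ≤ l / 2 / x := by
      rw [hε, div_div]; gcongr
    have h2 : 5 / ((N : ℝ) + 1) ≤ 5 / x := by gcongr; linarith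
    have h3 : 1 / (N : ℝ) ≤ 1 / x := by gcongr
    have h4 : 5 / 6 / (N : ℝ) ≤ 5 / 6 / x := by gcongr
    have h5 : A * (5 / 6 / N + y / (N : ℝ) ^ 2) ≤ A * (5 / 6 / x + l / √2 / (x * r)) := by gcongr
    have e1 : (l / 2 + 8 + A * (5 / 6 + l / √2 / r)) / x
        = l / 2 / x + 5 / x + 1 / x + A * (5 / 6 / x + l / √2 / (x * r)) + 2 / x := by
      field_simp; ring
    rw [e1]
    linarith
  have hNN : (N : ℝ) ^ 2 + N ≤ x ^ 2 + 3 * x + 2 := by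
    calc (N : ℝ) ^ 2 + N ≤ (x + 1) ^ 2 + (x + 1) := by gcongr
      _ = _ := by ring
  rw [hsplit, Finset.sum_union hdisj]
  calc 1 / (T : ℝ) * (∑ t ∈ Finset.Icc 1 (N ^ 2 + N), loss t
        + ∑ t ∈ Finset.Icc (N ^ 2 + N + 1) T, loss t)
      ≤ 1 / (T : ℝ) * ((x ^ 2 + 3 * x + 2) + (T * ((l / 2 + 8 + A * (5 / 6 + l / √2 / r)) / x)
        + A * (5 / 6) * (2 * √(T : ℝ)))) := by
        gcongr
        · exact hs1.trans hNN
        · refine hs2.trans ?_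
          gcongr
    _ = (1 + 3 / x + 2 / x ^ 2 + 8 + l / 2 + A * (5 / 6 + (l / √2 + 5 / 3) / r)) / x := by
        rw [hsT, ← hx3]
        exact regret_average hr0 hr2 _ _ _
    _ ≤ _ := by gcongr

end

/-! ### Convergence to the equilibrium -/

section

/-- A strict maximum of a continuous function on a compact set is well separated. -/
lemma exists_near_of_near_max {K : Set ℝ} (hK : IsCompact K) {v : ℝ → ℝ} (hv : Continuous v) {z : ℝ}
    (hmax : IsMaxOn v K z) (huniq : ∀ r ∈ K, v z ≤ v r → r = z) {η : ℝ} (hη : 0 < η) :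
    ∃ δ > 0, ∀ r ∈ K, v z - δ ≤ v r → |r - z| < η := by
  have hK' : IsCompact (K ∩ {r | η ≤ |r - z|}) :=
    hK.inter_right (isClosed_le continuous_const (by fun_prop))
  rcases (K ∩ {r | η ≤ |r - z|}).eq_empty_or_nonempty with he | hne
  · refine ⟨1, one_pos, fun r hr _ => not_le.1 fun hle => ?_⟩
    exact (he ▸ (⟨hr, hle⟩ : r ∈ K ∩ {r | η ≤ |r - z|}) : r ∈ (∅ : Set ℝ))
  · obtain ⟨r₀, hr₀, hr₀max⟩ := hK'.exists_isMaxOn hne hv.continuousOn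
    have hlt : v r₀ < v z := by
      refine lt_of_le_of_ne (hmax hr₀.1) fun heq => ?_
      have h1 : η ≤ |r₀ - z| := hr₀.2
      rw [huniq r₀ hr₀.1 heq.ge, sub_self, abs_zero] at h1
      linarith
    refine ⟨(v z - v r₀) / 2, by linarith, fun r hr hle => not_le.1 fun hge => ?_⟩
    have h1 : v r ≤ v r₀ := hr₀max (⟨hr, hge⟩ : r ∈ K ∩ {r | η ≤ |r - z|})
    linarith

variable {𝒟 : Measure Outcome} [IsProbabilityMeasure 𝒟] {L : ℝ}

/-- If the empirical marginal revenue and the cost estimate are accurate from the last sweep on,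
then the moves after the commitment are close to the equilibrium: the value that the supplier gets
is close to `supplierValue` at the quantity of the committed round, and the maximum of
`supplierValue` is strict. -/
lemma LearningAssumption.exists_accuracy (hD : LearningAssumption 𝒟 L) {ws qs : ℝ}
    (hSE : IsStackelberg 𝒟 ws qs) {η : ℝ} (hη : 0 < η) :
    ∃ ε > 0, ∀ (T : ℕ) (x : ℕ → Outcome) (w q : ℕ → ℝ) (c : ℝ) (S : ℕ), 12 ≤ T →
      IsRealization T x w q → IsCommitment T w q c S → 1 / ((gridSize T : ℝ) + 1) ≤ ε →
      |c - ∫ x, cost x ∂𝒟| ≤ ε →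
      (∀ n ∈ Finset.Icc (gridSize T ^ 2) T, ∀ k ≤ gridSize T + 1,
        |saleSum x n ((k : ℝ) / ((gridSize T : ℝ) + 1))
          - n * marginalRevenue 𝒟 ((k : ℝ) / ((gridSize T : ℝ) + 1))| ≤ n * ε) →
      ∀ t ∈ Finset.Icc (gridSize T ^ 2 + gridSize T + 1) T, |ws - w t| + |qs - q t| ≤ η := by
  obtain ⟨hws, hqs, hpos, hmax, huniq⟩ := hD.equilibrium hSE
  set ec := ∫ x, cost x ∂𝒟 with hec
  have hec1 := hD.mean_cost_mem
  set a := (∫ x, price x ∂𝒟) * L with ha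
  have ha0 : 0 < a := mul_pos hD.mean_price_pos hD.pos
  have hg6 : 0 < marginalRevenue 𝒟 qs - ec := by
    by_contra hneg
    exact absurd hpos (not_lt.2 (mul_nonpos_of_nonneg_of_nonpos hqs.1.le (not_lt.1 hneg)))
  obtain ⟨ρ, hρ0, hρ⟩ := Metric.continuousAt_iff.1 (hD.continuous_marginalRevenue.continuousAt
    (x := qs)) (η / 4) (by linarith)
  simp only [Real.dist_eq] at hρ
  have hη'0 : 0 < min (min (ρ / 2) (η / 8)) qs := lt_min (lt_min (by linarith) (by linarith)) hqs.1
  obtain ⟨δ, hδ0, hδ⟩ := exists_near_of_near_max isCompact_Icc hD.continuous_supplierValue hmax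
    huniq hη'0
  set η' := min (min (ρ / 2) (η / 8)) qs with hη'
  have hη'1 : η' ≤ ρ / 2 := (min_le_left _ _).trans (min_le_left _ _)
  have hη'2 : η' ≤ η / 8 := (min_le_left _ _).trans (min_le_right _ _)
  have hη'3 : η' ≤ qs := min_le_right _ _
  -- `ε` is small against `δ`, the radius `ρ` and the final tolerance `η`.
  set ε := min (min (δ / 6) (ρ / 5)) (min (η / 32) (η * a / 16)) with hε
  have hε0 : 0 < ε := by positivity
  have hε1 : ε ≤ δ / 6 := (min_le_left _ _).trans (min_le_left _ _)
  have hε2 : ε ≤ ρ / 5 := (min_le_left _ _).trans (min_le_right _ _)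
  have hε3 : ε ≤ η / 32 := (min_le_right _ _).trans (min_le_left _ _)
  have hε4 : ε / a ≤ η / 16 := by
    rw [div_le_iff₀ ha0]
    exact ((min_le_right _ _).trans (min_le_right _ _)).trans (le_of_eq (by ring))
  refine ⟨ε, hε0, fun T x w q c S hT h hS hH hc hsale t ht => ?_⟩
  have hN3 := three_le_gridSize hT
  have hexp := explore_le hT
  set N := gridSize T with hN
  have hN9 : 9 ≤ N ^ 2 := by nlinarith
  set H : ℝ := (N : ℝ) + 1 with hHdef
  have hH0 : 0 < H := by positivity
  have hHpos : 0 < 1 / H := by positivity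
  have hS' := Finset.mem_Icc.1 hS.mem
  rw [← hN] at hS'
  have ht' := Finset.mem_Icc.1 ht
  have hwS := hS.wholesale_mem h
  have hmS : S ∈ Finset.Icc 1 T := Finset.mem_Icc.2 (by omega)
  have hmS2 : S ∈ Finset.Icc 2 T := Finset.mem_Icc.2 (by omega)
  have hmt2 : t ∈ Finset.Icc 2 T := Finset.mem_Icc.2 (by omega)
  have hqS0 := h.quantity_pos hmS
  have hqS1 := h.quantity_le_one hmS
  have hup : ∀ n ∈ Finset.Icc (N ^ 2) T, ∀ k ≤ N + 1, saleSum x n ((k : ℝ) / H)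
      ≤ n * (marginalRevenue 𝒟 ((k : ℝ) / H) + ε) := fun n hn k hk => by
    have := (abs_le.1 (hsale n hn k hk)).2
    linarith
  have hlow : ∀ n ∈ Finset.Icc (N ^ 2) T, ∀ k ≤ N + 1,
      n * (marginalRevenue 𝒟 ((k : ℝ) / H) - ε) ≤ saleSum x n ((k : ℝ) / H) := fun n hn k hk => by
    have := (abs_le.1 (hsale n hn k hk)).1
    linarith
  have hnS : S - 1 ∈ Finset.Icc (N ^ 2) T := Finset.mem_Icc.2 (by omega)
  have hnt : t - 1 ∈ Finset.Icc (N ^ 2) T := Finset.mem_Icc.2 (by omega)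
  have hwt : w t = w S := hS.commit t ht
  -- The quantity of round `t` is close to that of the committed round.
  have hdist : |q t - q S| ≤ η / 4 := by
    have h1 := h.quantity_sub_le hmS2 hmt2 hwS.1 hwt ha0
      (fun r r' h1 h2 h3 => hD.marginalRevenue_sub_ge h1 h2 h3) hε0.le hε0.le
      (fun k _ hk => hup _ hnS k (by omega)) (fun k hk => hlow _ hnt k hk)
    have h2 := h.quantity_sub_le hmt2 hmS2 (hwt ▸ hwS.1) hwt.symm ha0
      (fun r r' h1 h2 h3 => hD.marginalRevenue_sub_ge h1 h2 h3) hε0.le hε0.le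
      (fun k _ hk => hup _ hnt k (by omega)) (fun k hk => hlow _ hnS k hk)
    rw [← hN, ← hHdef] at h1 h2
    have e1 : 2 / H + (ε + ε) / a = 2 * (1 / H) + 2 * (ε / a) := by ring
    rw [e1] at h1 h2
    rw [abs_le]
    constructor <;> linarith
  obtain ⟨s, hs, k, hk, hgood⟩ := exists_good_price (g := marginalRevenue 𝒟) (qs := qs)
    (c := ec) (ε := ε) T (by omega) hD.marginalRevenue_antitone hqs
    hec1.1 (sub_pos.1 hg6) (hD.marginalRevenue_mem qs).2 hε0.le
  have hs' := Finset.mem_Icc.1 hs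
  rw [← hN] at hs' hk hgood
  have hval := hgood x w q hT h (hlow _ (Finset.mem_Icc.2 (by omega)) k (by omega))
  have hval2 := hS.value_le (ec := ec) hT h hs
  rw [← hHdef] at hval
  rw [← hN] at hval2
  obtain ⟨l, hl, hql, hl2, hl1⟩ := h.leader_bracket hmS2 hwS.1
  rw [Finset.mem_Icc] at hl
  rw [← hN, ← hHdef] at hql hl2 hl1
  rw [← hN] at hl
  have hn0 : (0 : ℝ) < ((S - 1 : ℕ) : ℝ) := by exact_mod_cast (show 0 < S - 1 by omega)
  have hlcast : ((l - 1 : ℕ) : ℝ) = l - 1 := by push_cast [hl.1]; ring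
  set r : ℝ := ((l - 1 : ℕ) : ℝ) / H with hr
  have hr0 : 0 ≤ r := by positivity
  have hqr : q S = r + 1 / H := by rw [hql, hr, hlcast]; ring
  have hr1 : r ≤ 1 := by linarith
  have hwup : 2 ≤ l → w S ≤ marginalRevenue 𝒟 r + ε := fun hl' =>
    le_of_mul_le_mul_left ((hl2 hl').trans (hup _ hnS (l - 1) (by omega))) hn0
  have hwlow : marginalRevenue 𝒟 (((l + 1 : ℕ) : ℝ) / H) - ε ≤ w S :=
    le_of_mul_le_mul_left ((hlow _ hnS (l + 1) (by omega)).trans hl1) hn0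
  have hvr : q S * (w S - ec) ≤ supplierValue 𝒟 r + 1 / H + ε := by
    rcases Nat.lt_or_ge l 2 with hl' | hl'
    · have hr00 : r = 0 := by rw [hr, show l - 1 = 0 by omega]; simp
      rw [hqr, hr00, supplierValue]
      have : 1 / H * (w S - ec) ≤ 1 / H :=
        mul_le_of_le_one_right hHpos.le (by linarith [hwS.2, hec1.1])
      linarith
    · have h1 : q S * (w S - ec) ≤ q S * (marginalRevenue 𝒟 r + ε - ec) :=
        mul_le_mul_of_nonneg_left (by linarith [hwup hl']) hqS0.le
      have h2 : q S * ε ≤ ε := mul_le_of_le_one_left hε0.le hqS1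
      have h3 : 1 / H * (marginalRevenue 𝒟 r - ec) ≤ 1 / H :=
        mul_le_of_le_one_right hHpos.le (by linarith [(hD.marginalRevenue_mem r).2, hec1.1])
      rw [supplierValue]
      have e1 : q S * (marginalRevenue 𝒟 r + ε - ec) = r * (marginalRevenue 𝒟 r - ec)
          + 1 / H * (marginalRevenue 𝒟 r - ec) + q S * ε := by rw [hqr]; ring
      linarith
  have hnear : |r - qs| < η' := by
    refine hδ r ⟨hr0, hr1⟩ ?_
    have e1 : supplierValue 𝒟 qs = qs * (marginalRevenue 𝒟 qs - ec) := rfl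
    have e2 : 2 / H = 2 * (1 / H) := by ring
    linarith
  have hl' : 2 ≤ l := by
    by_contra hlt
    have hr00 : r = 0 := by rw [hr, show l - 1 = 0 by omega]; simp
    rw [hr00, zero_sub, abs_neg, abs_of_pos hqs.1] at hnear
    linarith
  have hr' : ((l + 1 : ℕ) : ℝ) / H = r + 2 * (1 / H) := by
    rw [hr, hlcast]; push_cast; ring
  have hnear' : |r + 2 * (1 / H) - qs| < ρ := by
    rw [abs_lt] at hnear ⊢
    constructor <;> linarith
  have hg1 := abs_lt.1 (hρ (show |r - qs| < ρ by linarith))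
  have hg2 := abs_lt.1 (hρ hnear')
  rw [hr'] at hwlow
  have hw' := hwup hl'
  have hdw : |ws - w S| ≤ η / 2 := by
    rw [hws, abs_le]
    constructor <;> linarith
  have hdq : |qs - q S| ≤ η / 4 := by
    rw [abs_lt] at hnear
    rw [hqr, abs_le]
    constructor <;> linarith
  rw [hwt]
  have h3 := abs_sub_le qs (q S) (q t)
  rw [abs_sub_comm (q S) (q t)] at h3
  linarith

end

/-! ### The probability of inaccurate estimates -/

section

variable {Ω : Type*} [MeasurableSpace Ω] {μ : Measure Ω} [IsProbabilityMeasure μ]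
variable {𝒟 : Measure Outcome} [IsProbabilityMeasure 𝒟] {L : ℝ}

/-- The event that the average of `f` over the first `n` draws is off by more than `ε`. -/
def averageDeviation (𝒟 : Measure Outcome) (X : ℕ → Ω → Outcome) (f : Outcome → ℝ) (ε : ℝ) (n : ℕ) :
    Set Ω :=
  {ω | n * ε < |∑ t ∈ Finset.Icc 1 n, f (X t ω) - n * ∫ x, f x ∂𝒟|}

/-- The event that, in a play with horizon `T`, the empirical marginal revenue at some grid point,
or the empirical cost, is off by more than `ε` from the last sweep on. -/
def inaccurate (𝒟 : Measure Outcome) (T : ℕ) (X : ℕ → Ω → Outcome) (ε : ℝ) : Set Ω :=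
  ⋃ n ∈ Finset.Icc (gridSize T ^ 2) T, averageDeviation 𝒟 X cost ε n ∪
    ⋃ k ∈ Finset.range (gridSize T + 2),
      averageDeviation 𝒟 X (marginalSale ((k : ℝ) / ((gridSize T : ℝ) + 1))) ε n

section

variable {T : ℕ} {X : ℕ → Ω → Outcome}

omit [IsProbabilityMeasure μ] [IsProbabilityMeasure 𝒟] in
lemma IidDraws.measurableSet_averageDeviation (h : IidDraws 𝒟 μ T X) {f : Outcome → ℝ}
    (hf : Measurable f) (ε : ℝ) {n : ℕ} (hn : n ≤ T) :
    MeasurableSet (averageDeviation 𝒟 X f ε n) :=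
  measurableSet_lt measurable_const (Measurable.abs (Measurable.sub_const
    (Finset.measurable_fun_sum _ fun t ht => hf.comp
      (h.measurable t (Finset.Icc_subset_Icc_right hn ht))) _))

omit [IsProbabilityMeasure 𝒟] in
lemma IidDraws.measureReal_averageDeviation_le (h : IidDraws 𝒟 μ T X) {f : Outcome → ℝ}
    (hf : Measurable f) (hf01 : ∀ᵐ x ∂𝒟, f x ∈ Set.Icc (0 : ℝ) 1) {ε : ℝ} (hε : 0 ≤ ε) {n : ℕ}
    (hn0 : 0 < n) (hn : n ≤ T) :
    μ.real (averageDeviation 𝒟 X f ε n) ≤ 2 * Real.exp (-2 * (n * ε ^ 2)) := by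
  have hn0' : (n : ℝ) ≠ 0 := by positivity
  have h1 : ∀ δ : ℝ, δ ^ 2 = 1 → μ.real {ω | n * ε ≤ δ * (∑ t ∈ Finset.Icc 1 n, f (X t ω)
      - n * ∫ x, f x ∂𝒟)} ≤ Real.exp (-2 * (n * ε ^ 2)) := by
    intro δ hδ
    have h2 := h.hoeffding (S := Finset.Icc 1 n) (Finset.Icc_subset_Icc_right hn)
      (Finset.nonempty_Icc.2 hn0) hf hf01 hδ (y := n * ε) (n := n) (by positivity) (by simp)
    rw [Nat.card_Icc, Nat.add_sub_cancel] at h2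
    refine h2.trans (le_of_eq ?_)
    congr 1
    field_simp
  have hsub : averageDeviation 𝒟 X f ε n ⊆
      {ω | n * ε ≤ 1 * (∑ t ∈ Finset.Icc 1 n, f (X t ω) - n * ∫ x, f x ∂𝒟)} ∪
      {ω | n * ε ≤ -1 * (∑ t ∈ Finset.Icc 1 n, f (X t ω) - n * ∫ x, f x ∂𝒟)} := by
    intro ω hω
    rw [averageDeviation, Set.mem_ofPred_eq] at hω
    rcases lt_abs.1 hω with h3 | h3
    · left; rw [Set.mem_ofPred_eq]; linarith
    · right; rw [Set.mem_ofPred_eq]; linarith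
  refine (measureReal_mono hsub).trans ((measureReal_union_le _ _).trans ?_)
  linarith [h1 1 (by norm_num), h1 (-1) (by norm_num)]

omit [IsProbabilityMeasure μ] [IsProbabilityMeasure 𝒟] in
lemma IidDraws.measurableSet_inaccurate (h : IidDraws 𝒟 μ T X) (ε : ℝ) :
    MeasurableSet (inaccurate 𝒟 T X ε) := by
  refine Finset.measurableSet_biUnion _ fun n hn => ?_
  have hn' := (Finset.mem_Icc.1 hn).2
  exact (h.measurableSet_averageDeviation measurable_cost ε hn').union
    (Finset.measurableSet_biUnion _ fun k _ =>
      h.measurableSet_averageDeviation (measurable_marginalSale _) ε hn')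

lemma IidDraws.measureReal_inaccurate_le (h : IidDraws 𝒟 μ T X) (hT : 12 ≤ T)
    (hD : LearningAssumption 𝒟 L) {ε : ℝ} (hε : 0 < ε) :
    μ.real (inaccurate 𝒟 T X ε) ≤ 1440 / (2 * ε ^ 2) ^ 6 * (1 / (T : ℝ) ^ 2) := by
  have hN3 := three_le_gridSize hT
  have hexp := explore_le hT
  have hxN := rpow_third_le_gridSize T
  have hx3 := rpow_third_pow T
  have hT0 : (0 : ℝ) < T := by positivity
  have hx0 : 0 < (T : ℝ) ^ (1 / 3 : ℝ) := by positivity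
  rw [inaccurate]
  set N := gridSize T with hN
  set x := (T : ℝ) ^ (1 / 3 : ℝ) with hx
  have hN9 : 9 ≤ N ^ 2 := by nlinarith
  have hdev : ∀ n ∈ Finset.Icc (N ^ 2) T, ∀ f : Outcome → ℝ, Measurable f →
      (∀ᵐ x ∂𝒟, f x ∈ Set.Icc (0 : ℝ) 1) →
      μ.real (averageDeviation 𝒟 X f ε n) ≤ 2 * Real.exp (-(2 * ε ^ 2 * x ^ 2)) := by
    intro n hn f hf hf01
    rw [Finset.mem_Icc] at hn
    refine (h.measureReal_averageDeviation_le hf hf01 hε.le (by omega) hn.2).trans ?_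
    have h1 : x ^ 2 ≤ (n : ℝ) := by
      calc x ^ 2 ≤ (N : ℝ) ^ 2 := by gcongr
        _ ≤ (n : ℝ) := by exact_mod_cast hn.1
    have h2 : x ^ 2 * ε ^ 2 ≤ n * ε ^ 2 := by gcongr
    gcongr
    linarith
  -- The `N + 3 ≤ T` averages taken at one time are handled by a union bound.
  have hone : ∀ n ∈ Finset.Icc (N ^ 2) T, μ.real (averageDeviation 𝒟 X cost ε n ∪
      ⋃ k ∈ Finset.range (N + 2), averageDeviation 𝒟 X (marginalSale ((k : ℝ) / ((N : ℝ) + 1))) ε n)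
      ≤ T * (2 * Real.exp (-(2 * ε ^ 2 * x ^ 2))) := by
    intro n hn
    refine (measureReal_union_le _ _).trans ((add_le_add (hdev n hn _ measurable_cost hD.cost_mem)
      ((measureReal_biUnion_finset_le _ _).trans (Finset.sum_le_sum fun k _ =>
        hdev n hn _ (measurable_marginalSale _) (hD.marginalSale_mem _)))).trans ?_)
    rw [Finset.sum_const, Finset.card_range, nsmul_eq_mul, ← one_add_mul]
    refine mul_le_mul_of_nonneg_right ?_ (by positivity)
    exact_mod_cast (show 1 + (N + 2) ≤ T by omega)
  refine (measureReal_biUnion_finset_le _ _).trans ((Finset.sum_le_sum hone).trans ?_)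
  rw [Finset.sum_const, Nat.card_Icc, nsmul_eq_mul]
  have hcard : ((T + 1 - N ^ 2 : ℕ) : ℝ) ≤ T := by exact_mod_cast (show T + 1 - N ^ 2 ≤ T by omega)
  have hpow := Real.pow_div_factorial_le_exp (2 * ε ^ 2 * x ^ 2) (by positivity) 6
  have hx12 : (x ^ 2) ^ 6 = (T : ℝ) ^ 4 := by rw [← hx3]; ring
  rw [mul_pow, hx12, show ((Nat.factorial 6 : ℕ) : ℝ) = 720 by norm_num [Nat.factorial]] at hpow
  have hinv : Real.exp (-(2 * ε ^ 2 * x ^ 2)) ≤ 720 / ((2 * ε ^ 2) ^ 6 * (T : ℝ) ^ 4) := by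
    rw [Real.exp_neg, ← one_div, div_le_div_iff₀ (Real.exp_pos _) (by positivity)]
    rw [div_le_iff₀ (by norm_num)] at hpow
    linarith
  calc ((T + 1 - N ^ 2 : ℕ) : ℝ) * (T * (2 * Real.exp (-(2 * ε ^ 2 * x ^ 2))))
      ≤ T * (T * (2 * (720 / ((2 * ε ^ 2) ^ 6 * (T : ℝ) ^ 4)))) := by gcongr
    _ = _ := by field_simp; norm_num

variable {W Q : ℕ → Ω → ℝ}

/-- Outside the exceptional event, all moves after the commitment are close to the equilibrium. -/
lemma LearningAssumption.exists_close (hD : LearningAssumption 𝒟 L) {ws qs : ℝ}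
    (hSE : IsStackelberg 𝒟 ws qs) {η : ℝ} (hη : 0 < η) :
    ∃ ε > 0, ∀ (T : ℕ) (X : ℕ → Ω → Outcome) (W Q : ℕ → Ω → ℝ), 12 ≤ T → IsPlay 𝒟 μ T X W Q →
      1 / ((gridSize T : ℝ) + 1) ≤ ε → ∀ᵐ ω ∂μ, ω ∉ inaccurate 𝒟 T X ε →
      ∀ t ∈ Finset.Icc (gridSize T ^ 2 + gridSize T + 1) T,
        |ws - W t ω| + |qs - Q t ω| ≤ η := by
  obtain ⟨ε, hε, hacc⟩ := hD.exists_accuracy hSE hη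
  refine ⟨ε, hε, fun T X W Q hT h hH => ?_⟩
  filter_upwards [h.realization hD] with ω hω hgood
  obtain ⟨S, hS⟩ := h.commitment ω
  have hN3 := three_le_gridSize hT
  have hexp := explore_le hT
  have hgood' : ∀ n ∈ Finset.Icc (gridSize T ^ 2) T, ω ∉ averageDeviation 𝒟 X cost ε n ∧
      ∀ k ∈ Finset.range (gridSize T + 2),
        ω ∉ averageDeviation 𝒟 X (marginalSale ((k : ℝ) / ((gridSize T : ℝ) + 1))) ε n :=
    fun n hn => ⟨fun h1 => hgood (Set.mem_biUnion hn (Or.inl h1)),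
      fun k hk h1 => hgood (Set.mem_biUnion hn (Or.inr (Set.mem_biUnion hk h1)))⟩
  refine hacc T _ _ _ _ S hT hω hS hH ?_ fun n hn k hk => ?_
  · have h1 := (hgood' (gridSize T ^ 2) (Finset.mem_Icc.2 (by omega))).1
    rw [averageDeviation, Set.mem_ofPred_eq, not_lt] at h1
    have hN0 : (0 : ℝ) < gridSize T := by exact_mod_cast (show 0 < gridSize T by omega)
    have e1 : ∑ j ∈ Finset.Icc 1 (gridSize T ^ 2), cost (X j ω)
        - ((gridSize T ^ 2 : ℕ) : ℝ) * ∫ x, cost x ∂𝒟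
        = (gridSize T : ℝ) ^ 2 * (costEstimate T X ω - ∫ x, cost x ∂𝒟) := by
      rw [costEstimate]; push_cast; field_simp
    rw [e1, abs_mul, abs_of_pos (by positivity)] at h1
    push_cast at h1
    exact le_of_mul_le_mul_left h1 (by positivity)
  · have h1 := (hgood' n hn).2 k (Finset.mem_range.2 (by omega))
    rw [averageDeviation, Set.mem_ofPred_eq, not_lt] at h1
    exact h1

end

lemma tendsto_gridSize : Tendsto (fun T : ℕ => (gridSize T : ℝ)) atTop atTop :=
  tendsto_atTop_mono rpow_third_le_gridSize
    ((tendsto_rpow_atTop (by norm_num)).comp tendsto_natCast_atTop_atTop)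

lemma eventually_inv_gridSize_le {ε : ℝ} (hε : 0 < ε) :
    ∀ᶠ T : ℕ in atTop, 1 / ((gridSize T : ℝ) + 1) ≤ ε := by
  have h1 : Tendsto (fun T : ℕ => 1 / ((gridSize T : ℝ) + 1)) atTop (𝓝 0) := by
    simp_rw [one_div]
    exact (tendsto_atTop_add_const_right _ _ tendsto_gridSize).inv_tendsto_atTop
  exact (h1.eventually_lt_const hε).mono fun _ h => h.le

variable {X : ℕ → ℕ → Ω → Outcome} {W Q : ℕ → ℕ → Ω → ℝ}

/-- The exceptional events of the plays with different horizons have summable probabilities. -/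
lemma summable_measureReal_inaccurate (hD : LearningAssumption 𝒟 L)
    (h : ∀ T : ℕ, 12 ≤ T → IsPlay 𝒟 μ T (X T) (W T) (Q T)) {ε : ℝ} (hε : 0 < ε) :
    Summable fun T : ℕ => μ.real (inaccurate 𝒟 T (X T) ε) := by
  rw [← summable_nat_add_iff 12]
  have h1 : Summable fun T : ℕ => 1440 / (2 * ε ^ 2) ^ 6 * (1 / (T : ℝ) ^ 2) :=
    (Real.summable_one_div_nat_pow.2 one_lt_two).mul_left _
  exact Summable.of_nonneg_of_le (fun _ => measureReal_nonneg)
    (fun T => (h (T + 12) (by omega)).protocol.iidDraws.measureReal_inaccurate_le (by omega) hD hε)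
    ((summable_nat_add_iff 12).2 h1)

omit [IsProbabilityMeasure μ] in
/-- If the integrals of nonnegative functions are summable, the functions tend to zero. -/
lemma ae_tendsto_zero_of_summable_integral {Z : ℕ → Ω → ℝ} (hZ : ∀ n, Integrable (Z n) μ)
    (hZ0 : ∀ n, 0 ≤ᵐ[μ] Z n) {u : ℕ → ℝ} (hu : ∀ n, ∫ ω, Z n ω ∂μ ≤ u n) (hsum : Summable u) :
    ∀ᵐ ω ∂μ, Tendsto (fun n => Z n ω) atTop (𝓝 0) := by
  have hs : Summable fun n => ∫ ω, Z n ω ∂μ :=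
    Summable.of_nonneg_of_le (fun n => integral_nonneg_of_ae (hZ0 n)) hu hsum
  have hint : ∫⁻ ω, ∑' n, ENNReal.ofReal (Z n ω) ∂μ ≠ ⊤ := by
    rw [lintegral_tsum fun n => (hZ n).aemeasurable.ennreal_ofReal]
    simp_rw [← fun n => ofReal_integral_eq_lintegral_ofReal (hZ n) (hZ0 n)]
    exact hs.tsum_ofReal_ne_top
  have hfin := ae_lt_top' (AEMeasurable.tsum fun n => (hZ n).aemeasurable.ennreal_ofReal) hint
  filter_upwards [hfin, ae_all_iff.2 hZ0] with ω hω h0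
  have h1 := ENNReal.tendsto_atTop_zero_of_tsum_ne_top hω.ne
  have h2 := (ENNReal.tendsto_toReal ENNReal.zero_ne_top).comp h1
  refine (tendsto_congr fun n => ?_).1 h2
  exact ENNReal.toReal_ofReal (h0 n)

end

/-! ### Rounds before the commitment -/

section

variable {Ω : Type*} [MeasurableSpace Ω] {μ : Measure Ω} [IsProbabilityMeasure μ]
variable {𝒟 : Measure Outcome} [IsProbabilityMeasure 𝒟] {L : ℝ}

lemma tendsto_explore_div :
    Tendsto (fun T : ℕ => ((gridSize T : ℝ) ^ 2 + gridSize T) / T) atTop (𝓝 0) := by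
  have hx : Tendsto (fun T : ℕ => (T : ℝ) ^ (1 / 3 : ℝ)) atTop atTop :=
    (tendsto_rpow_atTop (by norm_num)).comp tendsto_natCast_atTop_atTop
  have h0 : Tendsto (fun T : ℕ => 6 * ((T : ℝ) ^ (1 / 3 : ℝ))⁻¹) atTop (𝓝 0) := by
    simpa using hx.inv_tendsto_atTop.const_mul 6
  refine squeeze_zero' (Eventually.of_forall fun T => by positivity) ?_ h0
  filter_upwards [hx.eventually_ge_atTop 1] with T h1
  have hlt := gridSize_lt T
  have h3 := rpow_third_pow T
  rw [show ((gridSize T : ℝ) ^ 2 + gridSize T) / T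
    = ((gridSize T : ℝ) ^ 2 + gridSize T) / ((T : ℝ) ^ (1 / 3 : ℝ)) ^ 3 by rw [h3]]
  generalize (T : ℝ) ^ (1 / 3 : ℝ) = x at *
  have hx0 : 0 < x := by linarith
  rw [div_le_iff₀ (by positivity)]
  calc (gridSize T : ℝ) ^ 2 + gridSize T ≤ (x + 1) ^ 2 + (x + 1) := by gcongr
    _ ≤ 6 * x ^ 2 := by nlinarith
    _ = 6 * x⁻¹ * x ^ 3 := by field_simp

lemma eventually_explore_lt : ∀ᶠ T : ℕ in atTop, gridSize T ^ 2 + gridSize T + 1 ≤ T := by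
  filter_upwards [tendsto_explore_div.eventually_lt_const one_pos, eventually_gt_atTop 0]
    with T h1 h2
  rw [div_lt_one (by exact_mod_cast h2)] at h1
  exact_mod_cast h1

lemma tendsto_zero_of_forall_eventually_le {u : ℕ → ℝ} (h0 : ∀ n, 0 ≤ u n)
    (h : ∀ m : ℕ, ∀ᶠ n in atTop, u n ≤ 1 / ((m : ℝ) + 1)) : Tendsto u atTop (𝓝 0) := by
  refine tendsto_order.2 ⟨fun a ha => Eventually.of_forall fun n => ha.trans_le (h0 n),
    fun a ha => ?_⟩
  obtain ⟨m, hm⟩ := exists_nat_one_div_lt ha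
  exact (h m).mono fun n hn => hn.trans_lt hm

/-! ### The average utility of the retailer -/

lemma measurable_rho_comp {α : Type*} [MeasurableSpace α] {Q W : α → ℝ} {X : α → Outcome}
    (hQ : Measurable Q) (hW : Measurable W) (hX : Measurable X) :
    Measurable fun ω => rho (Q ω) (W ω) (price (X ω)) (demand (X ω)) :=
  ((hQ.min (measurable_demand.comp hX)).mul (measurable_price.comp hX)).sub (hQ.mul hW)

lemma rho_mem_Icc {q w p d : ℝ} (hq : q ∈ Set.Icc (0 : ℝ) 1) (hw : w ∈ Set.Icc (0 : ℝ) 1)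
    (hp : p ∈ Set.Icc (0 : ℝ) 1) (hd : d ∈ Set.Icc (0 : ℝ) 1) :
    rho q w p d ∈ Set.Icc (-1 : ℝ) 1 := by
  have h1 : 0 ≤ min q d * p := mul_nonneg (le_min hq.1 hd.1) hp.1
  have h2 : min q d * p ≤ 1 := mul_le_one₀ ((min_le_left _ _).trans hq.2) hp.1 hp.2
  have h3 : 0 ≤ q * w := mul_nonneg hq.1 hw.1
  have h4 : q * w ≤ 1 := mul_le_one₀ hq.2 hw.1 hw.2
  rw [rho]
  constructor <;> linarith

lemma abs_rho_sub_le {q w q' w' p d : ℝ} (hw : w ∈ Set.Icc (0 : ℝ) 1)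
    (hq' : q' ∈ Set.Icc (0 : ℝ) 1) (hp : p ∈ Set.Icc (0 : ℝ) 1) :
    |rho q w p d - rho q' w' p d| ≤ 2 * (|w' - w| + |q' - q|) := by
  have h1 : |min q d - min q' d| ≤ |q - q'| := abs_inf_sub_inf_le_abs q q' d
  have e : rho q w p d - rho q' w' p d
      = (min q d - min q' d) * p - (q - q') * w - q' * (w - w') := by
    rw [rho, rho]; ring
  have h2 : |(min q d - min q' d) * p| ≤ |q - q'| := by
    rw [abs_mul, abs_of_nonneg hp.1]
    exact (mul_le_of_le_one_right (abs_nonneg _) hp.2).trans h1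
  have h3 : |(q - q') * w| ≤ |q - q'| := by
    rw [abs_mul, abs_of_nonneg hw.1]
    exact mul_le_of_le_one_right (abs_nonneg _) hw.2
  have h4 : |q' * (w - w')| ≤ |w - w'| := by
    rw [abs_mul, abs_of_nonneg hq'.1]
    exact mul_le_of_le_one_left (abs_nonneg _) hq'.2
  rw [e, abs_sub_comm w' w, abs_sub_comm q' q]
  have h5 := abs_sub ((min q d - min q' d) * p - (q - q') * w) (q' * (w - w'))
  have h6 := abs_sub ((min q d - min q' d) * p) ((q - q') * w)
  linarith [abs_nonneg (w - w')]

omit [IsProbabilityMeasure 𝒟] in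
/-- If an integrable function is within `B` of a function of the draw, and the draw is independent
of `m`, then its conditional expectation given `m` is within that of `B` of the mean. -/
lemma abs_integral_sub_condExp_le {α : Type*} {m m0 : MeasurableSpace α} {ν : Measure α}
    [IsProbabilityMeasure ν] (hm : m ≤ m0) {Y : α → Outcome} (hY : Measurable Y)
    (hlaw : ν.map Y = 𝒟)
    (hind : Indep (MeasurableSpace.comap Y inferInstance) m ν) {f : Outcome → ℝ}
    (hf : Measurable f) {U B : α → ℝ} (hU : Integrable U ν) (hfi : Integrable (fun ω => f (Y ω)) ν)
    (hB : Integrable B ν) (hUB : ∀ᵐ ω ∂ν, |U ω - f (Y ω)| ≤ B ω) :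
    ∀ᵐ ω ∂ν, |∫ x, f x ∂𝒟 - (ν[U | m]) ω| ≤ (ν[B | m]) ω := by
  have hfY : StronglyMeasurable[MeasurableSpace.comap Y inferInstance] fun ω => f (Y ω) :=
    (hf.comp (comap_measurable Y)).stronglyMeasurable
  have h1 := condExp_indep_eq (μ := ν) hY.comap_le hm hfY hind
  have hint : ∫ ω, f (Y ω) ∂ν = ∫ x, f x ∂𝒟 := by
    rw [← hlaw, integral_map hY.aemeasurable hf.aestronglyMeasurable]
  have h2 := condExp_sub hU hfi m
  have h3 : ν[U - (fun ω => f (Y ω)) | m] ≤ᵐ[ν] ν[B | m] :=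
    condExp_mono (hU.sub hfi) hB (hUB.mono fun ω hω => (abs_le.1 hω).2)
  have h4 : ν[-B | m] ≤ᵐ[ν] ν[U - (fun ω => f (Y ω)) | m] :=
    condExp_mono hB.neg (hU.sub hfi) (hUB.mono fun ω hω => (abs_le.1 hω).1)
  filter_upwards [h1, h2, h3, h4, condExp_neg B m] with ω g1 g2 g3 g4 g5
  rw [g5] at g4
  rw [g2, Pi.sub_apply, g1, hint] at g3 g4
  rw [Pi.neg_apply] at g4
  rw [abs_sub_comm, abs_le]
  exact ⟨g4, g3⟩

/-- The average over the rounds of the conditional probabilities of an event given the wholesale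
prices. -/
noncomputable def averageCondProb (μ : Measure Ω) (T : ℕ) (W : ℕ → Ω → ℝ) (E : Set Ω) (ω : Ω) : ℝ :=
  1 / (T : ℝ) * ∑ t ∈ Finset.Icc 1 T,
    (μ[E.indicator (1 : Ω → ℝ) | MeasurableSpace.comap (W t) inferInstance]) ω

/-- The average of the retailer's conditional utilities is close to the equilibrium utility, as soon
as the moves after the commitment are `η`-close to the equilibrium outside an improbable event. -/
lemma IsPlay.abs_average_rho_le {T : ℕ} {X : ℕ → Ω → Outcome} {W Q : ℕ → Ω → ℝ}
    (h : IsPlay 𝒟 μ T X W Q) (hT : 12 ≤ T) (hD : LearningAssumption 𝒟 L) {ws qs η : ℝ}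
    (hws : ws ∈ Set.Icc (0 : ℝ) 1) (hqs : qs ∈ Set.Icc (0 : ℝ) 1) (hη : 0 ≤ η) {E : Set Ω}
    (hE : MeasurableSet E) (hclose : ∀ᵐ ω ∂μ, ω ∉ E →
      ∀ t ∈ Finset.Icc (gridSize T ^ 2 + gridSize T + 1) T, |ws - W t ω| + |qs - Q t ω| ≤ η) :
    ∀ᵐ ω ∂μ, |∫ x, rho qs ws (price x) (demand x) ∂𝒟 - 1 / (T : ℝ) * ∑ t ∈ Finset.Icc 1 T,
        (μ[fun ω' => rho (Q t ω') (W t ω') (price (X t ω')) (demand (X t ω')) |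
          MeasurableSpace.comap (W t) inferInstance]) ω|
      ≤ 2 * (((gridSize T : ℝ) ^ 2 + gridSize T) / T) + 2 * η + 2 * averageCondProb μ T W E ω := by
  have hexp := explore_le hT
  have hT0 : (0 : ℝ) < T := by positivity
  have hiid := h.protocol.iidDraws
  set b : ℕ → ℝ := fun t => if t ≤ gridSize T ^ 2 + gridSize T then 2 else 2 * η with hb
  have hI : Integrable (E.indicator (1 : Ω → ℝ)) μ := (integrable_const (1 : ℝ)).indicator hE
  have hind0 : ∀ ω, 0 ≤ E.indicator (1 : Ω → ℝ) ω := fun ω =>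
    Set.indicator_nonneg (fun _ _ => zero_le_one) ω
  have hround : ∀ t ∈ Finset.Icc 1 T, ∀ᵐ ω ∂μ, |∫ x, rho qs ws (price x) (demand x) ∂𝒟
      - (μ[fun ω' => rho (Q t ω') (W t ω') (price (X t ω')) (demand (X t ω')) |
          MeasurableSpace.comap (W t) inferInstance]) ω|
      ≤ b t + 2 * (μ[E.indicator (1 : Ω → ℝ) | MeasurableSpace.comap (W t) inferInstance]) ω := by
    intro t ht
    have hWm := h.protocol.measurable_wholesale ht
    have hQm := h.protocol.measurable_quantity ht
    have hXm := hiid.measurable t ht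
    have hbasic : ∀ᵐ ω ∂μ, Q t ω ∈ Set.Icc (0 : ℝ) 1 ∧ W t ω ∈ Set.Icc (0 : ℝ) 1 ∧
        price (X t ω) ∈ Set.Icc (0 : ℝ) 1 ∧ demand (X t ω) ∈ Set.Icc (0 : ℝ) 1 := by
      filter_upwards [h.realization hD] with ω hω
      exact ⟨⟨(hω.quantity_pos ht).le, hω.quantity_le_one ht⟩,
        hω.wholesale_mem (h.commitment ω).choose_spec ht, hω.price_mem t ht, hω.demand_mem t ht⟩
    have hU := integrable_of_ae_mem_Icc (measurable_rho_comp hQm hWm hXm) (hbasic.mono fun ω hω =>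
      rho_mem_Icc hω.1 hω.2.1 hω.2.2.1 hω.2.2.2)
    have hf : Measurable fun x : Outcome => rho qs ws (price x) (demand x) :=
      measurable_rho_comp measurable_const measurable_const measurable_id
    have hR := integrable_of_ae_mem_Icc (hf.comp hXm) (hbasic.mono fun ω hω =>
      rho_mem_Icc hqs hws hω.2.2.1 hω.2.2.2)
    have hB : Integrable ((fun _ => b t) + (2 : ℝ) • E.indicator (1 : Ω → ℝ)) μ :=
      (integrable_const _).add (hI.smul 2)
    have h1 := abs_integral_sub_condExp_le hWm.comap_le hXm (hiid.law t ht)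
      (h.protocol.indep_wholesale ht) hf hU hR hB (by
        filter_upwards [hbasic, hclose] with ω hω hω'
        rw [Pi.add_apply, Pi.smul_apply, smul_eq_mul]
        simp only [hb]
        have h2 := hind0 ω
        have hbnd : |rho (Q t ω) (W t ω) (price (X t ω)) (demand (X t ω))
            - rho qs ws (price (X t ω)) (demand (X t ω))| ≤ 2 := by
          have g1 := rho_mem_Icc hω.1 hω.2.1 hω.2.2.1 hω.2.2.2
          have g2 := rho_mem_Icc hqs hws hω.2.2.1 hω.2.2.2
          rw [abs_le]
          constructor <;> linarith [g1.1, g1.2, g2.1, g2.2]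
        by_cases hEω : ω ∈ E
        · rw [Set.indicator_of_mem hEω, Pi.one_apply]
          split_ifs <;> linarith
        · split_ifs with hte
          · linarith
          · rw [Finset.mem_Icc] at ht
            have h3 := hω' hEω t (Finset.mem_Icc.2 ⟨by omega, ht.2⟩)
            have h4 := abs_rho_sub_le (q := Q t ω) (w' := ws) (d := demand (X t ω)) hω.2.1 hqs
              hω.2.2.1
            linarith)
    filter_upwards [h1, condExp_add (integrable_const (b t)) (hI.smul (2 : ℝ))
      (MeasurableSpace.comap (W t) inferInstance), condExp_smul (μ := μ) (2 : ℝ)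
        (E.indicator (1 : Ω → ℝ)) (MeasurableSpace.comap (W t) inferInstance)] with ω g1 g2 g3
    rw [g2, Pi.add_apply, g3, condExp_const hWm.comap_le] at g1
    exact g1
  have hall : ∀ᵐ ω ∂μ, ∀ t ∈ Finset.Icc 1 T, |∫ x, rho qs ws (price x) (demand x) ∂𝒟
      - (μ[fun ω' => rho (Q t ω') (W t ω') (price (X t ω')) (demand (X t ω')) |
          MeasurableSpace.comap (W t) inferInstance]) ω|
      ≤ b t + 2 * (μ[E.indicator (1 : Ω → ℝ) | MeasurableSpace.comap (W t) inferInstance]) ω :=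
    (ae_ball_iff (Finset.Icc 1 T).countable_toSet).2 hround
  have hbsum : ∑ t ∈ Finset.Icc 1 T, b t
      ≤ 2 * ((gridSize T : ℝ) ^ 2 + gridSize T) + T * (2 * η) := by
    have hsplit : Finset.Icc 1 T = Finset.Icc 1 (gridSize T ^ 2 + gridSize T)
        ∪ Finset.Icc (gridSize T ^ 2 + gridSize T + 1) T := by
      ext i; simp only [Finset.mem_union, Finset.mem_Icc]; omega
    have hdisj : Disjoint (Finset.Icc 1 (gridSize T ^ 2 + gridSize T))
        (Finset.Icc (gridSize T ^ 2 + gridSize T + 1) T) := by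
      rw [Finset.disjoint_left]; intro i hi hi'; rw [Finset.mem_Icc] at hi hi'; omega
    rw [hsplit, Finset.sum_union hdisj,
      Finset.sum_congr rfl fun t ht => if_pos (Finset.mem_Icc.1 ht).2,
      Finset.sum_congr (g := fun _ => 2 * η) rfl fun t ht =>
        if_neg (by have := (Finset.mem_Icc.1 ht).1; omega),
      Finset.sum_const, Finset.sum_const, Nat.card_Icc, Nat.card_Icc, nsmul_eq_mul, nsmul_eq_mul]
    have h1 : ((T + 1 - (gridSize T ^ 2 + gridSize T + 1) : ℕ) : ℝ) ≤ T := by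
      exact_mod_cast (by omega)
    have h2 := mul_le_mul_of_nonneg_right h1 (show 0 ≤ 2 * η by linarith)
    push_cast [Nat.add_sub_cancel] at h2 ⊢
    linarith
  filter_upwards [hall] with ω hω
  set u : ℕ → ℝ := fun t => (μ[fun ω' => rho (Q t ω') (W t ω') (price (X t ω')) (demand (X t ω')) |
    MeasurableSpace.comap (W t) inferInstance]) ω with hu
  set z : ℕ → ℝ := fun t =>
    (μ[E.indicator (1 : Ω → ℝ) | MeasurableSpace.comap (W t) inferInstance]) ω with hz
  set R := ∫ x, rho qs ws (price x) (demand x) ∂𝒟 with hR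
  have e1 : R - 1 / (T : ℝ) * ∑ t ∈ Finset.Icc 1 T, u t
      = 1 / (T : ℝ) * ∑ t ∈ Finset.Icc 1 T, (R - u t) := by
    rw [Finset.sum_sub_distrib, Finset.sum_const, Nat.card_Icc, Nat.add_sub_cancel, nsmul_eq_mul]
    field_simp
  have e2 : averageCondProb μ T W E ω = 1 / (T : ℝ) * ∑ t ∈ Finset.Icc 1 T, z t := rfl
  rw [e1, e2, abs_mul, abs_of_pos (show 0 < 1 / (T : ℝ) by positivity)]
  have h1 : |∑ t ∈ Finset.Icc 1 T, (R - u t)| ≤ ∑ t ∈ Finset.Icc 1 T, (b t + 2 * z t) :=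
    (Finset.abs_sum_le_sum_abs _ _).trans (Finset.sum_le_sum hω)
  rw [Finset.sum_add_distrib, ← Finset.mul_sum] at h1
  calc 1 / (T : ℝ) * |∑ t ∈ Finset.Icc 1 T, (R - u t)|
      ≤ 1 / (T : ℝ) * ((2 * ((gridSize T : ℝ) ^ 2 + gridSize T) + T * (2 * η))
          + 2 * ∑ t ∈ Finset.Icc 1 T, z t) := by gcongr; linarith
    _ = _ := by field_simp

omit [IsProbabilityMeasure 𝒟] in
lemma averageCondProb_bounds {T : ℕ} {W : ℕ → Ω → ℝ} (hT : 0 < T)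
    (hW : ∀ t ∈ Finset.Icc 1 T, Measurable (W t)) {E : Set Ω} (hE : MeasurableSet E) :
    Integrable (averageCondProb μ T W E) μ ∧ 0 ≤ᵐ[μ] averageCondProb μ T W E ∧
      ∫ ω, averageCondProb μ T W E ω ∂μ = μ.real E := by
  have hT0 : (0 : ℝ) < T := by exact_mod_cast hT
  have hI : Integrable (E.indicator (1 : Ω → ℝ)) μ := (integrable_const (1 : ℝ)).indicator hE
  refine ⟨(integrable_finsetSum _ fun t _ => integrable_condExp).const_mul _, ?_, ?_⟩
  · have h1 : ∀ᵐ ω ∂μ, ∀ t ∈ Finset.Icc 1 T,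
        0 ≤ (μ[E.indicator (1 : Ω → ℝ) | MeasurableSpace.comap (W t) inferInstance]) ω :=
      (ae_ball_iff (Finset.Icc 1 T).countable_toSet).2 fun t _ =>
        condExp_nonneg (Eventually.of_forall fun ω =>
          Set.indicator_nonneg (fun _ _ => zero_le_one) ω)
    filter_upwards [h1] with ω hω
    exact mul_nonneg (by positivity) (Finset.sum_nonneg hω)
  · simp only [averageCondProb]
    rw [integral_const_mul, integral_finsetSum _ fun t _ => integrable_condExp,
      Finset.sum_congr rfl fun t ht => (integral_condExp (hW t ht).comap_le).trans
        (integral_indicator_one hE), Finset.sum_const, Nat.card_Icc, Nat.add_sub_cancel,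
      nsmul_eq_mul]
    field_simp

/-! ### Almost sure convergence -/

variable {X : ℕ → ℕ → Ω → Outcome} {W Q : ℕ → ℕ → Ω → ℝ}

/-- The moves of the last round converge to the equilibrium almost surely, by the Borel–Cantelli
lemma. -/
lemma ae_tendsto_moves (hD : LearningAssumption 𝒟 L) {ws qs : ℝ} (hSE : IsStackelberg 𝒟 ws qs)
    (h : ∀ T : ℕ, 12 ≤ T → IsPlay 𝒟 μ T (X T) (W T) (Q T)) :
    ∀ᵐ ω ∂μ, Tendsto (fun T : ℕ => |ws - W T T ω| + |qs - Q T T ω|) atTop (𝓝 0) := by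
  have key : ∀ m : ℕ, ∀ᵐ ω ∂μ, ∀ᶠ T : ℕ in atTop,
      |ws - W T T ω| + |qs - Q T T ω| ≤ 1 / ((m : ℝ) + 1) := by
    intro m
    obtain ⟨ε, hε, hclose⟩ := hD.exists_close (μ := μ) hSE
      (show 0 < 1 / ((m : ℝ) + 1) by positivity)
    have hsum : ∑' T, μ (inaccurate 𝒟 T (X T) ε) ≠ ⊤ := by
      have := (summable_measureReal_inaccurate hD h hε).tsum_ofReal_ne_top
      simpa using this
    have hall : ∀ᵐ ω ∂μ, ∀ T : ℕ, 12 ≤ T → 1 / ((gridSize T : ℝ) + 1) ≤ ε →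
        ω ∉ inaccurate 𝒟 T (X T) ε → ∀ t ∈ Finset.Icc (gridSize T ^ 2 + gridSize T + 1) T,
          |ws - W T t ω| + |qs - Q T t ω| ≤ 1 / ((m : ℝ) + 1) := by
      rw [ae_all_iff]
      intro T
      by_cases hT : 12 ≤ T ∧ 1 / ((gridSize T : ℝ) + 1) ≤ ε
      · filter_upwards [hclose T (X T) (W T) (Q T) hT.1 (h T hT.1) hT.2] with ω hω _ _ using hω
      · exact Eventually.of_forall fun ω h1 h2 => absurd ⟨h1, h2⟩ hT
    filter_upwards [hall, ae_eventually_notMem hsum] with ω hω hbc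
    filter_upwards [hbc, eventually_ge_atTop 12, eventually_inv_gridSize_le hε,
      eventually_explore_lt] with T h1 h2 h3 h4
    exact hω T h2 h3 h1 T (Finset.mem_Icc.2 ⟨h4, le_rfl⟩)
  filter_upwards [ae_all_iff.2 key] with ω hω
  exact tendsto_zero_of_forall_eventually_le (fun T => by positivity) hω

/-- The average of the retailer's conditional utilities converges almost surely. -/
lemma ae_tendsto_average_rho (hD : LearningAssumption 𝒟 L) {ws qs : ℝ}
    (hSE : IsStackelberg 𝒟 ws qs)
    (h : ∀ T : ℕ, 12 ≤ T → IsPlay 𝒟 μ T (X T) (W T) (Q T)) :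
    ∀ᵐ ω ∂μ, Tendsto (fun T : ℕ => (∫ x, rho qs ws (price x) (demand x) ∂𝒟)
      - 1 / (T : ℝ) * ∑ t ∈ Finset.Icc 1 T,
        (μ[fun ω' => rho (Q T t ω') (W T t ω') (price (X T t ω')) (demand (X T t ω')) |
          MeasurableSpace.comap (W T t) inferInstance]) ω) atTop (𝓝 0) := by
  obtain ⟨hws, hqs, -⟩ := hD.equilibrium hSE
  have hws' : ws ∈ Set.Icc (0 : ℝ) 1 := hws ▸ hD.marginalRevenue_mem qs
  set F : ℕ → Ω → ℝ := fun T ω => (∫ x, rho qs ws (price x) (demand x) ∂𝒟)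
      - 1 / (T : ℝ) * ∑ t ∈ Finset.Icc 1 T,
        (μ[fun ω' => rho (Q T t ω') (W T t ω') (price (X T t ω')) (demand (X T t ω')) |
          MeasurableSpace.comap (W T t) inferInstance]) ω with hF
  have key : ∀ m : ℕ, ∀ᵐ ω ∂μ, ∀ᶠ T : ℕ in atTop, |F T ω| ≤ 1 / ((m : ℝ) + 1) := by
    intro m
    have hη : 0 < 1 / ((m : ℝ) + 1) / 4 := by positivity
    obtain ⟨ε, hε, hclose⟩ := hD.exists_close (μ := μ) hSE hη
    set E : ℕ → Set Ω := fun T => inaccurate 𝒟 T (X T) ε with hE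
    have hEm : ∀ T, 12 ≤ T → MeasurableSet (E T) := fun T hT =>
      (h T hT).protocol.iidDraws.measurableSet_inaccurate ε
    have hb : ∀ T, Integrable (averageCondProb μ (T + 12) (W (T + 12)) (E (T + 12))) μ ∧
        0 ≤ᵐ[μ] averageCondProb μ (T + 12) (W (T + 12)) (E (T + 12)) ∧
        ∫ ω, averageCondProb μ (T + 12) (W (T + 12)) (E (T + 12)) ω ∂μ = μ.real (E (T + 12)) :=
      fun T => averageCondProb_bounds (by omega)
        (fun t ht => (h (T + 12) (by omega)).protocol.measurable_wholesale ht) (hEm _ (by omega))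
    have hsum : Summable fun T => μ.real (E T) := summable_measureReal_inaccurate hD h hε
    have hZ := ae_tendsto_zero_of_summable_integral (μ := μ)
      (Z := fun T => averageCondProb μ (T + 12) (W (T + 12)) (E (T + 12)))
      (u := fun T => μ.real (E (T + 12))) (fun T => (hb T).1) (fun T => (hb T).2.1)
      (fun T => (hb T).2.2.le) ((summable_nat_add_iff (f := fun T => μ.real (E T)) 12).2 hsum)
    have hall : ∀ᵐ ω ∂μ, ∀ T : ℕ, 12 ≤ T → 1 / ((gridSize T : ℝ) + 1) ≤ ε →
        |F T ω| ≤ 2 * (((gridSize T : ℝ) ^ 2 + gridSize T) / T) + 2 * (1 / ((m : ℝ) + 1) / 4)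
          + 2 * averageCondProb μ T (W T) (E T) ω := by
      rw [ae_all_iff]
      intro T
      by_cases hT : 12 ≤ T ∧ 1 / ((gridSize T : ℝ) + 1) ≤ ε
      · filter_upwards [(h T hT.1).abs_average_rho_le hT.1 hD hws' ⟨hqs.1.le, hqs.2.le⟩ hη.le
          (hEm T hT.1) (hclose T (X T) (W T) (Q T) hT.1 (h T hT.1) hT.2)] with ω hω _ _ using hω
      · exact Eventually.of_forall fun ω h1 h2 => absurd ⟨h1, h2⟩ hT
    filter_upwards [hall, hZ] with ω hω hz
    have hz' : Tendsto (fun T => averageCondProb μ T (W T) (E T) ω) atTop (𝓝 0) :=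
      (tendsto_add_atTop_iff_nat (f := fun T => averageCondProb μ T (W T) (E T) ω) 12).1 hz
    have h8 : 0 < 1 / ((m : ℝ) + 1) / 8 := by positivity
    filter_upwards [eventually_ge_atTop 12, eventually_inv_gridSize_le hε,
      hz'.eventually_lt_const h8, tendsto_explore_div.eventually_lt_const h8] with T h1 h2 h3 h4
    have h5 := hω T h1 h2
    linarith
  filter_upwards [ae_all_iff.2 key] with ω hω
  exact (tendsto_zero_iff_abs_tendsto_zero _).2
    (tendsto_zero_of_forall_eventually_le (fun T => abs_nonneg _) hω)

end

end SupplyChain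

theorem theorem5
    (𝒟 : Measure SupplyChain.Outcome) [IsProbabilityMeasure 𝒟] (L : ℝ)
    (h𝒟 : SupplyChain.LearningAssumption 𝒟 L)
    (wstar qstar : ℝ) (hSE : SupplyChain.IsStackelberg 𝒟 wstar qstar)
    {Ω : Type*} [MeasurableSpace Ω] (μ : Measure Ω) [IsProbabilityMeasure μ] :
    (∀ T : ℕ, 12 ≤ T → ∀ (X : ℕ → Ω → SupplyChain.Outcome) (W Q : ℕ → Ω → ℝ),
      SupplyChain.IsPlay 𝒟 μ T X W Q →
      (∫ x, SupplyChain.sigma wstar qstar (SupplyChain.cost x) ∂𝒟)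
          - 1 / (T : ℝ) * ∑ t ∈ Finset.Icc 1 T,
              ∫ ω, SupplyChain.sigma (W t ω) (Q t ω) (SupplyChain.cost (X t ω)) ∂μ
        ≤ (16 + (1 - ∫ x, SupplyChain.cost x ∂𝒟) / ((∫ x, SupplyChain.price x ∂𝒟) * L)
            + 7 * Real.sqrt (Real.log T)) * (T : ℝ) ^ (-(1 / 3) : ℝ)) ∧
    (∀ (X : ℕ → ℕ → Ω → SupplyChain.Outcome) (W Q : ℕ → ℕ → Ω → ℝ),
      (∀ T : ℕ, 12 ≤ T → SupplyChain.IsPlay 𝒟 μ T (X T) (W T) (Q T)) →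
      (∀ᵐ ω ∂μ, Tendsto (fun T : ℕ =>
        (∫ x, SupplyChain.rho qstar wstar (SupplyChain.price x) (SupplyChain.demand x) ∂𝒟)
          - 1 / (T : ℝ) * ∑ t ∈ Finset.Icc 1 T,
              (μ[fun ω' => SupplyChain.rho (Q T t ω') (W T t ω') (SupplyChain.price (X T t ω'))
                  (SupplyChain.demand (X T t ω')) | MeasurableSpace.comap (W T t) inferInstance]) ω)
        atTop (𝓝 0)) ∧
      (∀ᵐ ω ∂μ, Tendsto (fun T : ℕ => |wstar - W T T ω| + |qstar - Q T T ω|) atTop (𝓝 0))) := by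
  obtain ⟨hw, hq, hpos, -⟩ := h𝒟.equilibrium hSE
  refine ⟨fun T hT X W Q h => ?_, fun X W Q h => ⟨SupplyChain.ae_tendsto_average_rho h𝒟 hSE h,
    SupplyChain.ae_tendsto_moves h𝒟 hSE h⟩⟩
  have hsig : ∫ x, SupplyChain.sigma wstar qstar (SupplyChain.cost x) ∂𝒟
      = SupplyChain.supplierValue 𝒟 qstar := by
    have hc : Integrable SupplyChain.cost 𝒟 :=
      SupplyChain.integrable_of_ae_mem_Icc SupplyChain.measurable_cost h𝒟.cost_mem
    simp only [SupplyChain.sigma]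
    rw [integral_sub (integrable_const _) (hc.const_mul _), integral_const, probReal_univ, one_smul,
      integral_const_mul, SupplyChain.supplierValue, hw]
    ring
  rw [hsig]
  exact h.regret_le hT h𝒟 hq hpos
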